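/- Let $g=(g_j)_{j\in J}$ be a finite family of real polynomials in $x=(x_1,\dots,x_n)$, let $f$ be a real polynomial, let $d\ge 1$, and let $x^{\le d}$ denote the vector of all monomials of degree at most $d$. A degree-$2d$ SoS proof of $f\le c$ from the constraints $\{g_j=0\}_{j\in J}$ consists of a positive semidefinite matrix $A$ indexed by the monomials of degree at most $d$, and polynomials $(q_j)_{j\in J}$ with $\deg(q_jg_j)\le 2d$, such that $$c-f(x)=\big\langle A,\;x^{\le d}(x^{\le d})^{\top}\big\rangle+\sum_{j\in J}q_j(x)g_j(x)$$ as polynomials. The proof has all coefficients bounded by $B$ if $|c|$, all entries of $A$, all coefficients of every $q_j$, and all coefficients of $\sum_j q_jg_j$ are at most $B$ in absolute value. The degree-$2d$ SoS optimum of the problem $\max\{f : g_j=0\ \forall j\in J\}$ is the least $c$ for which a degree-$2d$ SoS proof of $f\le c$ exists. For every constant $K\in\mathbb N$ there is a constant $K'\in\mathbb N$ such that the following holds for all $n\ge 2$ and $d\ge 1$. For each of the following optimization problems, the degree-$2d$ SoS optimum $c^\ast$ exists (in particular the minimum is attained), and $f\le c^\ast$ has a degree-$2d$ SoS proof with all coefficients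 bounded by $n^{K'd}$. In (1)–(4), $f$ is an arbitrary objective polynomial of degree at most $2d$ whose coefficients are all at most $n^{Kd}$ in absolute value. 1. The hypercube: the constraints are $\{x_i^2=x_i\}_{i\in[n]}$, or $\{x_i^2=1\}_{i\in[n]}$. 2. The hypercube with balancedness: $n$ is even and the constraints are $\{x_i^2=1\}_{i\in[n]}\cup\{\sum_i x_i=0\}$. 3. The unit sphere: the constraint is $\sum_i x_i^2=1$. 4. The sparse hypercube: for an integer $k$ with $2d\le k\le n$, the constraints are $\{x_i^2=x_i\}_{i\in[n]}\cup\{\sum_i x_i=k\}$; or, for an integer $k$ with $2d\le k$ and $\lfloor d/2\rfloor\le n-k$, they are $\{x_i^3=x_i\}_{i\in[n]}\cup\{\sum_i x_i^2=k\}$. 5. Max clique: for a graph $G$ on the vertex set $[n]$, the constraints are $\{x_i^2=x_i\}_{i\in[n]}\cup\{x_ix_j=0 : i\ne j,\ ij\notin E(G)\}$, and the objective is $f=\sum_i x_i$. -/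

import Mathlib

open MvPolynomial

noncomputable section

/-- The exponent vectors of the monomials of degree at most `d` in `n` variables. -/
def monomialsUpTo (n d : ℕ) : Finset (Fin n →₀ ℕ) :=
  (Finset.range (d + 1)).biUnion fun j => Finset.finsuppAntidiag Finset.univ j

theorem mem_monomialsUpTo {n d : ℕ} {m : Fin n →₀ ℕ} :
    m ∈ monomialsUpTo n d ↔ ∑ i, m i ≤ d := by
  simp [monomialsUpTo, Finset.mem_finsuppAntidiag]

/-- The polynomial `⟨A, x^{≤ d} (x^{≤ d})ᵀ⟩`, where `x^{≤ d}` is the vector of all monomials of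
degree at most `d`. It is a sum of squares of polynomials of degree at most `d` exactly when it
can be written in this form with a positive semidefinite `A`. -/
def gramPolynomial {n d : ℕ} (A : Matrix (monomialsUpTo n d) (monomialsUpTo n d) ℝ) :
    MvPolynomial (Fin n) ℝ :=
  ∑ α : monomialsUpTo n d, ∑ β : monomialsUpTo n d, monomial ((α : Fin n →₀ ℕ) + (β : Fin n →₀ ℕ)) (A α β)

/-- A degree-`2d` sum-of-squares proof of `f ≤ c` from the equations `g j = 0`:
the polynomial identity `c - f = ⟨A, x^{≤ d} (x^{≤ d})ᵀ⟩ + ∑ j, q j * g j`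
with `A` positive semidefinite and every product `q j * g j` of degree at most `2d`. -/
structure SoSProof {n : ℕ} {ι : Type} [Fintype ι] (g : ι → MvPolynomial (Fin n) ℝ)
    (f : MvPolynomial (Fin n) ℝ) (d : ℕ) (c : ℝ) where
  A : Matrix (monomialsUpTo n d) (monomialsUpTo n d) ℝ
  q : ι → MvPolynomial (Fin n) ℝ
  posSemidef : A.PosSemidef
  degree_le : ∀ j, (q j * g j).totalDegree ≤ 2 * d
  identity : C c - f = gramPolynomial A + ∑ j, q j * g j

/-- Every number in the proof is at most `B` in absolute value: the certified bound, the entries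
of the positive semidefinite matrix, the coefficients of every multiplier, and the coefficients
of the ideal term. -/
def SoSProof.BoundedBy {n : ℕ} {ι : Type} [Fintype ι] {g : ι → MvPolynomial (Fin n) ℝ}
    {f : MvPolynomial (Fin n) ℝ} {d : ℕ} {c : ℝ} (P : SoSProof g f d c) (B : ℝ) : Prop :=
  |c| ≤ B ∧ (∀ α β, |P.A α β| ≤ B) ∧ (∀ j m, |coeff m (P.q j)| ≤ B) ∧
    ∀ m, |coeff m (∑ j, P.q j * g j)| ≤ B

/-- `c` is the optimum of the degree-`2d` sum-of-squares relaxation of maximizing `f` subject to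
`g j = 0`: the least upper bound on `f` that has a degree-`2d` sum-of-squares proof. -/
def IsSoSOptimum {n : ℕ} {ι : Type} [Fintype ι] (g : ι → MvPolynomial (Fin n) ℝ)
    (f : MvPolynomial (Fin n) ℝ) (d : ℕ) (c : ℝ) : Prop :=
  IsLeast {b : ℝ | Nonempty (SoSProof g f d b)} c

/-- The degree-`2d` sum-of-squares optimum of maximizing `f` subject to `g j = 0` exists and has a
degree-`2d` proof in which all numbers are bounded by `B`. -/
def HasBoundedSoSProof {n : ℕ} {ι : Type} [Fintype ι] (g : ι → MvPolynomial (Fin n) ℝ)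
    (f : MvPolynomial (Fin n) ℝ) (d : ℕ) (B : ℝ) : Prop :=
  ∃ c : ℝ, IsSoSOptimum g f d c ∧ ∃ P : SoSProof g f d c, P.BoundedBy B

/-- `x i ^ 2 = x i` for all `i`. -/
def boolCube (n : ℕ) : Fin n → MvPolynomial (Fin n) ℝ :=
  fun i => X i ^ 2 - X i

/-- `x i ^ 2 = 1` for all `i`. -/
def signCube (n : ℕ) : Fin n → MvPolynomial (Fin n) ℝ :=
  fun i => X i ^ 2 - 1

/-- `x i ^ 2 = 1` for all `i`, and `∑ i, x i = 0`. -/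
def balancedCube (n : ℕ) : Fin n ⊕ Unit → MvPolynomial (Fin n) ℝ :=
  Sum.elim (signCube n) fun _ => ∑ i, X i

/-- `∑ i, x i ^ 2 = 1`. -/
def unitSphere (n : ℕ) : Unit → MvPolynomial (Fin n) ℝ :=
  fun _ => (∑ i, X i ^ 2) - 1

/-- `x i ^ 2 = x i` for all `i`, and `∑ i, x i = k`. -/
def sparseBoolCube (n k : ℕ) : Fin n ⊕ Unit → MvPolynomial (Fin n) ℝ :=
  Sum.elim (boolCube n) fun _ => (∑ i, X i) - C (k : ℝ)

/-- `x i ^ 3 = x i` for all `i`, and `∑ i, x i ^ 2 = k`. -/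
def sparseTernaryCube (n k : ℕ) : Fin n ⊕ Unit → MvPolynomial (Fin n) ℝ :=
  Sum.elim (fun i => X i ^ 3 - X i) fun _ => (∑ i, X i ^ 2) - C (k : ℝ)

/-- `x i ^ 2 = x i` for all `i`, and `x i * x j = 0` for all pairs of distinct non-adjacent
vertices: the solutions are the indicator vectors of the cliques of `G`. -/
def cliqueSystem {n : ℕ} (G : SimpleGraph (Fin n)) :
    Fin n ⊕ {p : Fin n × Fin n // p.1 < p.2 ∧ ¬ G.Adj p.1 p.2} → MvPolynomial (Fin n) ℝ :=
  Sum.elim (boolCube n) fun p => X p.1.1 * X p.1.2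

end

/-! A bounded optimal proof is built from an arbitrary one. Take a space `W` that contains the
truncated ideal, each of whose elements of degree at most `2d` has, together with its negative, an
SoS certificate, and a functional `L` with `L 1 = 1` that kills the elements of `W` of degree at
most `2d`. If `c - f = ∑ vᵢ²` modulo `W`, applying `L` gives `∑ L(vᵢ²) = c - L f`, which is small.
Suppose every `v` of degree at most `d` can be exchanged, without changing its square modulo `W`,
for a `v'` whose squared coefficients are at most `R · L(v'²)`. Then the new Gram matrix has small
entries, and the defect `h = c - f - ∑ vᵢ'²` is an element of `W` with small coefficients. To
certify `h`, rewrite every monomial to a normal form in a space `N` with `N ∩ W = 0`. The normal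
form of `h` vanishes, so `h` is a combination, with its own coefficients, of the certified
differences "monomial minus normal form". Boundedness gives compactness, hence attainment of the
optimum. This is `hasBoundedSoSProof_of_normalForms`. With `R = n ^ (10 d)`,
`HasNormalForms.boundedSoS` turns its conclusion into powers of `n ^ d`.

Each system then needs `W`, `N`, `L` and a coefficient bound.

Slices (`IsSliceSystem`, covering both sparse cubes): multiplying by `∑ xᵢ^a = k` raises monomials
to the top degrees, and `L` averages over uniform `k`-subsets and random roots of unity. The
coefficient bound is a lower bound for the quadratic form of an inclusion matrix
(`choose_mul_sum_sq_le`), obtained from Vandermonde's identity.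

Boolean slices with `k < d`, and the middle slice `n = 2k` with `k < 2d`: squarefree monomials of
degree above `k` must be certified to be zero, by squares in the first case (`certBound_monomial`)
and inside the ideal in the second (`idealBound_middle`). Here `W` consists of all polynomials
vanishing on the slice.

Boolean cube and cliques (`IsFlagSystem`): `W` is the space of polynomials vanishing on the faces,
`L` averages over faces of size at most `d`, and Möbius inversion bounds coefficients by point
values.

Unit sphere: `L` is the uniform mean. After rescaling by degree its moments agree with Gaussian ones
on top-degree normal forms, and the Hermite expansion isolates each coefficient
(`sq_coeff_mul_le_sphereMean_sq`).

The sign cube, the balanced cube and Boolean slices with `k` close to `n` follow by invertible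
affine changes of variables (`BoundedSoS.of_affineSubst`). -/

open MvPolynomial

namespace SoSBound

/-! ### Degrees and the number of monomials. -/

section Degree

variable {n : ℕ}

theorem mem_monomialsUpTo_iff_degree {d : ℕ} {m : Fin n →₀ ℕ} :
    m ∈ monomialsUpTo n d ↔ m.degree ≤ d := by
  rw [mem_monomialsUpTo, Finsupp.degree_eq_sum]

theorem totalDegree_le_iff_degree {p : MvPolynomial (Fin n) ℝ} {e : ℕ} :
    p.totalDegree ≤ e ↔ ∀ m, coeff m p ≠ 0 → m.degree ≤ e := by
  rw [totalDegree, Finset.sup_le_iff]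
  simp only [mem_support_iff]
  rfl

theorem coeff_eq_zero_of_totalDegree_le {p : MvPolynomial (Fin n) ℝ} {e : ℕ}
    (hp : p.totalDegree ≤ e) {m : Fin n →₀ ℕ} (hm : e < m.degree) : coeff m p = 0 := by
  by_contra h
  exact absurd (totalDegree_le_iff_degree.1 hp m h) (by omega)

theorem totalDegree_monomial_le_degree (m : Fin n →₀ ℕ) (c : ℝ) :
    (monomial m c).totalDegree ≤ m.degree := by
  rw [totalDegree_le_iff_degree]
  intro m' hm'
  rw [coeff_monomial] at hm'
  split_ifs at hm' with h
  · rw [h]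
  · exact absurd rfl hm'

theorem sum_monomial_coeff {p : MvPolynomial (Fin n) ℝ} {e : ℕ} (hp : p.totalDegree ≤ e) :
    ∑ m ∈ monomialsUpTo n e, monomial m (coeff m p) = p := by
  ext m
  rw [coeff_sum]
  simp only [coeff_monomial]
  rw [Finset.sum_ite_eq' (monomialsUpTo n e) m (fun m => coeff m p)]
  split_ifs with h
  · rfl
  · rw [mem_monomialsUpTo_iff_degree, not_le] at h
    exact (coeff_eq_zero_of_totalDegree_le hp h).symm

theorem totalDegree_mul_le {p q : MvPolynomial (Fin n) ℝ} {a b : ℕ} (hp : p.totalDegree ≤ a)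
    (hq : q.totalDegree ≤ b) : (p * q).totalDegree ≤ a + b :=
  (totalDegree_mul p q).trans (add_le_add hp hq)

theorem totalDegree_add_le {p q : MvPolynomial (Fin n) ℝ} {a : ℕ} (hp : p.totalDegree ≤ a)
    (hq : q.totalDegree ≤ a) : (p + q).totalDegree ≤ a :=
  (totalDegree_add p q).trans (max_le hp hq)

theorem totalDegree_sub_le {p q : MvPolynomial (Fin n) ℝ} {a : ℕ} (hp : p.totalDegree ≤ a)
    (hq : q.totalDegree ≤ a) : (p - q).totalDegree ≤ a :=
  (totalDegree_sub p q).trans (max_le hp hq)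

theorem totalDegree_sum_le {κ : Type*} {s : Finset κ} {p : κ → MvPolynomial (Fin n) ℝ} {a : ℕ}
    (hp : ∀ i ∈ s, (p i).totalDegree ≤ a) : (∑ i ∈ s, p i).totalDegree ≤ a :=
  totalDegree_finsetSum_le hp

/-- Raising the degree bound by one multiplies the count by at most `n + 1`: an exponent vector
either already satisfied the old bound or has one of `n` unit vectors split off. -/
theorem card_monomialsUpTo_le_pow (d : ℕ) : (monomialsUpTo n d).card ≤ (n + 1) ^ d := by
  induction d with
  | zero =>
    rw [pow_zero, Finset.card_le_one]
    intro a ha b hb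
    rw [mem_monomialsUpTo_iff_degree] at ha hb
    rw [(Finsupp.degree_eq_zero_iff a).1 (by omega), (Finsupp.degree_eq_zero_iff b).1 (by omega)]
  | succ d ih =>
    classical
    let φ : Option (Fin n) × (Fin n →₀ ℕ) → (Fin n →₀ ℕ) :=
      fun x => x.1.elim x.2 fun i => x.2 + Finsupp.single i 1
    have hsub : monomialsUpTo n (d + 1) ⊆
        ((Finset.univ : Finset (Option (Fin n))) ×ˢ monomialsUpTo n d).image φ := by
      intro m hm
      rw [mem_monomialsUpTo_iff_degree] at hm
      rw [Finset.mem_image]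
      by_cases h : m.degree ≤ d
      · exact ⟨(none, m), by simp [mem_monomialsUpTo_iff_degree, h], rfl⟩
      · have hne : m ≠ 0 := by
          rintro rfl
          simp at h
        obtain ⟨i, hi⟩ := Finsupp.ne_iff.1 hne
        have hle : Finsupp.single i 1 ≤ m := by
          rw [Finsupp.single_le_iff]
          exact Nat.one_le_iff_ne_zero.2 hi
        have hadd : m - Finsupp.single i 1 + Finsupp.single i 1 = m := tsub_add_cancel_of_le hle
        refine ⟨(some i, m - Finsupp.single i 1), ?_, hadd⟩
        have hdeg := congrArg Finsupp.degree hadd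
        rw [map_add, Finsupp.degree_single] at hdeg
        simp only [Finset.mem_product, Finset.mem_univ, true_and, mem_monomialsUpTo_iff_degree]
        omega
    refine (Finset.card_le_card hsub).trans (Finset.card_image_le.trans ?_)
    rw [Finset.card_product, Finset.card_univ, Fintype.card_option, Fintype.card_fin, pow_succ,
      mul_comm]
    exact Nat.mul_le_mul_right _ ih

theorem card_monomialsUpTo_le (hn : 2 ≤ n) (d : ℕ) :
    ((monomialsUpTo n d).card : ℝ) ≤ (n : ℝ) ^ (2 * d) := by
  have h1 : n + 1 ≤ n ^ 2 := by nlinarith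
  have h2 : (monomialsUpTo n d).card ≤ n ^ (2 * d) := by
    rw [pow_mul]
    exact (card_monomialsUpTo_le_pow d).trans (Nat.pow_le_pow_left h1 d)
  exact_mod_cast h2

theorem one_le_card_monomialsUpTo (d : ℕ) : (1 : ℝ) ≤ (monomialsUpTo n d).card := by
  have : 0 < (monomialsUpTo n d).card :=
    Finset.card_pos.2 ⟨0, by simp [mem_monomialsUpTo_iff_degree]⟩
  exact_mod_cast this

end Degree

/-! ### Gram matrices and sums of squares. -/

section Gram

variable {n d : ℕ}

/-- `gramPolynomial` as a linear map. -/
noncomputable def gramLinear (n d : ℕ) :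
    Matrix (monomialsUpTo n d) (monomialsUpTo n d) ℝ →ₗ[ℝ] MvPolynomial (Fin n) ℝ where
  toFun A := gramPolynomial A
  map_add' A B := by
    simp only [gramPolynomial, Matrix.add_apply, map_add, Finset.sum_add_distrib]
  map_smul' c A := by
    simp only [gramPolynomial, Matrix.smul_apply, smul_eq_mul, RingHom.id_apply, Finset.smul_sum,
      smul_monomial]

theorem gramLinear_apply (A : Matrix (monomialsUpTo n d) (monomialsUpTo n d) ℝ) :
    gramLinear n d A = gramPolynomial A := rfl

theorem gramPolynomial_zero :
    gramPolynomial (0 : Matrix (monomialsUpTo n d) (monomialsUpTo n d) ℝ) = 0 :=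
  map_zero (gramLinear n d)

theorem gramPolynomial_add (A B : Matrix (monomialsUpTo n d) (monomialsUpTo n d) ℝ) :
    gramPolynomial (A + B) = gramPolynomial A + gramPolynomial B :=
  map_add (gramLinear n d) A B

theorem gramPolynomial_smul (c : ℝ) (A : Matrix (monomialsUpTo n d) (monomialsUpTo n d) ℝ) :
    gramPolynomial (c • A) = c • gramPolynomial A :=
  map_smul (gramLinear n d) c A

/-- The rank-one Gram matrix of the square of `p`. -/
noncomputable def squareGram (d : ℕ) (p : MvPolynomial (Fin n) ℝ) :
    Matrix (monomialsUpTo n d) (monomialsUpTo n d) ℝ :=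
  fun α β => coeff (α : Fin n →₀ ℕ) p * coeff (β : Fin n →₀ ℕ) p

theorem squareGram_posSemidef (p : MvPolynomial (Fin n) ℝ) : (squareGram d p).PosSemidef :=
  Matrix.posSemidef_vecMulVec_self_star fun α : monomialsUpTo n d => coeff (α : Fin n →₀ ℕ) p

theorem gramPolynomial_squareGram {p : MvPolynomial (Fin n) ℝ} (hp : p.totalDegree ≤ d) :
    gramPolynomial (squareGram d p) = p ^ 2 := by
  conv_rhs => rw [← sum_monomial_coeff hp]
  rw [pow_two, Finset.sum_mul_sum, gramPolynomial]
  rw [← Finset.sum_coe_sort (monomialsUpTo n d)]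
  refine Finset.sum_congr rfl fun α _ => ?_
  rw [← Finset.sum_coe_sort (monomialsUpTo n d)]
  refine Finset.sum_congr rfl fun β _ => ?_
  rw [monomial_mul]
  rfl

/-- The rows of a factor `B` with `A = Bᴴ B` are the coefficient vectors of the squares. This is
what allows a certificate to be modified one square at a time. -/
theorem exists_sum_sq_of_posSemidef {A : Matrix (monomialsUpTo n d) (monomialsUpTo n d) ℝ}
    (hA : A.PosSemidef) : ∃ v : monomialsUpTo n d → MvPolynomial (Fin n) ℝ,
      (∀ i, (v i).totalDegree ≤ d) ∧ gramPolynomial A = ∑ i, v i ^ 2 := by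
  classical
  obtain ⟨B, hB⟩ : ∃ B : Matrix (monomialsUpTo n d) (monomialsUpTo n d) ℝ,
      A = B.conjTranspose * B := by
    open scoped MatrixOrder in
    obtain ⟨X, hX⟩ := CStarAlgebra.nonneg_iff_eq_star_mul_self.1 hA.nonneg
    exact ⟨X, hX⟩
  let v : monomialsUpTo n d → MvPolynomial (Fin n) ℝ := fun i =>
    ∑ α : monomialsUpTo n d, monomial (α : Fin n →₀ ℕ) (B i α)
  have hdeg : ∀ i, (v i).totalDegree ≤ d := fun i => totalDegree_sum_le fun α _ =>
    (totalDegree_monomial_le_degree _ _).trans (mem_monomialsUpTo_iff_degree.1 α.2)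
  have hcoeff : ∀ i, ∀ α : monomialsUpTo n d, coeff (α : Fin n →₀ ℕ) (v i) = B i α := by
    intro i α
    simp only [v, coeff_sum, coeff_monomial]
    rw [Finset.sum_eq_single α]
    · simp
    · intro β _ hβ
      rw [if_neg fun h => hβ (Subtype.ext h)]
    · intro h
      exact absurd (Finset.mem_univ _) h
  refine ⟨v, hdeg, ?_⟩
  have hA' : A = ∑ i, squareGram d (v i) := by
    ext α β
    rw [hB, Matrix.mul_apply, Matrix.sum_apply]
    refine Finset.sum_congr rfl fun i _ => ?_
    simp only [squareGram, hcoeff, Matrix.conjTranspose_apply, star_trivial]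
  rw [hA', ← gramLinear_apply, map_sum]
  exact Finset.sum_congr rfl fun i _ => by rw [gramLinear_apply, gramPolynomial_squareGram (hdeg i)]

theorem abs_coeff_gramPolynomial_le {A : Matrix (monomialsUpTo n d) (monomialsUpTo n d) ℝ} {a : ℝ}
    (ha : ∀ α β, |A α β| ≤ a) (m : Fin n →₀ ℕ) :
    |coeff m (gramPolynomial A)| ≤ ((monomialsUpTo n d).card : ℝ) ^ 2 * a := by
  simp only [gramPolynomial, coeff_sum, coeff_monomial]
  have hle : ∀ α β : monomialsUpTo n d,
      |if (α : Fin n →₀ ℕ) + (β : Fin n →₀ ℕ) = m then A α β else 0| ≤ a := by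
    intro α β
    split_ifs
    · exact ha α β
    · rw [abs_zero]
      exact (abs_nonneg _).trans (ha α β)
  refine (Finset.abs_sum_le_sum_abs _ _).trans ?_
  refine (Finset.sum_le_sum fun α _ => (Finset.abs_sum_le_sum_abs _ _).trans
    (Finset.sum_le_sum fun β _ => hle α β)).trans ?_
  simp only [Finset.sum_const, Finset.card_univ, Fintype.card_coe, nsmul_eq_mul]
  rw [pow_two, mul_assoc]

theorem totalDegree_gramPolynomial_le
    (A : Matrix (monomialsUpTo n d) (monomialsUpTo n d) ℝ) :
    (gramPolynomial A).totalDegree ≤ 2 * d := by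
  refine totalDegree_sum_le fun α _ => totalDegree_sum_le fun β _ => ?_
  refine (totalDegree_monomial_le_degree _ _).trans ?_
  have h1 := mem_monomialsUpTo_iff_degree.1 α.2
  have h2 := mem_monomialsUpTo_iff_degree.1 β.2
  rw [map_add]
  omega

end Gram

/-! ### Arithmetic of certificates with explicit bounds. -/

section Certificates

variable {n : ℕ} {ι : Type} [Fintype ι] (g : ι → MvPolynomial (Fin n) ℝ)

/-- The combinations `∑ j, q j * g j` in which every product has degree at most `e`. -/
def truncIdeal (e : ℕ) : Submodule ℝ (MvPolynomial (Fin n) ℝ) where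
  carrier := {h | ∃ q : ι → MvPolynomial (Fin n) ℝ,
    (∀ j, (q j * g j).totalDegree ≤ e) ∧ h = ∑ j, q j * g j}
  zero_mem' := ⟨0, by simp, by simp⟩
  add_mem' := by
    rintro _ _ ⟨q, hq, rfl⟩ ⟨r, hr, rfl⟩
    refine ⟨q + r, fun j => ?_, ?_⟩
    · rw [Pi.add_apply, add_mul]
      exact totalDegree_add_le (hq j) (hr j)
    · simp only [Pi.add_apply, add_mul, Finset.sum_add_distrib]
  smul_mem' := by
    rintro c _ ⟨q, hq, rfl⟩
    refine ⟨c • q, fun j => ?_, ?_⟩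
    · rw [Pi.smul_apply, smul_mul_assoc]
      exact (totalDegree_smul_le _ _).trans (hq j)
    · simp only [Pi.smul_apply, smul_mul_assoc, Finset.smul_sum]

/-- `h` lies in the degree-`e` truncation of the ideal, with multipliers whose coefficients are at
most `B` in absolute value. -/
def IdealBound (e : ℕ) (h : MvPolynomial (Fin n) ℝ) (B : ℝ) : Prop :=
  ∃ q : ι → MvPolynomial (Fin n) ℝ, (∀ j, (q j * g j).totalDegree ≤ e) ∧
    (∀ j m, |coeff m (q j)| ≤ B) ∧ h = ∑ j, q j * g j

/-- `h` is a sum of squares plus an element of the truncated ideal, with all numbers at most `B`. -/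
def CertBound (d : ℕ) (h : MvPolynomial (Fin n) ℝ) (B : ℝ) : Prop :=
  ∃ (A : Matrix (monomialsUpTo n d) (monomialsUpTo n d) ℝ) (q : ι → MvPolynomial (Fin n) ℝ),
    A.PosSemidef ∧ (∀ j, (q j * g j).totalDegree ≤ 2 * d) ∧ (∀ α β, |A α β| ≤ B) ∧
    (∀ j m, |coeff m (q j)| ≤ B) ∧ h = gramPolynomial A + ∑ j, q j * g j

/-- Both `h` and `-h` have bounded certificates. -/
def TwoSidedBound (d : ℕ) (h : MvPolynomial (Fin n) ℝ) (B : ℝ) : Prop :=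
  CertBound g d h B ∧ CertBound g d (-h) B

/-- `h` is a sum of squares of polynomials of degree at most `d`, modulo `W`. -/
def IsSoSMod (W : Submodule ℝ (MvPolynomial (Fin n) ℝ)) (d : ℕ) (h : MvPolynomial (Fin n) ℝ) :
    Prop :=
  ∃ A : Matrix (monomialsUpTo n d) (monomialsUpTo n d) ℝ,
    A.PosSemidef ∧ h - gramPolynomial A ∈ W

variable {g}

theorem IdealBound.mem {e : ℕ} {h : MvPolynomial (Fin n) ℝ} {B : ℝ} (H : IdealBound g e h B) :
    h ∈ truncIdeal g e := by
  obtain ⟨q, h1, -, h2⟩ := H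
  exact ⟨q, h1, h2⟩

theorem truncIdeal_mono {e e' : ℕ} (he : e ≤ e') : truncIdeal g e ≤ truncIdeal g e' := by
  rintro _ ⟨q, hq, rfl⟩
  exact ⟨q, fun j => (hq j).trans he, rfl⟩

theorem totalDegree_le_of_mem_truncIdeal {e : ℕ} {h : MvPolynomial (Fin n) ℝ}
    (hh : h ∈ truncIdeal g e) : h.totalDegree ≤ e := by
  obtain ⟨q, hq, rfl⟩ := hh
  exact totalDegree_sum_le fun j _ => hq j

theorem mul_mem_truncIdeal {e b : ℕ} {h r : MvPolynomial (Fin n) ℝ} (hh : h ∈ truncIdeal g e)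
    (hr : r.totalDegree ≤ b) : h * r ∈ truncIdeal g (e + b) := by
  obtain ⟨q, hq, rfl⟩ := hh
  refine ⟨fun j => q j * r, fun j => ?_, ?_⟩
  · rw [mul_right_comm]
    exact totalDegree_mul_le (hq j) hr
  · rw [Finset.sum_mul]
    exact Finset.sum_congr rfl fun j _ => by ring

theorem IdealBound.mono {e e' : ℕ} {h : MvPolynomial (Fin n) ℝ} {B B' : ℝ}
    (H : IdealBound g e h B) (he : e ≤ e') (hB : B ≤ B') : IdealBound g e' h B' := by
  obtain ⟨q, h1, h2, h3⟩ := H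
  exact ⟨q, fun j => (h1 j).trans he, fun j m => (h2 j m).trans hB, h3⟩

theorem IdealBound.zero (e : ℕ) : IdealBound g e 0 0 :=
  ⟨0, by simp, by simp, by simp⟩

theorem IdealBound.add {e : ℕ} {h h' : MvPolynomial (Fin n) ℝ} {B B' : ℝ}
    (H : IdealBound g e h B) (H' : IdealBound g e h' B') : IdealBound g e (h + h') (B + B') := by
  obtain ⟨q, h1, h2, rfl⟩ := H
  obtain ⟨r, h1', h2', rfl⟩ := H'
  refine ⟨q + r, fun j => ?_, fun j m => ?_, ?_⟩
  · rw [Pi.add_apply, add_mul]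
    exact totalDegree_add_le (h1 j) (h1' j)
  · rw [Pi.add_apply, coeff_add]
    exact (abs_add_le _ _).trans (add_le_add (h2 j m) (h2' j m))
  · simp only [Pi.add_apply, add_mul, Finset.sum_add_distrib]

theorem IdealBound.smul {e : ℕ} {h : MvPolynomial (Fin n) ℝ} {B : ℝ}
    (H : IdealBound g e h B) (c : ℝ) : IdealBound g e (c • h) (|c| * B) := by
  obtain ⟨q, h1, h2, rfl⟩ := H
  refine ⟨c • q, fun j => ?_, fun j m => ?_, ?_⟩
  · rw [Pi.smul_apply, smul_mul_assoc]
    exact (totalDegree_smul_le _ _).trans (h1 j)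
  · rw [Pi.smul_apply, coeff_smul, smul_eq_mul, abs_mul]
    exact mul_le_mul_of_nonneg_left (h2 j m) (abs_nonneg c)
  · simp only [Pi.smul_apply, smul_mul_assoc, Finset.smul_sum]

theorem IdealBound.sum {κ : Type*} {e : ℕ} (s : Finset κ) {h : κ → MvPolynomial (Fin n) ℝ}
    {B : κ → ℝ} (H : ∀ i ∈ s, IdealBound g e (h i) (B i)) :
    IdealBound g e (∑ i ∈ s, h i) (∑ i ∈ s, B i) := by
  classical
  induction s using Finset.induction_on with
  | empty => simpa using IdealBound.zero e
  | insert a s ha ih =>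
    rw [Finset.sum_insert ha, Finset.sum_insert ha]
    exact (H a (Finset.mem_insert_self a s)).add
      (ih fun i hi => H i (Finset.mem_insert_of_mem hi))

theorem CertBound.mono {d : ℕ} {h : MvPolynomial (Fin n) ℝ} {B B' : ℝ}
    (H : CertBound g d h B) (hB : B ≤ B') : CertBound g d h B' := by
  obtain ⟨A, q, h0, h1, h2, h3, h4⟩ := H
  exact ⟨A, q, h0, h1, fun α β => (h2 α β).trans hB, fun j m => (h3 j m).trans hB, h4⟩

theorem CertBound.add {d : ℕ} {h h' : MvPolynomial (Fin n) ℝ} {B B' : ℝ}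
    (H : CertBound g d h B) (H' : CertBound g d h' B') : CertBound g d (h + h') (B + B') := by
  obtain ⟨A, q, hA, h1, hAB, h2, rfl⟩ := H
  obtain ⟨A', r, hA', h1', hAB', h2', rfl⟩ := H'
  refine ⟨A + A', q + r, hA.add hA', fun j => ?_, fun α β => ?_, fun j m => ?_, ?_⟩
  · rw [Pi.add_apply, add_mul]
    exact totalDegree_add_le (h1 j) (h1' j)
  · exact (abs_add_le _ _).trans (add_le_add (hAB α β) (hAB' α β))
  · rw [Pi.add_apply, coeff_add]
    exact (abs_add_le _ _).trans (add_le_add (h2 j m) (h2' j m))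
  · simp only [Pi.add_apply, add_mul, Finset.sum_add_distrib, gramPolynomial_add]
    ring

theorem CertBound.smul {d : ℕ} {h : MvPolynomial (Fin n) ℝ} {B : ℝ}
    (H : CertBound g d h B) {c : ℝ} (hc : 0 ≤ c) : CertBound g d (c • h) (c * B) := by
  obtain ⟨A, q, hA, h1, hAB, h2, rfl⟩ := H
  refine ⟨c • A, c • q, hA.smul hc, fun j => ?_, fun α β => ?_, fun j m => ?_, ?_⟩
  · rw [Pi.smul_apply, smul_mul_assoc]
    exact (totalDegree_smul_le _ _).trans (h1 j)
  · rw [Matrix.smul_apply, smul_eq_mul, abs_mul, abs_of_nonneg hc]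
    exact mul_le_mul_of_nonneg_left (hAB α β) hc
  · rw [Pi.smul_apply, coeff_smul, smul_eq_mul, abs_mul, abs_of_nonneg hc]
    exact mul_le_mul_of_nonneg_left (h2 j m) hc
  · simp only [Pi.smul_apply, smul_mul_assoc, smul_add, Finset.smul_sum, gramPolynomial_smul]

theorem CertBound.zero (d : ℕ) : CertBound g d 0 0 :=
  ⟨0, 0, Matrix.PosSemidef.zero, by simp, by simp, by simp, by simp [gramPolynomial_zero]⟩

theorem CertBound.sum {κ : Type*} {d : ℕ} (s : Finset κ) {h : κ → MvPolynomial (Fin n) ℝ}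
    {B : κ → ℝ} (H : ∀ i ∈ s, CertBound g d (h i) (B i)) :
    CertBound g d (∑ i ∈ s, h i) (∑ i ∈ s, B i) := by
  classical
  induction s using Finset.induction_on with
  | empty => simpa using CertBound.zero d
  | insert a s ha ih =>
    rw [Finset.sum_insert ha, Finset.sum_insert ha]
    exact (H a (Finset.mem_insert_self a s)).add
      (ih fun i hi => H i (Finset.mem_insert_of_mem hi))

theorem CertBound.sq {d : ℕ} {p : MvPolynomial (Fin n) ℝ} (hp : p.totalDegree ≤ d) {b : ℝ}
    (hb : ∀ m, |coeff m p| ≤ b) : CertBound g d (p ^ 2) (b ^ 2) := by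
  have hb0 : 0 ≤ b := (abs_nonneg _).trans (hb 0)
  refine ⟨squareGram d p, 0, squareGram_posSemidef p, by simp, fun α β => ?_, ?_, ?_⟩
  · rw [squareGram, abs_mul, pow_two]
    exact mul_le_mul (hb _) (hb _) (abs_nonneg _) hb0
  · intro j m
    simpa using pow_nonneg hb0 2
  · simp [gramPolynomial_squareGram hp]

theorem IdealBound.certBound {d : ℕ} {h : MvPolynomial (Fin n) ℝ} {B : ℝ} (hB : 0 ≤ B)
    (H : IdealBound g (2 * d) h B) : CertBound g d h B := by
  obtain ⟨q, h1, h2, h3⟩ := H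
  exact ⟨0, q, Matrix.PosSemidef.zero, h1, fun α β => by rwa [Matrix.zero_apply, abs_zero], h2,
    by simp [gramPolynomial_zero, h3]⟩

theorem IdealBound.twoSidedBound {d : ℕ} {h : MvPolynomial (Fin n) ℝ} {B : ℝ} (hB : 0 ≤ B)
    (H : IdealBound g (2 * d) h B) : TwoSidedBound g d h B := by
  refine ⟨H.certBound hB, IdealBound.certBound hB ?_⟩
  simpa using H.smul (-1)

theorem TwoSidedBound.mono {d : ℕ} {h : MvPolynomial (Fin n) ℝ} {B B' : ℝ}
    (H : TwoSidedBound g d h B) (hB : B ≤ B') : TwoSidedBound g d h B' :=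
  ⟨H.1.mono hB, H.2.mono hB⟩

theorem TwoSidedBound.add {d : ℕ} {h h' : MvPolynomial (Fin n) ℝ} {B B' : ℝ}
    (H : TwoSidedBound g d h B) (H' : TwoSidedBound g d h' B') :
    TwoSidedBound g d (h + h') (B + B') := by
  refine ⟨H.1.add H'.1, ?_⟩
  rw [neg_add]
  exact H.2.add H'.2

/-- A negative scalar exchanges the two certificates, so two-sided certificates can be combined
linearly with coefficients of any sign, which one-sided ones cannot. -/
theorem TwoSidedBound.smul {d : ℕ} {h : MvPolynomial (Fin n) ℝ} {B : ℝ}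
    (H : TwoSidedBound g d h B) (c : ℝ) : TwoSidedBound g d (c • h) (|c| * B) := by
  rcases le_total 0 c with hc | hc
  · rw [abs_of_nonneg hc]
    exact ⟨H.1.smul hc, by rw [← smul_neg]; exact H.2.smul hc⟩
  · rw [abs_of_nonpos hc]
    have hc' : 0 ≤ -c := by linarith
    refine ⟨?_, ?_⟩
    · have := H.2.smul hc'
      rwa [neg_smul_neg] at this
    · have := H.1.smul hc'
      rwa [neg_smul] at this

theorem TwoSidedBound.sum {κ : Type*} {d : ℕ} (s : Finset κ) {h : κ → MvPolynomial (Fin n) ℝ}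
    {B : κ → ℝ} (H : ∀ i ∈ s, TwoSidedBound g d (h i) (B i)) :
    TwoSidedBound g d (∑ i ∈ s, h i) (∑ i ∈ s, B i) := by
  refine ⟨CertBound.sum s fun i hi => (H i hi).1, ?_⟩
  rw [← Finset.sum_neg_distrib]
  exact CertBound.sum s fun i hi => (H i hi).2

variable {W : Submodule ℝ (MvPolynomial (Fin n) ℝ)}

theorem IsSoSMod.add {d : ℕ} {h h' : MvPolynomial (Fin n) ℝ} (H : IsSoSMod W d h)
    (H' : IsSoSMod W d h') : IsSoSMod W d (h + h') := by
  obtain ⟨A, hA, hW⟩ := H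
  obtain ⟨A', hA', hW'⟩ := H'
  refine ⟨A + A', hA.add hA', ?_⟩
  rw [gramPolynomial_add, add_sub_add_comm]
  exact W.add_mem hW hW'

theorem IsSoSMod.smul {d : ℕ} {h : MvPolynomial (Fin n) ℝ} (H : IsSoSMod W d h) {c : ℝ}
    (hc : 0 ≤ c) : IsSoSMod W d (c • h) := by
  obtain ⟨A, hA, hW⟩ := H
  refine ⟨c • A, hA.smul hc, ?_⟩
  rw [gramPolynomial_smul, ← smul_sub]
  exact W.smul_mem c hW

theorem IsSoSMod.of_mem {h : MvPolynomial (Fin n) ℝ} (d : ℕ) (H : h ∈ W) : IsSoSMod W d h :=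
  ⟨0, Matrix.PosSemidef.zero, by simpa [gramPolynomial_zero] using H⟩

theorem IsSoSMod.sq {d : ℕ} {p : MvPolynomial (Fin n) ℝ} (hp : p.totalDegree ≤ d) :
    IsSoSMod W d (p ^ 2) :=
  ⟨squareGram d p, squareGram_posSemidef p, by simp [gramPolynomial_squareGram hp]⟩

theorem IsSoSMod.sum {κ : Type*} {d : ℕ} (s : Finset κ) {h : κ → MvPolynomial (Fin n) ℝ}
    (H : ∀ i ∈ s, IsSoSMod W d (h i)) : IsSoSMod W d (∑ i ∈ s, h i) := by
  classical
  induction s using Finset.induction_on with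
  | empty => simpa using IsSoSMod.of_mem d W.zero_mem
  | insert a s ha ih =>
    rw [Finset.sum_insert ha]
    exact (H a (Finset.mem_insert_self a s)).add
      (ih fun i hi => H i (Finset.mem_insert_of_mem hi))

theorem isSoSMod_C {d : ℕ} {c : ℝ} (hc : 0 ≤ c) : IsSoSMod W d (C c) := by
  have h : (C c : MvPolynomial (Fin n) ℝ) = (C (Real.sqrt c)) ^ 2 := by
    rw [← C_pow, Real.sq_sqrt hc]
  rw [h]
  exact IsSoSMod.sq (by simp)

end Certificates

end SoSBound

namespace SoSBound

/-! ### The criterion: normal forms and a pseudo-expectation give bounded optimal proofs. -/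

section Criterion

/-- Symmetry, and nonnegativity of the quadratic form at each finitely supported vector, are closed
conditions on finitely many entries. Matrices are taken as plain functions in order to use the
product topology. -/
theorem isClosed_setOf_posSemidef {κ : Type*} :
    IsClosed {A : κ → κ → ℝ | (Matrix.of A).PosSemidef} := by
  have h : {A : κ → κ → ℝ | (Matrix.of A).PosSemidef} =
      {A | ∀ i j, A j i = A i j} ∩
        ⋂ x : κ →₀ ℝ, {A | 0 ≤ ∑ i ∈ x.support, ∑ j ∈ x.support, x i * A i j * x j} := by
    ext A
    simp only [Matrix.PosSemidef, Set.mem_ofPred_eq, Set.mem_inter_iff, Set.mem_iInter, Finsupp.sum,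
      star_trivial, Matrix.of_apply, Matrix.IsHermitian]
    refine and_congr_left fun _ => ⟨fun h i j => ?_, fun h => ?_⟩
    · simpa using congrFun (congrFun h i) j
    · ext i j
      simpa using h i j
  rw [h]
  refine IsClosed.inter ?_ (isClosed_iInter fun x => ?_)
  · simp only [Set.ofPred_forall]
    refine isClosed_iInter fun i => isClosed_iInter fun j => isClosed_eq ?_ ?_ <;> fun_prop
  · exact isClosed_le continuous_const (by fun_prop)

variable {n : ℕ}

/-- The condition is affine. An extra coordinate for the coefficient of `f` makes it linear, the
preimage of `W` is then a subspace of a finite-dimensional space, hence closed, and the section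
where that coordinate equals `1` is the set in question. -/
theorem isClosed_setOf_sub_gram_mem (W : Submodule ℝ (MvPolynomial (Fin n) ℝ))
    (f : MvPolynomial (Fin n) ℝ) (d : ℕ) :
    IsClosed {x : ℝ × (monomialsUpTo n d → monomialsUpTo n d → ℝ) |
      C x.1 - f - gramPolynomial (Matrix.of x.2) ∈ W} := by
  let Φ : ℝ × ℝ × (monomialsUpTo n d → monomialsUpTo n d → ℝ) →ₗ[ℝ] MvPolynomial (Fin n) ℝ :=
    { toFun := fun y => C y.2.1 - y.1 • f - gramLinear n d (Matrix.of y.2.2)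
      map_add' := fun y z => by
        have : (Matrix.of (y + z).2.2 : Matrix (monomialsUpTo n d) (monomialsUpTo n d) ℝ) =
          Matrix.of y.2.2 + Matrix.of z.2.2 := rfl
        rw [this, map_add]
        simp only [Prod.fst_add, Prod.snd_add, add_smul, map_add]
        ring
      map_smul' := fun c y => by
        have : (Matrix.of (c • y).2.2 : Matrix (monomialsUpTo n d) (monomialsUpTo n d) ℝ) =
          c • Matrix.of y.2.2 := rfl
        rw [this, map_smul]
        simp only [Prod.smul_fst, Prod.smul_snd, smul_eq_mul, C_mul, RingHom.id_apply, smul_sub,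
          mul_smul, C_mul'] }
  have hclosed : IsClosed ((W.comap Φ : Submodule ℝ _) :
      Set (ℝ × ℝ × (monomialsUpTo n d → monomialsUpTo n d → ℝ))) :=
    Submodule.closed_of_finiteDimensional _
  have hcont : Continuous fun x : ℝ × (monomialsUpTo n d → monomialsUpTo n d → ℝ) =>
      ((1 : ℝ), x) := by fun_prop
  have := hclosed.preimage hcont
  convert this using 1
  ext x
  simp [Φ, gramLinear_apply]

variable {ι : Type} [Fintype ι] {g : ι → MvPolynomial (Fin n) ℝ}
  {W : Submodule ℝ (MvPolynomial (Fin n) ℝ)}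

/-- Split `m = α + β` with both degrees at most `d` and use `2 (R - ε x^(α+β)) = (R - x^(2α)) + (R -
x^(2β)) + (x^α - ε x^β)²`. -/
theorem isSoSMod_const_sub_monomial {d : ℕ} {R : ℝ}
    (bd : ∀ α : Fin n →₀ ℕ, α.degree ≤ d → IsSoSMod W d (C R - monomial (α + α) 1))
    {m : Fin n →₀ ℕ} (hm : m.degree ≤ 2 * d) {ε : ℝ} (hε : ε ^ 2 = 1) :
    IsSoSMod W d (C R - monomial m ε) := by
  obtain ⟨α, hα, hαd⟩ := Finsupp.exists_le_degree_eq m (min d m.degree) (min_le_right _ _)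
  obtain ⟨β, rfl⟩ := exists_add_of_le hα
  rw [map_add] at hm hαd
  have h1 : α.degree ≤ d := by omega
  have h2 : β.degree ≤ d := by omega
  have hsq : IsSoSMod W d ((monomial α 1 - monomial β ε) ^ 2) :=
    IsSoSMod.sq (totalDegree_sub_le ((totalDegree_monomial_le_degree _ _).trans h1)
      ((totalDegree_monomial_le_degree _ _).trans h2))
  have key := (((bd α h1).add (bd β h2)).add hsq).smul (show (0 : ℝ) ≤ 1 / 2 by norm_num)
  convert key using 1
  have e1 : (monomial α (1 : ℝ) - monomial β ε) ^ 2 =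
      monomial (α + α) 1 - (2 : ℝ) • monomial (α + β) ε + monomial (β + β) 1 := by
    have : (monomial α (1 : ℝ) - monomial β ε) ^ 2 = monomial α (1 : ℝ) * monomial α (1 : ℝ) -
      (2 : ℝ) • (monomial α (1 : ℝ) * monomial β ε) + monomial β ε * monomial β ε := by
      rw [smul_eq_C_mul, map_ofNat]
      ring
    rw [this]
    rw [monomial_mul, monomial_mul, monomial_mul, one_mul, one_mul, ← pow_two ε, hε]
  rw [e1]
  module

/-- Sum the monomial bounds, with the sign of each coefficient absorbed into `ε` and the slack `F -
|coeff|` covered by a nonnegative constant. This provides the explicit feasible value from which the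
minimization starts. -/
theorem isSoSMod_const_sub {d : ℕ} {R F : ℝ} (hR : 0 ≤ R)
    (bd : ∀ α : Fin n →₀ ℕ, α.degree ≤ d → IsSoSMod W d (C R - monomial (α + α) 1))
    {f : MvPolynomial (Fin n) ℝ} (hf : f.totalDegree ≤ 2 * d) (hF : ∀ m, |coeff m f| ≤ F) :
    IsSoSMod W d (C ((monomialsUpTo n (2 * d)).card * F * R) - f) := by
  have hterm : ∀ m ∈ monomialsUpTo n (2 * d),
      IsSoSMod W d (C (F * R) - monomial m (coeff m f)) := by
    intro m hm
    rw [mem_monomialsUpTo_iff_degree] at hm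
    have hc : IsSoSMod W d (C ((F - |coeff m f|) * R)) :=
      isSoSMod_C (mul_nonneg (sub_nonneg.2 (hF m)) hR)
    obtain ⟨ε, hε, hεc⟩ : ∃ ε : ℝ, ε ^ 2 = 1 ∧ coeff m f = |coeff m f| * ε := by
      rcases le_total 0 (coeff m f) with h | h
      · exact ⟨1, by norm_num, by rw [abs_of_nonneg h, mul_one]⟩
      · exact ⟨-1, by norm_num, by rw [abs_of_nonpos h]; ring⟩
    have := ((isSoSMod_const_sub_monomial bd hm hε).smul (abs_nonneg (coeff m f))).add hc
    convert this using 1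
    rw [smul_sub, smul_monomial, smul_eq_mul, ← hεc, smul_eq_C_mul, ← C_mul]
    have : C (F * R) = (C (|coeff m f| * R) + C ((F - |coeff m f|) * R) : MvPolynomial (Fin n) ℝ) := by
      rw [← C_add]
      congr 1
      ring
    rw [this]
    ring
  have := IsSoSMod.sum _ hterm
  rw [Finset.sum_sub_distrib, sum_monomial_coeff hf, Finset.sum_const] at this
  convert this using 2
  rw [nsmul_eq_mul, mul_assoc, C_mul, map_natCast]

/-- Rewriting each monomial of `h` changes `h` by an element of `W`, so the normal form of `h` lies
in both `N` and `W` and is zero. Hence `h` equals the sum of the certified differences, weighted by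
its own coefficients. -/
theorem twoSidedBound_of_mem {N : Submodule ℝ (MvPolynomial (Fin n) ℝ)} {d : ℕ} {R M : ℝ}
    (hR : 0 ≤ R)
    (nf : ∀ m : Fin n →₀ ℕ, m.degree ≤ 2 * d →
      ∃ ν ∈ N, monomial m 1 - ν ∈ W ∧ TwoSidedBound g d (monomial m 1 - ν) R)
    (indep : ∀ ν ∈ N, ν ∈ W → ν = 0)
    {h : MvPolynomial (Fin n) ℝ} (hW : h ∈ W) (hd : h.totalDegree ≤ 2 * d)
    (hM : ∀ m, |coeff m h| ≤ M) :
    TwoSidedBound g d h ((monomialsUpTo n (2 * d)).card * (M * R)) := by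
  choose! ν hνN hνW hνB using nf
  have hdecomp : h = ∑ m ∈ monomialsUpTo n (2 * d), coeff m h • (monomial m 1 - ν m) +
      ∑ m ∈ monomialsUpTo n (2 * d), coeff m h • ν m := by
    conv_lhs => rw [← sum_monomial_coeff hd]
    rw [← Finset.sum_add_distrib]
    refine Finset.sum_congr rfl fun m _ => ?_
    rw [smul_sub, sub_add_cancel, smul_monomial, smul_eq_mul, mul_one]
  have h1 : ∑ m ∈ monomialsUpTo n (2 * d), coeff m h • (monomial m 1 - ν m) ∈ W :=
    W.sum_mem fun m hm => W.smul_mem _ (hνW m (mem_monomialsUpTo_iff_degree.1 hm))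
  have h2 : ∑ m ∈ monomialsUpTo n (2 * d), coeff m h • ν m = 0 := by
    refine indep _ (N.sum_mem fun m hm =>
      N.smul_mem _ (hνN m (mem_monomialsUpTo_iff_degree.1 hm))) ?_
    have := W.sub_mem hW h1
    rwa [sub_eq_of_eq_add' hdecomp] at this
  rw [h2, add_zero] at hdecomp
  have hB := TwoSidedBound.sum (g := g) (d := d) (monomialsUpTo n (2 * d))
    (h := fun m => coeff m h • (monomial m 1 - ν m)) (B := fun _ => M * R) fun m hm =>
      ((hνB m (mem_monomialsUpTo_iff_degree.1 hm)).smul (coeff m h)).mono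
        (mul_le_mul_of_nonneg_right (hM m) hR)
  rw [← hdecomp, Finset.sum_const, nsmul_eq_mul] at hB
  exact hB

/-- Criterion for bounded sum-of-squares proofs. `L` is a pseudo-expectation, `W` a space of
polynomials that can be added to certificates for free, and `N` a space of normal forms. -/
theorem hasBoundedSoSProof_of_normalForms (d : ℕ)
    (W N : Submodule ℝ (MvPolynomial (Fin n) ℝ)) (L : MvPolynomial (Fin n) ℝ →ₗ[ℝ] ℝ) {R : ℝ}
    (hR : 1 ≤ R) (hW : truncIdeal g (2 * d) ≤ W) (L_one : L 1 = 1)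
    (L_mem : ∀ h ∈ W, h.totalDegree ≤ 2 * d → L h = 0)
    (L_bound : ∀ m : Fin n →₀ ℕ, m.degree ≤ 2 * d → |L (monomial m 1)| ≤ R)
    (red : ∀ p : MvPolynomial (Fin n) ℝ, p.totalDegree ≤ d →
      ∃ p' : MvPolynomial (Fin n) ℝ, p'.totalDegree ≤ d ∧ p ^ 2 - p' ^ 2 ∈ W ∧
        ∀ m, coeff m p' ^ 2 ≤ R * L (p' ^ 2))
    (nf : ∀ m : Fin n →₀ ℕ, m.degree ≤ 2 * d →
      ∃ ν ∈ N, monomial m 1 - ν ∈ W ∧ TwoSidedBound g d (monomial m 1 - ν) R)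
    (indep : ∀ ν ∈ N, ν ∈ W → ν = 0)
    (bd : ∀ α : Fin n →₀ ℕ, α.degree ≤ d → IsSoSMod W d (C R - monomial (α + α) 1))
    {f : MvPolynomial (Fin n) ℝ} (hf : f.totalDegree ≤ 2 * d) {F : ℝ}
    (hF : ∀ m, |coeff m f| ≤ F) {D E b a M B : ℝ}
    (hD : D = (monomialsUpTo n d).card) (hE : E = (monomialsUpTo n (2 * d)).card)
    (hb : b = E * F * R) (ha : a = R * (2 * b)) (hM : M = b + F + D ^ 2 * a)
    (hB : b + F + D ^ 2 * (a + E * (M * R)) + E * (M * R) ≤ B) :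
    HasBoundedSoSProof g f d B := by
  have hR0 : 0 ≤ R := zero_le_one.trans hR
  have hF0 : 0 ≤ F := (abs_nonneg _).trans (hF 0)
  have hE0 : 0 ≤ E := hE ▸ Nat.cast_nonneg _
  have hb0 : 0 ≤ b := by rw [hb]; positivity
  have ha0 : 0 ≤ a := by rw [ha]; positivity
  have hM0 : 0 ≤ M := by rw [hM]; positivity
  -- values of `L`
  have L_C : ∀ c : ℝ, L (C c) = c := fun c => by
    rw [← mul_one (C c), ← smul_eq_C_mul, map_smul, L_one, smul_eq_mul, mul_one]
  -- Since `L` vanishes on `p² - p'²`, the bound from `red` may be stated with the original square.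
  have L_sq : ∀ p : MvPolynomial (Fin n) ℝ, p.totalDegree ≤ d →
      ∃ p' : MvPolynomial (Fin n) ℝ, p'.totalDegree ≤ d ∧ p ^ 2 - p' ^ 2 ∈ W ∧
        ∀ m, coeff m p' ^ 2 ≤ R * L (p ^ 2) := by
    intro p hp
    obtain ⟨p', h1, h2, h3⟩ := red p hp
    have h0 := L_mem _ h2 (totalDegree_sub_le
      ((totalDegree_pow _ _).trans (by omega)) ((totalDegree_pow _ _).trans (by omega)))
    rw [map_sub, sub_eq_zero] at h0
    exact ⟨p', h1, h2, fun m => h0 ▸ h3 m⟩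
  -- Positivity of `L` on squares is not a separate hypothesis: it follows from the bound on squared
  -- coefficients in `red`.
  have L_sq_nonneg : ∀ p : MvPolynomial (Fin n) ℝ, p.totalDegree ≤ d → 0 ≤ L (p ^ 2) := by
    intro p hp
    obtain ⟨p', -, -, h3⟩ := L_sq p hp
    exact nonneg_of_mul_nonneg_right ((sq_nonneg _).trans (h3 0)) (by linarith)
  have L_f : |L f| ≤ b := by
    rw [← sum_monomial_coeff hf, map_sum, hb, hE]
    refine (Finset.abs_sum_le_sum_abs _ _).trans ?_
    refine (Finset.sum_le_sum (g := fun _ => F * R) fun m hm => ?_).trans ?_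
    · have : monomial m (coeff m f) = coeff m f • monomial m (1 : ℝ) := by
        rw [smul_monomial, smul_eq_mul, mul_one]
      rw [this, map_smul, smul_eq_mul, abs_mul]
      exact mul_le_mul (hF m) (L_bound m (mem_monomialsUpTo_iff_degree.1 hm)) (abs_nonneg _) hF0
    · rw [Finset.sum_const, nsmul_eq_mul, mul_assoc]
  -- bounded Gram matrices
  have hrefine : ∀ c : ℝ, c ≤ b → IsSoSMod W d (C c - f) →
      ∃ A : Matrix (monomialsUpTo n d) (monomialsUpTo n d) ℝ, A.PosSemidef ∧
        (∀ α β, |A α β| ≤ a) ∧ C c - f - gramPolynomial A ∈ W ∧ -b ≤ c := by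
    rintro c hcb ⟨A, hA, hAW⟩
    obtain ⟨v, hv, hAv⟩ := exists_sum_sq_of_posSemidef hA
    choose v' hv'd hv'W hv'c using fun i => L_sq (v i) (hv i)
    have hdeg : (C c - f - gramPolynomial A).totalDegree ≤ 2 * d :=
      totalDegree_sub_le (totalDegree_sub_le (by simp) hf) (totalDegree_gramPolynomial_le A)
    -- Applying `L` to the certificate gives `∑ L(vᵢ²) = c - L f ≤ 2b`. This one number controls
    -- every entry of the new Gram matrix.
    have hL := L_mem _ hAW hdeg
    rw [map_sub, map_sub, L_C, hAv, map_sum, sub_eq_zero] at hL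
    have hsum : ∑ i, L (v i ^ 2) ≤ 2 * b := by
      rw [← hL]
      linarith [(abs_le.1 L_f).1]
    have hsum0 : 0 ≤ ∑ i, L (v i ^ 2) := Finset.sum_nonneg fun i _ => L_sq_nonneg _ (hv i)
    refine ⟨∑ i, squareGram d (v' i),
      Matrix.posSemidef_sum _ fun i _ => squareGram_posSemidef (v' i), ?_, ?_, ?_⟩
    · intro α β
      rw [Matrix.sum_apply, ha]
      refine (Finset.abs_sum_le_sum_abs _ _).trans (le_trans (Finset.sum_le_sum fun i _ => ?_)
        ((Finset.mul_sum _ _ _).symm.le.trans (mul_le_mul_of_nonneg_left hsum hR0)))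
      have h1 := hv'c i α
      have h2 := hv'c i β
      rw [squareGram]
      refine abs_le_of_sq_le_sq ?_ ((sq_nonneg _).trans h1)
      rw [mul_pow, pow_two (R * _)]
      exact mul_le_mul h1 h2 (sq_nonneg _) ((sq_nonneg _).trans h1)
    · rw [← gramLinear_apply, map_sum]
      simp only [gramLinear_apply, gramPolynomial_squareGram (hv'd _)]
      have h1 : C c - f - ∑ i, v' i ^ 2 =
          (C c - f - gramPolynomial A) + ∑ i, (v i ^ 2 - v' i ^ 2) := by
        rw [hAv, Finset.sum_sub_distrib]
        ring
      rw [h1]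
      exact W.add_mem hAW (W.sum_mem fun i _ => hv'W i)
    · linarith [(abs_le.1 L_f).1]
  -- the optimum exists
  have htop : IsSoSMod W d (C b - f) := by
    rw [hb, hE]
    exact isSoSMod_const_sub hR0 bd hf hF
  obtain ⟨c, hcmem, hcmin⟩ : ∃ c, IsLeast {c : ℝ | IsSoSMod W d (C c - f)} c := by
    -- By `hrefine`, restricting to `|c| ≤ b` and Gram entries at most `a` loses no feasible value
    -- below `b`. The restricted feasible set is compact, so the minimum is attained.
    let S : Set (ℝ × (monomialsUpTo n d → monomialsUpTo n d → ℝ)) :=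
      (Set.Icc (-b) b ×ˢ Set.univ.pi fun _ => Set.univ.pi fun _ => Set.Icc (-a) a) ∩
        ({x | (Matrix.of x.2).PosSemidef} ∩ {x | C x.1 - f - gramPolynomial (Matrix.of x.2) ∈ W})
    have hS : IsCompact S :=
      (isCompact_Icc.prod (isCompact_univ_pi fun _ => isCompact_univ_pi fun _ =>
        isCompact_Icc)).inter_right
          ((isClosed_setOf_posSemidef.preimage continuous_snd).inter
            (isClosed_setOf_sub_gram_mem W f d))
    have hmemS : ∀ c : ℝ, c ≤ b → IsSoSMod W d (C c - f) → c ∈ Prod.fst '' S := by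
      intro c hcb hc
      obtain ⟨A, h1, h2, h3, h4⟩ := hrefine c hcb hc
      refine ⟨(c, A), ⟨⟨⟨h4, hcb⟩, ?_⟩, h1, h3⟩, rfl⟩
      intro α _ β _
      exact abs_le.1 (h2 α β)
    obtain ⟨c, hc1, hc2⟩ := (hS.image continuous_fst).exists_isLeast ⟨b, hmemS b le_rfl htop⟩
    refine ⟨c, ?_, ?_⟩
    · obtain ⟨⟨c', A⟩, ⟨-, h1, h2⟩, rfl⟩ := hc1
      exact ⟨A, h1, h2⟩
    · intro c' hc'
      rcases le_total c' b with h | h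
      · exact hc2 (hmemS c' h hc')
      · exact (hc2 (hmemS b le_rfl htop)).trans h
  have hcb : c ≤ b := hcmin htop
  -- from certificates modulo `W` to proofs
  have hproof : ∀ (c : ℝ) (A : Matrix (monomialsUpTo n d) (monomialsUpTo n d) ℝ) (M : ℝ),
      A.PosSemidef → C c - f - gramPolynomial A ∈ W →
      (∀ m, |coeff m (C c - f - gramPolynomial A)| ≤ M) →
      ∃ P : SoSProof g f d c, (∀ α β, |P.A α β| ≤ |A α β| + E * (M * R)) ∧
        ∀ j m, |coeff m (P.q j)| ≤ E * (M * R) := by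
    intro c A M hA hAW hM
    have hdeg : (C c - f - gramPolynomial A).totalDegree ≤ 2 * d :=
      totalDegree_sub_le (totalDegree_sub_le (by simp) hf) (totalDegree_gramPolynomial_le A)
    obtain ⟨A', q, h1, h2, h3, h4, h5⟩ := (twoSidedBound_of_mem hR0 nf indep hAW hdeg hM).1
    refine ⟨⟨A + A', q, hA.add h1, h2, ?_⟩, ?_, ?_⟩
    · rw [gramPolynomial_add, add_assoc, ← h5]
      ring
    · intro α β
      refine (abs_add_le _ _).trans (add_le_add le_rfl ?_)
      rw [hE]
      exact h3 α β
    · rw [hE]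
      exact h4
  -- Since elements of `W` of degree at most `2d` are themselves certified, working modulo `W`
  -- proves exactly the same bounds as genuine proofs, although `W` may be larger than the truncated
  -- ideal.
  have hiff : {c : ℝ | Nonempty (SoSProof g f d c)} = {c : ℝ | IsSoSMod W d (C c - f)} := by
    ext c
    constructor
    · rintro ⟨P⟩
      refine ⟨P.A, P.posSemidef, hW ⟨P.q, P.degree_le, ?_⟩⟩
      rw [P.identity]
      ring
    · rintro ⟨A, hA, hAW⟩
      -- Only existence is needed here, so the sum of the absolute values of all coefficients is a
      -- good enough bound.
      obtain ⟨P, -⟩ := hproof c A (∑ m ∈ (C c - f - gramPolynomial A).support,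
        |coeff m (C c - f - gramPolynomial A)|) hA hAW fun m => by
          by_cases hm : m ∈ (C c - f - gramPolynomial A).support
          · exact Finset.single_le_sum (f := fun m => |coeff m (C c - f - gramPolynomial A)|)
              (fun _ _ => abs_nonneg _) hm
          · rw [notMem_support_iff.1 hm, abs_zero]
            exact Finset.sum_nonneg fun _ _ => abs_nonneg _
      exact ⟨P⟩
  obtain ⟨A, hA, hAa, hAW, hbc⟩ := hrefine c hcb hcmem
  have hcabs : |c| ≤ b := abs_le.2 ⟨hbc, hcb⟩
  have hcf : ∀ m, |coeff m (C c - f)| ≤ b + F := by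
    intro m
    rw [coeff_sub]
    refine (abs_sub _ _).trans (add_le_add ?_ (hF m))
    rw [coeff_C]
    split_ifs
    · exact hcabs
    · rw [abs_zero]
      exact hb0
  obtain ⟨P, hP1, hP2⟩ := hproof c A M hA hAW fun m => by
    rw [coeff_sub, hM, hD]
    exact (abs_sub _ _).trans (add_le_add (hcf m) (abs_coeff_gramPolynomial_le hAa m))
  have hX : 0 ≤ E * (M * R) := by positivity
  have hD1 : 1 ≤ D := hD ▸ one_le_card_monomialsUpTo d
  have hP1' : ∀ α β, |P.A α β| ≤ a + E * (M * R) := fun α β =>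
    (hP1 α β).trans (add_le_add (hAa α β) le_rfl)
  have hDa : a + E * (M * R) ≤ D ^ 2 * (a + E * (M * R)) :=
    le_mul_of_one_le_left (by positivity) (one_le_pow₀ hD1)
  refine ⟨c, ?_, P, ?_, ?_, ?_, ?_⟩
  · rw [IsSoSOptimum, hiff]
    exact ⟨hcmem, hcmin⟩
  · have : 0 ≤ a + E * (M * R) := by positivity
    linarith
  · intro α β
    linarith [hP1' α β]
  · intro j m
    have : 0 ≤ a + E * (M * R) := by positivity
    linarith [hP2 j m]
  · intro m
    have h1 : ∑ j, P.q j * g j = C c - f - gramPolynomial P.A := by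
      rw [P.identity]
      ring
    rw [h1, coeff_sub]
    have h2 := abs_coeff_gramPolynomial_le hP1' m
    rw [← hD] at h2
    have h3 := hcf m
    have h4 := abs_sub (coeff m (C c - f)) (coeff m (gramPolynomial P.A))
    linarith

end Criterion

end SoSBound

/-! ### The bounds of the criterion as powers of `n ^ d`. -/

namespace SoSBound

theorem _root_.HasBoundedSoSProof.mono {n : ℕ} {ι : Type} [Fintype ι]
    {g : ι → MvPolynomial (Fin n) ℝ} {f : MvPolynomial (Fin n) ℝ} {d : ℕ} {B B' : ℝ}
    (H : HasBoundedSoSProof g f d B) (hB : B ≤ B') : HasBoundedSoSProof g f d B' := by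
  obtain ⟨c, hc, P, h1, h2, h3, h4⟩ := H
  exact ⟨c, hc, P, h1.trans hB, fun α β => (h2 α β).trans hB, fun j m => (h3 j m).trans hB,
    fun m => (h4 m).trans hB⟩

/-- Every objective of degree `2d` with coefficients at most `n ^ (K d)` has an optimal proof with
coefficients at most `n ^ ((K + r) d)`. -/
def BoundedSoS {n : ℕ} {ι : Type} [Fintype ι] (g : ι → MvPolynomial (Fin n) ℝ) (d r : ℕ) : Prop :=
  ∀ (K : ℕ) (f : MvPolynomial (Fin n) ℝ), f.totalDegree ≤ 2 * d →
    (∀ m, |coeff m f| ≤ (n : ℝ) ^ (K * d)) →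
      HasBoundedSoSProof g f d ((n : ℝ) ^ ((K + r) * d))

theorem BoundedSoS.mono {n : ℕ} {ι : Type} [Fintype ι] {g : ι → MvPolynomial (Fin n) ℝ}
    {d r r' : ℕ} (hn : 1 ≤ n) (H : BoundedSoS g d r) (hr : r ≤ r') : BoundedSoS g d r' :=
  fun K f hf hF => (H K f hf hF).mono (pow_le_pow_right₀ (by exact_mod_cast hn)
    (Nat.mul_le_mul_right d (Nat.add_le_add_left hr K)))

/-- The hypotheses of `hasBoundedSoSProof_of_normalForms` with `R = n ^ (r d)`. -/
structure HasNormalForms {n : ℕ} {ι : Type} [Fintype ι] (g : ι → MvPolynomial (Fin n) ℝ) (d r : ℕ)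
    (W N : Submodule ℝ (MvPolynomial (Fin n) ℝ)) (L : MvPolynomial (Fin n) ℝ →ₗ[ℝ] ℝ) : Prop where
  le_W : truncIdeal g (2 * d) ≤ W
  L_one : L 1 = 1
  L_mem : ∀ h ∈ W, h.totalDegree ≤ 2 * d → L h = 0
  L_bound : ∀ m : Fin n →₀ ℕ, m.degree ≤ 2 * d → |L (monomial m 1)| ≤ (n : ℝ) ^ (r * d)
  red : ∀ p : MvPolynomial (Fin n) ℝ, p.totalDegree ≤ d →
      ∃ p' : MvPolynomial (Fin n) ℝ, p'.totalDegree ≤ d ∧ p ^ 2 - p' ^ 2 ∈ W ∧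
        ∀ m, coeff m p' ^ 2 ≤ (n : ℝ) ^ (r * d) * L (p' ^ 2)
  nf : ∀ m : Fin n →₀ ℕ, m.degree ≤ 2 * d → ∃ ν ∈ N, monomial m 1 - ν ∈ W ∧
      TwoSidedBound g d (monomial m 1 - ν) ((n : ℝ) ^ (r * d))
  indep : ∀ ν ∈ N, ν ∈ W → ν = 0
  bd : ∀ α : Fin n →₀ ℕ, α.degree ≤ d →
      IsSoSMod W d (C ((n : ℝ) ^ (r * d)) - monomial (α + α) 1)

/-- Everything is measured in powers of `Q = n ^ d ≥ 2`: there are at most `Q ^ 2` and `Q ^ 4`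
monomials of degree at most `d` and `2d`, and a factor `2` costs one power of `Q`. The factor `R = Q
^ r` enters three times (in `b`, in the Gram bound and in the rewriting of the defect), whereas `Q ^
K` enters once because the bounds are linear in the coefficients of `f`. -/
theorem HasNormalForms.boundedSoS {n : ℕ} {ι : Type} [Fintype ι]
    {g : ι → MvPolynomial (Fin n) ℝ} {d r : ℕ} {W N : Submodule ℝ (MvPolynomial (Fin n) ℝ)}
    {L : MvPolynomial (Fin n) ℝ →ₗ[ℝ] ℝ} (hn : 2 ≤ n) (hd : 1 ≤ d)
    (H : HasNormalForms g d r W N L) : BoundedSoS g d (3 * r + 22) := by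
  intro K f hf hF
  obtain ⟨Q, hQ⟩ : ∃ Q : ℝ, Q = (n : ℝ) ^ d := ⟨_, rfl⟩
  have hpow : ∀ j : ℕ, (n : ℝ) ^ (j * d) = Q ^ j := fun j => by rw [hQ, ← pow_mul, mul_comm]
  have hQ2 : 2 ≤ Q := by
    rw [hQ]
    have h2 : (2 : ℝ) ≤ n := by exact_mod_cast hn
    calc (2 : ℝ) ≤ n := h2
      _ = (n : ℝ) ^ 1 := (pow_one _).symm
      _ ≤ (n : ℝ) ^ d := pow_le_pow_right₀ (by linarith) hd
  have hQ1 : 1 ≤ Q := by linarith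
  have hQ0 : 0 < Q := by linarith
  have hmono : ∀ {i j : ℕ}, i ≤ j → Q ^ i ≤ Q ^ j := fun h => pow_le_pow_right₀ hQ1 h
  have htwo : ∀ j : ℕ, 2 * Q ^ j ≤ Q ^ (j + 1) := fun j => by
    rw [pow_succ']
    exact mul_le_mul_of_nonneg_right hQ2 (pow_nonneg hQ0.le j)
  refine hasBoundedSoSProof_of_normalForms d W N L (one_le_pow₀ (by exact_mod_cast (by omega)))
    H.le_W H.L_one H.L_mem H.L_bound H.red H.nf H.indep H.bd hf hF rfl rfl rfl rfl rfl ?_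
  rw [hpow, hpow, hpow]
  have hD : ((monomialsUpTo n d).card : ℝ) ≤ Q ^ 2 := by
    rw [← hpow]
    exact card_monomialsUpTo_le hn d
  have hE : ((monomialsUpTo n (2 * d)).card : ℝ) ≤ Q ^ 4 := by
    rw [← hpow]
    refine (card_monomialsUpTo_le hn (2 * d)).trans (le_of_eq ?_)
    congr 1
    ring
  have hD0 : (0 : ℝ) ≤ (monomialsUpTo n d).card := Nat.cast_nonneg _
  have hE0 : (0 : ℝ) ≤ (monomialsUpTo n (2 * d)).card := Nat.cast_nonneg _
  generalize ((monomialsUpTo n d).card : ℝ) = D at *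
  generalize ((monomialsUpTo n (2 * d)).card : ℝ) = E at *
  have hb : E * Q ^ K * Q ^ r ≤ Q ^ (4 + K + r) := by
    rw [pow_add, pow_add]
    gcongr
  have hb0 : 0 ≤ E * Q ^ K * Q ^ r := by positivity
  generalize E * Q ^ K * Q ^ r = b at *
  have ha : Q ^ r * (2 * b) ≤ Q ^ (5 + K + 2 * r) := by
    calc Q ^ r * (2 * b) ≤ Q ^ r * (2 * Q ^ (4 + K + r)) := by gcongr
      _ ≤ Q ^ r * Q ^ (4 + K + r + 1) := mul_le_mul_of_nonneg_left (htwo _) (by positivity)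
      _ = Q ^ (5 + K + 2 * r) := by rw [← pow_add]; congr 1; ring
  have ha0 : 0 ≤ Q ^ r * (2 * b) := by positivity
  generalize Q ^ r * (2 * b) = a at *
  have hDa : D ^ 2 * a ≤ Q ^ (9 + K + 2 * r) := by
    calc D ^ 2 * a ≤ (Q ^ 2) ^ 2 * Q ^ (5 + K + 2 * r) := by gcongr
      _ = Q ^ (9 + K + 2 * r) := by rw [← pow_mul, ← pow_add]; congr 1; ring
  have hbF : b + Q ^ K ≤ Q ^ (9 + K + 2 * r) := by
    calc b + Q ^ K ≤ Q ^ (8 + K + 2 * r) + Q ^ (8 + K + 2 * r) :=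
          add_le_add (hb.trans (hmono (by omega))) (hmono (by omega))
      _ = 2 * Q ^ (8 + K + 2 * r) := (two_mul _).symm
      _ ≤ Q ^ (8 + K + 2 * r + 1) := htwo _
      _ = Q ^ (9 + K + 2 * r) := by congr 1; ring
  have hM : b + Q ^ K + D ^ 2 * a ≤ Q ^ (10 + K + 2 * r) := by
    calc b + Q ^ K + D ^ 2 * a ≤ 2 * Q ^ (9 + K + 2 * r) := by linarith
      _ ≤ Q ^ (9 + K + 2 * r + 1) := htwo _
      _ = Q ^ (10 + K + 2 * r) := by congr 1; ring
  have hM0 : 0 ≤ b + Q ^ K + D ^ 2 * a := by positivity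
  have hEM : E * ((b + Q ^ K + D ^ 2 * a) * Q ^ r) ≤ Q ^ (14 + K + 3 * r) := by
    calc E * ((b + Q ^ K + D ^ 2 * a) * Q ^ r) ≤ Q ^ 4 * (Q ^ (10 + K + 2 * r) * Q ^ r) := by
          gcongr
      _ = Q ^ (14 + K + 3 * r) := by rw [← pow_add, ← pow_add]; congr 1; ring
  have hEM0 : 0 ≤ E * ((b + Q ^ K + D ^ 2 * a) * Q ^ r) := by positivity
  generalize E * ((b + Q ^ K + D ^ 2 * a) * Q ^ r) = X at *
  have haX : a + X ≤ Q ^ (15 + K + 3 * r) := by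
    calc a + X ≤ Q ^ (14 + K + 3 * r) + Q ^ (14 + K + 3 * r) :=
          add_le_add (ha.trans (hmono (by omega))) hEM
      _ = 2 * Q ^ (14 + K + 3 * r) := (two_mul _).symm
      _ ≤ Q ^ (14 + K + 3 * r + 1) := htwo _
      _ = Q ^ (15 + K + 3 * r) := by congr 1; ring
  have hDaX : D ^ 2 * (a + X) ≤ Q ^ (19 + K + 3 * r) := by
    calc D ^ 2 * (a + X) ≤ (Q ^ 2) ^ 2 * Q ^ (15 + K + 3 * r) := by gcongr
      _ = Q ^ (19 + K + 3 * r) := by rw [← pow_mul, ← pow_add]; congr 1; ring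
  calc b + Q ^ K + D ^ 2 * (a + X) + X
      ≤ Q ^ (19 + K + 3 * r) + Q ^ (19 + K + 3 * r) + Q ^ (19 + K + 3 * r) :=
        add_le_add (add_le_add (hbF.trans (hmono (by omega))) hDaX) (hEM.trans (hmono (by omega)))
    _ ≤ 2 * (2 * Q ^ (19 + K + 3 * r)) := by
        have : 0 ≤ Q ^ (19 + K + 3 * r) := by positivity
        linarith
    _ ≤ 2 * Q ^ (19 + K + 3 * r + 1) := mul_le_mul_of_nonneg_left (htwo _) zero_le_two
    _ ≤ Q ^ (19 + K + 3 * r + 1 + 1) := htwo _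
    _ ≤ Q ^ (K + (3 * r + 22)) := hmono (by omega)

/-! ### Transport of bounded proofs along affine substitutions. -/

section AffineSubstitution

variable {n : ℕ}

/-- The sum of the absolute values of the coefficients. -/
noncomputable def coeffNorm (p : MvPolynomial (Fin n) ℝ) : ℝ := ∑ m ∈ p.support, |coeff m p|

theorem coeffNorm_eq_sum {p : MvPolynomial (Fin n) ℝ} {s : Finset (Fin n →₀ ℕ)}
    (hs : p.support ⊆ s) : coeffNorm p = ∑ m ∈ s, |coeff m p| :=
  Finset.sum_subset hs fun m _ hm => by rw [notMem_support_iff.1 hm, abs_zero]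

theorem coeffNorm_nonneg (p : MvPolynomial (Fin n) ℝ) : 0 ≤ coeffNorm p :=
  Finset.sum_nonneg fun _ _ => abs_nonneg _

theorem abs_coeff_le_coeffNorm (p : MvPolynomial (Fin n) ℝ) (m : Fin n →₀ ℕ) :
    |coeff m p| ≤ coeffNorm p := by
  classical
  rw [coeffNorm_eq_sum (Finset.subset_insert m p.support)]
  exact Finset.single_le_sum (f := fun m => |coeff m p|) (fun _ _ => abs_nonneg _)
    (Finset.mem_insert_self m _)

theorem coeffNorm_add_le (p q : MvPolynomial (Fin n) ℝ) :
    coeffNorm (p + q) ≤ coeffNorm p + coeffNorm q := by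
  classical
  rw [coeffNorm_eq_sum (support_add (p := p) (q := q)),
    coeffNorm_eq_sum (Finset.subset_union_left (s₁ := p.support) (s₂ := q.support)),
    coeffNorm_eq_sum (Finset.subset_union_right (s₁ := p.support) (s₂ := q.support)),
    ← Finset.sum_add_distrib]
  exact Finset.sum_le_sum fun m _ => by rw [coeff_add]; exact abs_add_le _ _

theorem coeffNorm_sum_le {κ : Type*} (s : Finset κ) (p : κ → MvPolynomial (Fin n) ℝ) :
    coeffNorm (∑ i ∈ s, p i) ≤ ∑ i ∈ s, coeffNorm (p i) :=
  Finset.le_sum_of_subadditive coeffNorm (by simp [coeffNorm]) coeffNorm_add_le s p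

theorem coeffNorm_monomial (m : Fin n →₀ ℕ) (c : ℝ) : coeffNorm (monomial m c) = |c| := by
  rw [coeffNorm_eq_sum (support_monomial_subset), Finset.sum_singleton, coeff_monomial, if_pos rfl]

theorem coeffNorm_mul_le (p q : MvPolynomial (Fin n) ℝ) :
    coeffNorm (p * q) ≤ coeffNorm p * coeffNorm q := by
  conv_lhs => rw [p.as_sum, q.as_sum, Finset.sum_mul_sum]
  refine (coeffNorm_sum_le _ _).trans ?_
  rw [coeffNorm, coeffNorm, Finset.sum_mul_sum]
  refine Finset.sum_le_sum fun a _ => (coeffNorm_sum_le _ _).trans (Finset.sum_le_sum fun b _ => ?_)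
  rw [monomial_mul, coeffNorm_monomial, abs_mul]

theorem coeffNorm_pow_le {p : MvPolynomial (Fin n) ℝ} {c : ℝ} (hp : coeffNorm p ≤ c) (j : ℕ) :
    coeffNorm (p ^ j) ≤ c ^ j := by
  induction j with
  | zero =>
    have := coeffNorm_monomial (0 : Fin n →₀ ℕ) 1
    rw [monomial_zero', C_1, abs_one] at this
    simp [this]
  | succ j ih =>
    rw [pow_succ, pow_succ]
    exact (coeffNorm_mul_le _ _).trans
      (mul_le_mul ih hp (coeffNorm_nonneg _) ((coeffNorm_nonneg _).trans ih))

theorem coeffNorm_prod_le {κ : Type*} (s : Finset κ) {p : κ → MvPolynomial (Fin n) ℝ} {c : κ → ℝ}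
    (h : ∀ i ∈ s, coeffNorm (p i) ≤ c i) : coeffNorm (∏ i ∈ s, p i) ≤ ∏ i ∈ s, c i := by
  classical
  induction s using Finset.induction_on with
  | empty => simpa using coeffNorm_pow_le (p := (0 : MvPolynomial (Fin n) ℝ)) le_rfl 0
  | insert a s ha ih =>
    rw [Finset.prod_insert ha, Finset.prod_insert ha]
    have h1 := h a (Finset.mem_insert_self a s)
    exact (coeffNorm_mul_le _ _).trans (mul_le_mul h1
      (ih fun i hi => h i (Finset.mem_insert_of_mem hi)) (coeffNorm_nonneg _)
      ((coeffNorm_nonneg _).trans h1))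

/-- The substitution `X i ↦ a X i + b`. -/
noncomputable def affineSubst (n : ℕ) (a b : ℝ) :
    MvPolynomial (Fin n) ℝ →ₐ[ℝ] MvPolynomial (Fin n) ℝ :=
  aeval fun i => C a * X i + C b

theorem affineSubst_X (a b : ℝ) (i : Fin n) : affineSubst n a b (X i) = C a * X i + C b :=
  aeval_X _ i

theorem affineSubst_C (a b c : ℝ) : affineSubst n a b (C c) = C c :=
  (affineSubst n a b).commutes c

theorem affineSubst_affineSubst {a b a' b' : ℝ} (h1 : a' * a = 1) (h2 : a' * b + b' = 0)
    (p : MvPolynomial (Fin n) ℝ) : affineSubst n a b (affineSubst n a' b' p) = p := by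
  have : (affineSubst n a b).comp (affineSubst n a' b') = AlgHom.id ℝ _ := by
    refine MvPolynomial.algHom_ext fun i => ?_
    simp only [AlgHom.comp_apply, affineSubst_X, map_add, map_mul, affineSubst_C, AlgHom.id_apply]
    rw [mul_add, ← mul_assoc, ← C_mul, h1, add_assoc, ← C_mul, ← C_add, h2]
    simp
  exact DFunLike.congr_fun this p

theorem affineSubst_monomial (a b : ℝ) (m : Fin n →₀ ℕ) (c : ℝ) :
    affineSubst n a b (monomial m c) = c • ∏ i, (C a * X i + C b) ^ m i := by
  rw [affineSubst, aeval_monomial, Finsupp.prod_fintype _ _ fun _ => pow_zero _,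
    Algebra.smul_def]

theorem totalDegree_affine_le (a b : ℝ) (i : Fin n) :
    (C a * X i + C b : MvPolynomial (Fin n) ℝ).totalDegree ≤ 1 := by
  refine totalDegree_add_le ?_ (by simp)
  have := totalDegree_mul_le (p := C a) (q := (X i : MvPolynomial (Fin n) ℝ)) (a := 0) (b := 1)
    (by simp) (by simp)
  simpa using this

theorem totalDegree_affineSubst_le (a b : ℝ) {p : MvPolynomial (Fin n) ℝ} {e : ℕ}
    (hp : p.totalDegree ≤ e) : (affineSubst n a b p).totalDegree ≤ e := by
  rw [← sum_monomial_coeff hp, map_sum]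
  refine totalDegree_sum_le fun m hm => ?_
  rw [mem_monomialsUpTo] at hm
  rw [affineSubst_monomial]
  refine (totalDegree_smul_le _ _).trans ((totalDegree_finsetProd _ _).trans
    ((Finset.sum_le_sum fun i _ => ?_).trans hm))
  refine (totalDegree_pow _ _).trans ?_
  simpa using Nat.mul_le_mul_left (m i) (totalDegree_affine_le a b i)

theorem coeffNorm_affine_le {a b : ℝ} (hab : |a| + |b| ≤ 4) (i : Fin n) :
    coeffNorm (C a * X i + C b : MvPolynomial (Fin n) ℝ) ≤ 4 := by
  refine (coeffNorm_add_le _ _).trans ((le_of_eq ?_).trans hab)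
  have h1 : (C a * X i : MvPolynomial (Fin n) ℝ) = monomial (Finsupp.single i 1) a := by
    rw [X, C_mul_monomial, mul_one]
  have h2 : (C b : MvPolynomial (Fin n) ℝ) = monomial 0 b := rfl
  rw [h1, h2, coeffNorm_monomial, coeffNorm_monomial]

/-- The coefficient norm is submultiplicative, and every variable is replaced by a factor of norm at
most `4`. -/
theorem coeffNorm_affineSubst_monomial_le {a b : ℝ} (hab : |a| + |b| ≤ 4) {m : Fin n →₀ ℕ} {e : ℕ}
    (hm : m.degree ≤ e) : coeffNorm (affineSubst n a b (monomial m 1)) ≤ 4 ^ e := by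
  rw [affineSubst_monomial, one_smul]
  refine (coeffNorm_prod_le (c := fun i => 4 ^ m i) _ fun i _ =>
    coeffNorm_pow_le (coeffNorm_affine_le hab i) (m i)).trans ?_
  rw [Finset.prod_pow_eq_pow_sum, ← Finsupp.degree_eq_sum]
  exact pow_le_pow_right₀ (by norm_num) hm

theorem abs_coeff_affineSubst_le {a b : ℝ} (hab : |a| + |b| ≤ 4) {p : MvPolynomial (Fin n) ℝ}
    {e : ℕ} (hp : p.totalDegree ≤ e) {B : ℝ} (hB : ∀ m, |coeff m p| ≤ B) (m : Fin n →₀ ℕ) :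
    |coeff m (affineSubst n a b p)| ≤ (monomialsUpTo n e).card * (B * 4 ^ e) := by
  rw [← nsmul_eq_mul, ← Finset.sum_const, ← sum_monomial_coeff hp, map_sum, coeff_sum]
  refine (Finset.abs_sum_le_sum_abs _ _).trans (Finset.sum_le_sum fun m' hm' => ?_)
  have h1 : monomial m' (coeff m' p) = coeff m' p • monomial m' (1 : ℝ) := by
    rw [smul_monomial, smul_eq_mul, mul_one]
  rw [h1, map_smul, coeff_smul, smul_eq_mul, abs_mul]
  exact mul_le_mul (hB m') ((abs_coeff_le_coeffNorm _ _).trans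
    (coeffNorm_affineSubst_monomial_le hab (mem_monomialsUpTo_iff_degree.1 hm'))) (abs_nonneg _)
    ((abs_nonneg _).trans (hB m'))

/-- The substitution does not raise degrees, so it acts on the vector of monomials of degree at most
`d` by a matrix `T`. The Gram matrix is then changed by a congruence, which preserves positive
semidefiniteness. -/
theorem exists_affineSubst_gramPolynomial {a b : ℝ} (hab : |a| + |b| ≤ 4) (d : ℕ) :
    ∃ T : Matrix (monomialsUpTo n d) (monomialsUpTo n d) ℝ, (∀ α γ, |T α γ| ≤ 4 ^ d) ∧
      ∀ A, affineSubst n a b (gramPolynomial A) = gramPolynomial (T * A * T.conjTranspose) := by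
  let T : Matrix (monomialsUpTo n d) (monomialsUpTo n d) ℝ := fun α γ =>
    coeff (α : Fin n →₀ ℕ) (affineSubst n a b (monomial (γ : Fin n →₀ ℕ) 1))
  have hT : ∀ α γ, |T α γ| ≤ 4 ^ d := fun α γ => (abs_coeff_le_coeffNorm _ _).trans
    (coeffNorm_affineSubst_monomial_le hab (mem_monomialsUpTo_iff_degree.1 γ.2))
  have hTsum : ∀ γ : monomialsUpTo n d, affineSubst n a b (monomial (γ : Fin n →₀ ℕ) 1) =
      ∑ α : monomialsUpTo n d, monomial (α : Fin n →₀ ℕ) (T α γ) := by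
    intro γ
    have hdeg := totalDegree_affineSubst_le a b ((totalDegree_monomial_le_degree
      (γ : Fin n →₀ ℕ) 1).trans (mem_monomialsUpTo_iff_degree.1 γ.2))
    conv_lhs => rw [← sum_monomial_coeff hdeg]
    rw [← Finset.sum_coe_sort (monomialsUpTo n d)]
  clear_value T
  refine ⟨T, hT, fun A => ?_⟩
  have hterm : ∀ γ δ : monomialsUpTo n d,
      affineSubst n a b (monomial ((γ : Fin n →₀ ℕ) + (δ : Fin n →₀ ℕ)) (A γ δ)) =
      ∑ α : monomialsUpTo n d, ∑ β : monomialsUpTo n d,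
        monomial ((α : Fin n →₀ ℕ) + (β : Fin n →₀ ℕ)) (T α γ * A γ δ * T β δ) := by
    intro γ δ
    have h1 : monomial ((γ : Fin n →₀ ℕ) + (δ : Fin n →₀ ℕ)) (A γ δ) =
        A γ δ • (monomial (γ : Fin n →₀ ℕ) (1 : ℝ) * monomial (δ : Fin n →₀ ℕ) 1) := by
      rw [monomial_mul, smul_monomial, smul_eq_mul, mul_one, mul_one]
    rw [h1, map_smul, map_mul, hTsum, hTsum, Finset.sum_mul_sum, Finset.smul_sum]
    refine Finset.sum_congr rfl fun α _ => ?_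
    rw [Finset.smul_sum]
    refine Finset.sum_congr rfl fun β _ => ?_
    rw [monomial_mul, smul_monomial, smul_eq_mul]
    congr 1
    ring
  have hentry : ∀ α β : monomialsUpTo n d, (T * A * T.conjTranspose) α β =
      ∑ γ, ∑ δ, T α γ * A γ δ * T β δ := by
    intro α β
    simp only [Matrix.mul_apply, Matrix.conjTranspose_apply, star_trivial, Finset.sum_mul]
    rw [Finset.sum_comm]
  simp only [gramPolynomial, map_sum, hterm, hentry]
  generalize hF : (fun (γ δ α β : monomialsUpTo n d) =>
    (monomial ((α : Fin n →₀ ℕ) + (β : Fin n →₀ ℕ)) (T α γ * A γ δ * T β δ) :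
      MvPolynomial (Fin n) ℝ)) = F
  have hF' : ∀ γ δ α β : monomialsUpTo n d,
      (monomial ((α : Fin n →₀ ℕ) + (β : Fin n →₀ ℕ)) (T α γ * A γ δ * T β δ) :
        MvPolynomial (Fin n) ℝ) = F γ δ α β := fun γ δ α β => by rw [← hF]
  simp only [hF']
  calc ∑ γ, ∑ δ, ∑ α, ∑ β, F γ δ α β = ∑ γ, ∑ α, ∑ δ, ∑ β, F γ δ α β :=
        Finset.sum_congr rfl fun γ _ => Finset.sum_comm
    _ = ∑ α, ∑ γ, ∑ δ, ∑ β, F γ δ α β := Finset.sum_comm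
    _ = ∑ α, ∑ γ, ∑ β, ∑ δ, F γ δ α β :=
        Finset.sum_congr rfl fun α _ => Finset.sum_congr rfl fun γ _ => Finset.sum_comm
    _ = ∑ α, ∑ β, ∑ γ, ∑ δ, F γ δ α β := Finset.sum_congr rfl fun α _ => Finset.sum_comm

variable {ι ι' : Type} [Fintype ι] [Fintype ι'] {g : ι → MvPolynomial (Fin n) ℝ}
  {g' : ι' → MvPolynomial (Fin n) ℝ}

/-- Transport of a sum-of-squares proof along an affine substitution. -/
theorem _root_.SoSProof.exists_affineSubst {a b : ℝ} (hab : |a| + |b| ≤ 4) (e : ι ≃ ι')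
    {u : ι → ℝ} (hu : ∀ j, |u j| ≤ 4) (hg : ∀ j, affineSubst n a b (g j) = C (u j) * g' (e j))
    (hg0 : ∀ j, g j ≠ 0) {f : MvPolynomial (Fin n) ℝ} {d : ℕ} {c : ℝ} (P : SoSProof g f d c)
    {B B' : ℝ} (hP : P.BoundedBy B)
    (hA : (monomialsUpTo n d).card ^ 2 * ((4 ^ d) ^ 2 * B) ≤ B')
    (hq : 4 * ((monomialsUpTo n (2 * d)).card * (B * 4 ^ (2 * d))) ≤ B') :
    ∃ P' : SoSProof g' (affineSubst n a b f) d c, P'.BoundedBy B' := by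
  obtain ⟨hc, hPA, hPq, hPI⟩ := hP
  have hB0 : 0 ≤ B := (abs_nonneg _).trans hc
  obtain ⟨T, hT, hgram⟩ := exists_affineSubst_gramPolynomial hab d
  have hqg : ∀ j, C (u j) * affineSubst n a b (P.q j) * g' (e j) =
      affineSubst n a b (P.q j * g j) := by
    intro j
    rw [map_mul, hg]
    ring
  have hsum : ∑ j', (C (u (e.symm j')) * affineSubst n a b (P.q (e.symm j'))) * g' j' =
      affineSubst n a b (∑ j, P.q j * g j) := by
    rw [map_sum, ← Equiv.sum_comp e]
    exact Finset.sum_congr rfl fun j _ => by rw [e.symm_apply_apply, hqg]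
  -- The coefficient bound for a substituted polynomial needs the degree of the multiplier itself.
  -- It is read off from the degree of the product, because the generator is nonzero in a domain.
  have hqdeg : ∀ j, (P.q j).totalDegree ≤ 2 * d := by
    intro j
    by_cases h0 : P.q j = 0
    · simp [h0]
    · have := P.degree_le j
      rw [totalDegree_mul_of_isDomain h0 (hg0 j)] at this
      omega
  refine ⟨⟨T * P.A * T.conjTranspose, fun j' => C (u (e.symm j')) * affineSubst n a b (P.q (e.symm j')),
    P.posSemidef.mul_mul_conjTranspose_same T, ?_, ?_⟩, ?_, ?_, ?_, ?_⟩
  · intro j'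
    obtain ⟨j, rfl⟩ := e.surjective j'
    rw [e.symm_apply_apply, hqg]
    exact totalDegree_affineSubst_le a b (P.degree_le j)
  · rw [hsum, ← hgram, ← map_add, ← P.identity, map_sub, affineSubst_C]
  · refine hc.trans (le_trans ?_ hA)
    have h1 := one_le_card_monomialsUpTo (n := n) d
    have h2 : (1 : ℝ) ≤ (4 ^ d) ^ 2 := one_le_pow₀ (one_le_pow₀ (by norm_num))
    have h3 : (1 : ℝ) ≤ ((monomialsUpTo n d).card : ℝ) ^ 2 := one_le_pow₀ h1
    calc B = 1 * (1 * B) := by ring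
      _ ≤ _ := by gcongr
  · intro α β
    refine le_trans ?_ hA
    have hentry : (T * P.A * T.conjTranspose) α β = ∑ δ, ∑ γ, T α γ * P.A γ δ * T β δ := by
      simp only [Matrix.mul_apply, Matrix.conjTranspose_apply, star_trivial, Finset.sum_mul]
    change |(T * P.A * T.conjTranspose) α β| ≤ _
    rw [hentry]
    refine (Finset.abs_sum_le_sum_abs _ _).trans ((Finset.sum_le_sum fun δ _ =>
      (Finset.abs_sum_le_sum_abs _ _).trans (Finset.sum_le_sum (g := fun _ => (4 ^ d) ^ 2 * B)
        fun γ _ => ?_)).trans ?_)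
    · rw [abs_mul, abs_mul]
      calc |T α γ| * |P.A γ δ| * |T β δ| ≤ 4 ^ d * B * 4 ^ d := by
            gcongr
            · exact hT α γ
            · exact hPA γ δ
            · exact hT β δ
        _ = (4 ^ d) ^ 2 * B := by ring
    · simp only [Finset.sum_const, Finset.card_univ, Fintype.card_coe, nsmul_eq_mul]
      rw [← mul_assoc, ← pow_two]
  · intro j' m
    refine le_trans ?_ hq
    change |coeff m (C (u (e.symm j')) * affineSubst n a b (P.q (e.symm j')))| ≤ _
    rw [coeff_C_mul, abs_mul]
    exact mul_le_mul (hu _) (abs_coeff_affineSubst_le hab (hqdeg _) (hPq _) m) (abs_nonneg _)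
      (by norm_num)
  · intro m
    refine le_trans ?_ hq
    change |coeff m (∑ j', (C (u (e.symm j')) * affineSubst n a b (P.q (e.symm j'))) * g' j')| ≤ _
    rw [hsum]
    refine (abs_coeff_affineSubst_le hab (totalDegree_sum_le fun j _ => P.degree_le j) hPI m).trans ?_
    have : 0 ≤ ((monomialsUpTo n (2 * d)).card : ℝ) * (B * 4 ^ (2 * d)) := by positivity
    linarith

theorem _root_.SoSProof.exists_boundedBy {f : MvPolynomial (Fin n) ℝ} {d : ℕ} {c : ℝ}
    (P : SoSProof g f d c) : ∃ B, P.BoundedBy B := by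
  refine ⟨|c| + (∑ α, ∑ β, |P.A α β|) + (∑ j, coeffNorm (P.q j)) +
    coeffNorm (∑ j, P.q j * g j), ?_⟩
  have h1 : 0 ≤ ∑ α, ∑ β, |P.A α β| :=
    Finset.sum_nonneg fun _ _ => Finset.sum_nonneg fun _ _ => abs_nonneg _
  have h2 : 0 ≤ ∑ j, coeffNorm (P.q j) := Finset.sum_nonneg fun _ _ => coeffNorm_nonneg _
  have h3 := coeffNorm_nonneg (∑ j, P.q j * g j)
  have h4 := abs_nonneg c
  refine ⟨by linarith, fun α β => ?_, fun j m => ?_, fun m => ?_⟩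
  · have h5 : |P.A α β| ≤ ∑ β, |P.A α β| :=
      Finset.single_le_sum (f := fun β => |P.A α β|) (fun _ _ => abs_nonneg _) (Finset.mem_univ β)
    have h6 : ∑ β, |P.A α β| ≤ ∑ α, ∑ β, |P.A α β| :=
      Finset.single_le_sum (f := fun α => ∑ β, |P.A α β|)
        (fun _ _ => Finset.sum_nonneg fun _ _ => abs_nonneg _) (Finset.mem_univ α)
    linarith
  · have h5 := abs_coeff_le_coeffNorm (P.q j) m
    have h6 : coeffNorm (P.q j) ≤ ∑ j, coeffNorm (P.q j) :=
      Finset.single_le_sum (f := fun j => coeffNorm (P.q j)) (fun _ _ => coeffNorm_nonneg _)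
        (Finset.mem_univ j)
    linarith
  · have := abs_coeff_le_coeffNorm (∑ j, P.q j * g j) m
    linarith

/-- The objective is pulled back by the inverse substitution, an optimal proof is taken there, and
the proof is pushed forward. Invertibility makes both problems certify the same values. The
pull-back costs `8 d` in the exponent of `n` and the push-forward at most `10 d` (from the
multipliers: `2 d` for the scalar `4`, `4 d` for the number of monomials, `4 d` for `4 ^ (2 d)`),
hence `18`. -/
theorem BoundedSoS.of_affineSubst (hn : 2 ≤ n) {d r : ℕ} (hd : 1 ≤ d) (H : BoundedSoS g d r)
    {a b a' b' : ℝ} (hab : |a| + |b| ≤ 4) (hab' : |a'| + |b'| ≤ 4)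
    (haa : a' * a = 1) (hbb : a' * b + b' = 0) (hbb' : a * b' + b = 0) (e : ι ≃ ι')
    {u u' : ι → ℝ} (hu : ∀ j, |u j| ≤ 4) (hu' : ∀ j, |u' j| ≤ 4)
    (hg : ∀ j, affineSubst n a b (g j) = C (u j) * g' (e j))
    (hg' : ∀ j, affineSubst n a' b' (g' (e j)) = C (u' j) * g j)
    (hg0 : ∀ j, g j ≠ 0) : BoundedSoS g' d (r + 18) := by
  have hn2 : (2 : ℝ) ≤ n := by exact_mod_cast hn
  have hn0 : (0 : ℝ) < n := by linarith
  have h4 : (4 : ℝ) ≤ (n : ℝ) ^ (2 * d) := by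
    calc (4 : ℝ) = 2 ^ 2 := by norm_num
      _ ≤ (n : ℝ) ^ 2 := by gcongr
      _ ≤ (n : ℝ) ^ (2 * d) := pow_le_pow_right₀ (by linarith) (by omega)
  have h4d : (4 : ℝ) ^ d ≤ (n : ℝ) ^ (2 * d) := by
    rw [pow_mul]
    gcongr
    nlinarith
  have h42d : (4 : ℝ) ^ (2 * d) ≤ (n : ℝ) ^ (4 * d) := by
    calc (4 : ℝ) ^ (2 * d) = (4 ^ d) ^ 2 := by ring
      _ ≤ ((n : ℝ) ^ (2 * d)) ^ 2 := by gcongr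
      _ = (n : ℝ) ^ (4 * d) := by ring
  have hD := card_monomialsUpTo_le hn d
  have hE := card_monomialsUpTo_le hn (2 * d)
  have hinv : ∀ p, affineSubst n a b (affineSubst n a' b' p) = p :=
    affineSubst_affineSubst haa hbb
  have hinv' : ∀ p, affineSubst n a' b' (affineSubst n a b p) = p :=
    affineSubst_affineSubst (by rwa [mul_comm]) hbb'
  have hu0 : ∀ j, u j ≠ 0 := by
    intro j hj
    have h1 := congrArg (affineSubst n a' b') (hg j)
    rw [hinv', hj, C_0, zero_mul, map_zero] at h1
    exact hg0 j h1
  have hg0' : ∀ j', g' j' ≠ 0 := by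
    intro j' hj'
    obtain ⟨j, rfl⟩ := e.surjective j'
    have h1 := congrArg (affineSubst n a' b') (hg j)
    rw [hinv', hj', mul_zero, map_zero] at h1
    exact hg0 j h1
  intro K f hf hF
  obtain ⟨c, hc, P, hP⟩ := H (K + 8) (affineSubst n a' b' f) (totalDegree_affineSubst_le _ _ hf)
    fun m => by
      refine (abs_coeff_affineSubst_le hab' hf hF m).trans ?_
      calc ((monomialsUpTo n (2 * d)).card : ℝ) * ((n : ℝ) ^ (K * d) * 4 ^ (2 * d))
          ≤ (n : ℝ) ^ (2 * (2 * d)) * ((n : ℝ) ^ (K * d) * (n : ℝ) ^ (4 * d)) := by gcongr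
        _ = (n : ℝ) ^ ((K + 8) * d) := by rw [← pow_add, ← pow_add]; congr 1; ring
  -- For equality of the feasible sets the size of the proofs is irrelevant, so any bound and the
  -- maximum of the two requirements may be used.
  have hiff : {c : ℝ | Nonempty (SoSProof g (affineSubst n a' b' f) d c)} =
      {c : ℝ | Nonempty (SoSProof g' f d c)} := by
    ext c
    constructor
    · rintro ⟨P⟩
      obtain ⟨B, hB⟩ := P.exists_boundedBy
      have hex := P.exists_affineSubst hab e hu hg hg0 hB (le_max_left _ _) (le_max_right _ _)
      rw [hinv] at hex
      exact ⟨hex.choose⟩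
    · rintro ⟨P⟩
      obtain ⟨B, hB⟩ := P.exists_boundedBy
      obtain ⟨P', -⟩ := P.exists_affineSubst (g' := g) hab' e.symm
        (u := fun j' => u' (e.symm j')) (fun j' => hu' _)
        (fun j' => by simpa using hg' (e.symm j')) hg0' hB (le_max_left _ _) (le_max_right _ _)
      exact ⟨P'⟩
  have hIs : IsSoSOptimum g' f d c := by
    rw [IsSoSOptimum, ← hiff]
    exact hc
  have hex := P.exists_affineSubst hab e hu hg hg0 hP
    (B' := (n : ℝ) ^ ((K + (r + 18)) * d)) (by
      calc ((monomialsUpTo n d).card : ℝ) ^ 2 * ((4 ^ d) ^ 2 * (n : ℝ) ^ ((K + 8 + r) * d))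
          ≤ ((n : ℝ) ^ (2 * d)) ^ 2 * (((n : ℝ) ^ (2 * d)) ^ 2 * (n : ℝ) ^ ((K + 8 + r) * d)) := by
            gcongr
        _ = (n : ℝ) ^ ((K + (r + 16)) * d) := by
            rw [← pow_mul, ← pow_add, ← pow_add]; congr 1; ring
        _ ≤ (n : ℝ) ^ ((K + (r + 18)) * d) :=
            pow_le_pow_right₀ (by linarith) (Nat.mul_le_mul_right d (by omega))) (by
      calc 4 * (((monomialsUpTo n (2 * d)).card : ℝ) *
            ((n : ℝ) ^ ((K + 8 + r) * d) * 4 ^ (2 * d)))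
          ≤ (n : ℝ) ^ (2 * d) * ((n : ℝ) ^ (2 * (2 * d)) *
            ((n : ℝ) ^ ((K + 8 + r) * d) * (n : ℝ) ^ (4 * d))) := by
            gcongr
        _ = (n : ℝ) ^ ((K + (r + 18)) * d) := by
            rw [← pow_add, ← pow_add, ← pow_add]; congr 1; ring)
  rw [hinv] at hex
  exact ⟨c, hIs, hex⟩

end AffineSubstitution

end SoSBound

namespace SoSBound

variable {n : ℕ}

theorem exists_eq_add_single {m : Fin n →₀ ℕ} {i : Fin n} {a : ℕ} (h : a ≤ m i) :
    ∃ m', m = m' + Finsupp.single i a :=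
  ⟨m - Finsupp.single i a, (tsub_add_cancel_of_le (Finsupp.single_le_iff.2 h)).symm⟩

theorem X_pow_eq_monomial_single (i : Fin n) (a : ℕ) :
    (X i ^ a : MvPolynomial (Fin n) ℝ) = monomial (Finsupp.single i a) 1 :=
  X_pow_eq_monomial

theorem monomial_mul_X_pow (m : Fin n →₀ ℕ) (c : ℝ) (i : Fin n) (a : ℕ) :
    monomial m c * X i ^ a = monomial (m + Finsupp.single i a) c := by
  rw [X_pow_eq_monomial, monomial_mul, mul_one]

theorem abs_coeff_monomial_le (m m' : Fin n →₀ ℕ) (c : ℝ) : |coeff m (monomial m' c)| ≤ |c| := by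
  rw [coeff_monomial]
  split_ifs
  · exact le_rfl
  · rw [abs_zero]
    exact abs_nonneg c

/-! ### Rewriting monomials: lowering and raising exponents. -/

section Tools

variable {ι : Type} [Fintype ι] {g : ι → MvPolynomial (Fin n) ℝ}

theorem IdealBound.mul_generator {e : ℕ} {q : MvPolynomial (Fin n) ℝ} {B : ℝ} (j : ι)
    (hd : (q * g j).totalDegree ≤ e) (hq : ∀ m, |coeff m q| ≤ B) : IdealBound g e (q * g j) B := by
  classical
  have hB : 0 ≤ B := (abs_nonneg _).trans (hq 0)
  refine ⟨Pi.single j q, fun j' => ?_, fun j' m => ?_, ?_⟩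
  · by_cases h : j' = j
    · subst h
      rwa [Pi.single_eq_same]
    · rw [Pi.single_eq_of_ne h, zero_mul]
      simp
  · by_cases h : j' = j
    · subst h
      rw [Pi.single_eq_same]
      exact hq m
    · rw [Pi.single_eq_of_ne h]
      simpa using hB
  · rw [Finset.sum_eq_single j]
    · rw [Pi.single_eq_same]
    · intro j' _ h
      rw [Pi.single_eq_of_ne h, zero_mul]
    · intro h
      exact absurd (Finset.mem_univ j) h

/-- A bound on each variable gives bounds on all even powers. -/
theorem isSoSMod_pow_sub_monomial {W : Submodule ℝ (MvPolynomial (Fin n) ℝ)} {d : ℕ}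
    (hW : truncIdeal g (2 * d) ≤ W) {κ : ℝ} (hκ : 0 ≤ κ)
    (h : ∀ i, IsSoSMod (truncIdeal g 2) 1 (C κ - X i ^ 2)) (j : ℕ) :
    ∀ α : Fin n →₀ ℕ, α.degree = j → j ≤ d → IsSoSMod W d (C (κ ^ j) - monomial (α + α) 1) := by
  induction j with
  | zero =>
    intro α hα _
    rw [(Finsupp.degree_eq_zero_iff α).1 hα]
    refine IsSoSMod.of_mem d ?_
    simp
  | succ j ih =>
    intro α hα hj
    have hne : α ≠ 0 := by
      rintro rfl
      simp at hα
    obtain ⟨i, hi⟩ := Finsupp.ne_iff.1 hne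
    obtain ⟨β, rfl⟩ := exists_eq_add_single (Nat.one_le_iff_ne_zero.2 hi)
    rw [map_add, Finsupp.degree_single] at hα
    have hβ : β.degree = j := by omega
    obtain ⟨A, hA, hAmem⟩ := h i
    obtain ⟨v, hv, hAv⟩ := exists_sum_sq_of_posSemidef hA
    -- With `α = β + eᵢ`: `κ^(j+1) - x^(2α) = κ (κ^j - x^(2β)) + x^(2β) (κ - xᵢ²)`. In the second
    -- summand the squares of the certificate for `κ - xᵢ²` are multiplied by `x^β` inside the
    -- square, and its ideal part by `x^(2β)`.
    have h1 := (ih β hβ (by omega)).smul hκ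
    have h2 : IsSoSMod W d (∑ l, (monomial β 1 * v l) ^ 2) := IsSoSMod.sum _ fun l _ =>
      IsSoSMod.sq ((totalDegree_mul_le ((totalDegree_monomial_le_degree _ _).trans hβ.le)
        (hv l)).trans hj)
    have h3 : (C κ - X i ^ 2 - gramPolynomial A) * monomial (β + β) 1 ∈ W := by
      refine hW (truncIdeal_mono ?_ (mul_mem_truncIdeal (b := j + j) hAmem
        ((totalDegree_monomial_le_degree _ _).trans ?_)))
      · omega
      · rw [map_add, hβ]
    convert (h1.add h2).add (IsSoSMod.of_mem d h3) using 1
    have e1 : (monomial (β + Finsupp.single i 1 + (β + Finsupp.single i 1)) (1 : ℝ)) =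
        monomial (β + β) 1 * X i ^ 2 := by
      rw [monomial_mul_X_pow]
      congr 1
      have : Finsupp.single i 2 = Finsupp.single i 1 + Finsupp.single i 1 := by
        rw [← Finsupp.single_add]
      rw [this, add_add_add_comm]
    have e2 : ∑ l, (monomial β 1 * v l) ^ 2 = monomial (β + β) 1 * gramPolynomial A := by
      rw [hAv, Finset.mul_sum]
      refine Finset.sum_congr rfl fun l _ => ?_
      have : (monomial (β + β) (1 : ℝ)) = monomial β 1 * monomial β 1 := by
        rw [monomial_mul, mul_one]
      rw [this]
      ring
    rw [e1, e2, smul_eq_C_mul, pow_succ, C_mul]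
    ring

/-- `κ' - xᵢ² = ∑_{j ≠ i} xⱼ² + (κ' - κ) - (∑ⱼ xⱼ² - κ)`. -/
theorem isSoSMod_const_sub_of_sum_sq {W : Submodule ℝ (MvPolynomial (Fin n) ℝ)} {κ κ' : ℝ}
    (hκ : κ ≤ κ') (h : (∑ i, X i ^ 2) - C κ ∈ W) (i : Fin n) : IsSoSMod W 1 (C κ' - X i ^ 2) := by
  have h1 : IsSoSMod W 1 (∑ j ∈ Finset.univ.erase i, (X j : MvPolynomial (Fin n) ℝ) ^ 2) :=
    IsSoSMod.sum _ fun j _ => IsSoSMod.sq (by simp)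
  have h2 := (h1.add (isSoSMod_C (sub_nonneg.2 hκ))).add
    (IsSoSMod.of_mem 1 (W.neg_mem h))
  convert h2 using 1
  rw [← Finset.add_sum_erase _ _ (Finset.mem_univ i), C_sub]
  ring

/-- `κ - x² = (1 - x)² + (κ - 1) - 2 (x² - x)`. -/
theorem one_sub_X_sq_isSoSMod {W : Submodule ℝ (MvPolynomial (Fin n) ℝ)} {κ : ℝ}
    (hκ : 1 ≤ κ) (i : Fin n) (h : X i ^ 2 - X i ∈ W) : IsSoSMod W 1 (C κ - X i ^ 2) := by
  have h1 : IsSoSMod W 1 ((1 - X i : MvPolynomial (Fin n) ℝ) ^ 2) :=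
    IsSoSMod.sq (totalDegree_sub_le (by simp) (by simp))
  have h2 := (h1.add (isSoSMod_C (sub_nonneg.2 hκ))).add
    (IsSoSMod.of_mem 1 (W.smul_mem (-2) h))
  convert h2 using 1
  rw [C_sub, C_1, neg_smul, smul_eq_C_mul, map_ofNat]
  ring

/-- Since `xᵢ` divides the monomial, dividing it out exhibits the difference as a single monomial
times a generator. -/
theorem IdealBound.lower_exponent {a e : ℕ} (hg : ∀ i, ∃ j, g j = X i ^ (a + 1) - X i)
    {m : Fin n →₀ ℕ} {i : Fin n} (hi : m i ≠ 0) (hm : m.degree + a ≤ e) :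
    IdealBound g e (monomial (m + Finsupp.single i a) 1 - monomial m 1) 1 := by
  obtain ⟨j, hj⟩ := hg i
  obtain ⟨m', rfl⟩ := exists_eq_add_single (Nat.one_le_iff_ne_zero.2 hi)
  have h1 : monomial (m' + Finsupp.single i 1 + Finsupp.single i a) (1 : ℝ) -
      monomial (m' + Finsupp.single i 1) 1 = monomial m' 1 * g j := by
    rw [hj, mul_sub, monomial_mul_X_pow]
    congr 2
    · rw [add_assoc, ← Finsupp.single_add, add_comm 1 a]
    · rw [← pow_one (X i), monomial_mul_X_pow]
  rw [h1]
  refine IdealBound.mul_generator j ?_ fun m => by simpa using abs_coeff_monomial_le m m' 1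
  rw [← h1]
  have hdeg : (m' + Finsupp.single i 1 + Finsupp.single i a).degree ≤ e := by
    rw [map_add, Finsupp.degree_single]
    exact hm
  exact totalDegree_sub_le ((totalDegree_monomial_le_degree _ _).trans hdeg)
    ((totalDegree_monomial_le_degree _ _).trans (le_trans (by omega) hm))

/-- Reduction of all exponents to at most `a`, modulo `X i ^ (a + 1) = X i`. -/
theorem exists_reduced_monomial {a : ℕ} (ha : 1 ≤ a)
    (hg : ∀ i, ∃ j, g j = X i ^ (a + 1) - X i) {e : ℕ} (m : Fin n →₀ ℕ) (hm : m.degree ≤ e) :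
    ∃ m' : Fin n →₀ ℕ, (∀ i, m' i ≤ a) ∧ m'.support = m.support ∧ m'.degree ≤ m.degree ∧
      IdealBound g e (monomial m 1 - monomial m' 1) m.degree := by
  induction hj : m.degree using Nat.strong_induction_on generalizing m with
  | _ j ih =>
    by_cases h : ∀ i, m i ≤ a
    · refine ⟨m, h, rfl, hj.le, ?_⟩
      rw [sub_self]
      exact (IdealBound.zero e).mono le_rfl (Nat.cast_nonneg _)
    · push Not at h
      obtain ⟨i, hi⟩ := h
      obtain ⟨m₁, rfl⟩ := exists_eq_add_single hi.le
      have hi1 : m₁ i ≠ 0 := by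
        intro h0
        simp [h0] at hi
      have hd : m₁.degree + a = j := by
        rw [← hj, map_add, Finsupp.degree_single]
      have hje : j ≤ e := hj ▸ hm
      obtain ⟨m', h1, h2, h3, h4⟩ := ih m₁.degree (by omega) m₁ (by omega) rfl
      refine ⟨m', h1, ?_, by omega, ?_⟩
      · rw [h2]
        ext l
        by_cases hl : l = i
        · subst hl
          simp [hi1]
        · simp [Ne.symm hl]
      · have h5 := (IdealBound.lower_exponent hg hi1 (e := e) (by omega)).add h4
        rw [sub_add_sub_cancel] at h5
        refine h5.mono le_rfl ?_
        have : (1 : ℝ) + m₁.degree ≤ m₁.degree + a := by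
          have : (1 : ℝ) ≤ a := by exact_mod_cast ha
          linarith
        rw [← hd]
        push_cast
        exact this

/-- Raising a monomial to the top degrees, one step `step` at a time. -/
theorem exists_raised {a : ℕ} (ha : 1 ≤ a) (Q : (Fin n →₀ ℕ) → Prop) {e : ℕ}
    (step : ∀ m, Q m → m.degree + a ≤ e → ∃ (s : Finset (Fin n)) (c : ℝ), |c| ≤ 1 ∧
      (∀ i ∈ s, Q (m + Finsupp.single i a)) ∧
      IdealBound g e (monomial m 1 - c • ∑ i ∈ s, monomial (m + Finsupp.single i a) 1) (n + 1))
    (m : Fin n →₀ ℕ) (hQ : Q m) (hm : m.degree ≤ e) :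
    ∃ ν ∈ restrictSupport ℝ {m : Fin n →₀ ℕ | Q m ∧ m.degree ≤ e ∧ e < m.degree + a},
      IdealBound g e (monomial m 1 - ν) (((n : ℝ) + 1) ^ (2 * (e - m.degree))) := by
  induction hj : e - m.degree using Nat.strong_induction_on generalizing m with
  | _ j ih =>
    by_cases h : e < m.degree + a
    · refine ⟨monomial m 1, (monomial_mem_restrictSupport ℝ).2 (Or.inl ⟨hQ, hm, h⟩), ?_⟩
      rw [sub_self]
      exact (IdealBound.zero e).mono le_rfl (by positivity)
    · push Not at h
      obtain ⟨s, c, hc, hs, hb⟩ := step m hQ h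
      have hdeg : ∀ i, (m + Finsupp.single i a).degree = m.degree + a := fun i => by
        rw [map_add, Finsupp.degree_single]
      have ih' : ∀ i ∈ s, ∃ ν ∈ restrictSupport ℝ
          {m : Fin n →₀ ℕ | Q m ∧ m.degree ≤ e ∧ e < m.degree + a},
          IdealBound g e (monomial (m + Finsupp.single i a) 1 - ν)
            (((n : ℝ) + 1) ^ (2 * (j - 1))) := by
        intro i hi
        obtain ⟨ν, hν, hνb⟩ := ih (e - (m + Finsupp.single i a).degree) (by rw [hdeg]; omega) _
          (hs i hi) (by rw [hdeg]; exact h) rfl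
        refine ⟨ν, hν, hνb.mono le_rfl (pow_le_pow_right₀ (by linarith [n.cast_nonneg (α := ℝ)]) ?_)⟩
        rw [hdeg]
        omega
      choose! ν hν hνb using ih'
      refine ⟨c • ∑ i ∈ s, ν i, Submodule.smul_mem _ _ (Submodule.sum_mem _ hν), ?_⟩
      have h1 := hb.add ((IdealBound.sum s hνb).smul c)
      convert h1.mono le_rfl ?_ using 1
      · rw [Finset.sum_sub_distrib, smul_sub]
        ring
      · rw [Finset.sum_const, nsmul_eq_mul]
        have hn0 : (0 : ℝ) ≤ n := n.cast_nonneg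
        have hX : (1 : ℝ) ≤ ((n : ℝ) + 1) ^ (2 * (j - 1)) := one_le_pow₀ (by linarith)
        have hs' : (s.card : ℝ) ≤ n := by
          have := s.card_le_univ
          rw [Fintype.card_fin] at this
          exact_mod_cast this
        have hj1 : 2 * j = 2 * (j - 1) + 2 := by omega
        rw [hj1, pow_add]
        generalize ((n : ℝ) + 1) ^ (2 * (j - 1)) = X at *
        -- One raising step turns a bound `X ≥ 1` into `n + 1 + n X ≤ (n + 1)² X`, which is why the
        -- exponent grows by `2` per step.
        have h2 : |c| * (s.card * X) ≤ 1 * (n * X) := by gcongr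
        nlinarith [mul_nonneg (show 0 ≤ (n : ℝ) ^ 2 + n + 1 by positivity) (sub_nonneg.2 hX)]

end Tools

end SoSBound

namespace SoSBound

/-! ### Inclusion matrices and binomial estimates. -/

section Counting

/-- Complementation turns `k`-sets containing `A` into `s`-subsets of the complement of `A`. The
count in terms of `s` is the form suited to Vandermonde's identity. -/
theorem card_filter_superset_powersetCard {α : Type*} [Fintype α] [DecidableEq α] (A : Finset α)
    {k s : ℕ} (hks : k + s = Fintype.card α) :
    ((Finset.powersetCard k (Finset.univ : Finset α)).filter (A ⊆ ·)).card =
      (Fintype.card α - A.card).choose s := by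
  rw [← Finset.card_compl A, ← Finset.card_powersetCard,
    ← Finset.card_image_of_injective (Finset.powersetCard s Aᶜ) compl_injective]
  congr 1
  ext z
  simp only [Finset.mem_filter, Finset.mem_powersetCard, Finset.subset_univ, true_and,
    Finset.mem_image]
  constructor
  · rintro ⟨hz, hA⟩
    refine ⟨zᶜ, ⟨Finset.compl_subset_compl.2 hA, ?_⟩, compl_compl z⟩
    rw [Finset.card_compl]
    omega
  · rintro ⟨y, ⟨hy, hys⟩, rfl⟩
    refine ⟨?_, ?_⟩
    · rw [Finset.card_compl]
      omega
    · rwa [Finset.subset_compl_comm] at hy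

/-- From `s · C(n, s) = n · C(n-1, s-1)` and `(n - s) · C(n, s) = n · C(n-1, s)`: each of the `a +
b` unit steps costs a factor at most `n`. -/
theorem choose_le_pow_mul_choose {n s a b : ℕ} (ha : a ≤ s) (hb : b + s ≤ n) :
    n.choose s ≤ n ^ (a + b) * (n - a - b).choose (s - a) := by
  induction a generalizing n s with
  | zero =>
    rw [zero_add, Nat.sub_zero, Nat.sub_zero]
    induction b generalizing n with
    | zero => simp
    | succ b ih =>
      obtain ⟨n, rfl⟩ : ∃ n', n = n' + 1 := ⟨n - 1, by omega⟩
      have h1 : (n + 1).choose s ≤ (n + 1) * n.choose s := by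
        have h2 : (n + 1).choose s * (n + 1 - s) = (n + 1) * n.choose s := by
          have := Nat.choose_mul_succ_eq n s
          rw [← this]
          ring
        calc (n + 1).choose s ≤ (n + 1).choose s * (n + 1 - s) :=
              Nat.le_mul_of_pos_right _ (by omega)
          _ = _ := h2
      have h3 := ih (n := n) (by omega)
      have h4 : n + 1 - (b + 1) = n - b := by omega
      rw [h4, pow_succ']
      calc (n + 1).choose s ≤ (n + 1) * n.choose s := h1
        _ ≤ (n + 1) * (n ^ b * (n - b).choose s) := Nat.mul_le_mul_left _ h3
        _ ≤ (n + 1) * ((n + 1) ^ b * (n - b).choose s) :=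
            Nat.mul_le_mul_left _ (Nat.mul_le_mul_right _ (Nat.pow_le_pow_left (by omega) b))
        _ = _ := by ring
  | succ a ih =>
    obtain ⟨n, rfl⟩ : ∃ n', n = n' + 1 := ⟨n - 1, by omega⟩
    obtain ⟨s, rfl⟩ : ∃ s', s = s' + 1 := ⟨s - 1, by omega⟩
    have h1 : (n + 1).choose (s + 1) ≤ (n + 1) * n.choose s := by
      calc (n + 1).choose (s + 1) ≤ (n + 1).choose (s + 1) * (s + 1) :=
            Nat.le_mul_of_pos_right _ (by omega)
        _ = _ := (Nat.add_one_mul_choose_eq n s).symm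
    have h3 := ih (n := n) (s := s) (by omega) (by omega)
    have h4 : n + 1 - (a + 1) - b = n - a - b := by omega
    have h5 : s + 1 - (a + 1) = s - a := by omega
    have h6 : a + 1 + b = (a + b) + 1 := by ring
    rw [h4, h5, h6, pow_succ']
    calc (n + 1).choose (s + 1) ≤ (n + 1) * n.choose s := h1
      _ ≤ (n + 1) * (n ^ (a + b) * (n - a - b).choose (s - a)) := Nat.mul_le_mul_left _ h3
      _ ≤ (n + 1) * ((n + 1) ^ (a + b) * (n - a - b).choose (s - a)) :=
          Nat.mul_le_mul_left _ (Nat.mul_le_mul_right _ (Nat.pow_le_pow_left (by omega) _))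
      _ = _ := by ring

theorem sq_sum_indicator {α κ : Type*} [DecidableEq α] (M : Finset κ) (U : κ → Finset α)
    (c : κ → ℝ) (𝒵 : Finset (Finset α)) :
    ∑ z ∈ 𝒵, (∑ m ∈ M, if U m ⊆ z then c m else 0) ^ 2 =
      ∑ m ∈ M, ∑ m' ∈ M, c m * c m' * (𝒵.filter (U m ∪ U m' ⊆ ·)).card := by
  simp only [pow_two, Finset.sum_mul_sum]
  rw [Finset.sum_comm]
  refine Finset.sum_congr rfl fun m _ => ?_
  rw [Finset.sum_comm]
  refine Finset.sum_congr rfl fun m' _ => ?_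
  rw [Finset.card_filter, Nat.cast_sum, Finset.mul_sum]
  refine Finset.sum_congr rfl fun z _ => ?_
  by_cases h1 : U m ⊆ z <;> by_cases h2 : U m' ⊆ z <;> simp [Finset.union_subset_iff, h1, h2]

/-- The kernel counts the `i`-sets contained in both arguments, so the quadratic form is a sum of
squares indexed by `i`-sets. -/
theorem sum_choose_card_inter_nonneg {α κ : Type*} [Fintype α] [DecidableEq α] (M : Finset κ)
    (S : κ → Finset α) (c : κ → ℝ) (i : ℕ) :
    0 ≤ ∑ m ∈ M, ∑ m' ∈ M, c m * c m' * ((S m ∩ S m').card.choose i : ℝ) := by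
  have h : ∑ m ∈ M, ∑ m' ∈ M, c m * c m' * ((S m ∩ S m').card.choose i : ℝ) =
      ∑ X ∈ Finset.powersetCard i (Finset.univ : Finset α),
        (∑ m ∈ M, if X ⊆ S m then c m else 0) ^ 2 := by
    simp only [pow_two, Finset.sum_mul_sum]
    rw [Finset.sum_comm (s := Finset.powersetCard i Finset.univ)]
    refine Finset.sum_congr rfl fun m _ => ?_
    rw [Finset.sum_comm (s := Finset.powersetCard i Finset.univ)]
    refine Finset.sum_congr rfl fun m' _ => ?_
    have h1 : ((S m ∩ S m').card.choose i) =
        ((Finset.powersetCard i Finset.univ).filter (· ⊆ S m ∩ S m')).card := by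
      rw [← Finset.card_powersetCard]
      congr 1
      ext X
      simp only [Finset.mem_filter, Finset.mem_powersetCard, Finset.subset_univ, true_and]
      exact and_comm
    rw [h1, Finset.card_filter, Nat.cast_sum, Finset.mul_sum]
    refine Finset.sum_congr rfl fun X _ => ?_
    by_cases h1 : X ⊆ S m <;> by_cases h2 : X ⊆ S m' <;> simp [Finset.subset_inter_iff, h1, h2]
  rw [h]
  exact Finset.sum_nonneg fun _ _ => sq_nonneg _

/-- Lower bound for the quadratic form of the inclusion matrix between `e`-sets and `k`-sets. -/
theorem choose_mul_sum_sq_le {α κ : Type*} [Fintype α] [DecidableEq α] (M : Finset κ)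
    (T : Finset α) (S : κ → Finset α) (c : κ → ℝ) {k s e : ℕ} (hks : k + s = Fintype.card α)
    (hdisj : ∀ m ∈ M, Disjoint T (S m)) (hcard : ∀ m ∈ M, (S m).card = e)
    (hinj : ∀ m ∈ M, ∀ m' ∈ M, S m = S m' → m = m') (hes : e ≤ s) (hek : T.card + e ≤ k) :
    ((Fintype.card α - e - (T.card + e)).choose (s - e) : ℝ) * ∑ m ∈ M, c m ^ 2 ≤
      ∑ z ∈ Finset.powersetCard k (Finset.univ : Finset α),
        (∑ m ∈ M, if T ∪ S m ⊆ z then c m else 0) ^ 2 := by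
  classical
  rw [sq_sum_indicator]
  set N := Fintype.card α - e - (T.card + e) with hN
  -- The complement of the union has `N + |S m ∩ S m'|` elements, where `N` does not depend on the
  -- pair. Vandermonde's identity then splits the count into the positive semidefinite kernels `C(|S
  -- m ∩ S m'|, i)`.
  have hcount : ∀ m ∈ M, ∀ m' ∈ M,
      ((Finset.powersetCard k (Finset.univ : Finset α)).filter
        ((T ∪ S m) ∪ (T ∪ S m') ⊆ ·)).card =
      ∑ ij ∈ Finset.HasAntidiagonal.antidiagonal s, (S m ∩ S m').card.choose ij.1 * N.choose ij.2 := by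
    intro m hm m' hm'
    rw [card_filter_superset_powersetCard _ hks, ← Nat.add_choose_eq]
    congr 1
    have h1 : (T ∪ S m) ∪ (T ∪ S m') = T ∪ (S m ∪ S m') := by
      ext x
      simp only [Finset.mem_union]
      tauto
    have h2 : Disjoint T (S m ∪ S m') :=
      Finset.disjoint_union_right.2 ⟨hdisj m hm, hdisj m' hm'⟩
    have h3 := Finset.card_union_add_card_inter (S m) (S m')
    rw [hcard m hm, hcard m' hm'] at h3
    have h4 : (S m ∩ S m').card ≤ e := hcard m hm ▸ Finset.card_le_card Finset.inter_subset_left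
    rw [h1, Finset.card_union_of_disjoint h2, hN]
    omega
  have hexpand : ∑ m ∈ M, ∑ m' ∈ M, c m * c m' *
      (((Finset.powersetCard k (Finset.univ : Finset α)).filter
        ((T ∪ S m) ∪ (T ∪ S m') ⊆ ·)).card : ℝ) =
      ∑ ij ∈ Finset.HasAntidiagonal.antidiagonal s, (N.choose ij.2 : ℝ) *
        ∑ m ∈ M, ∑ m' ∈ M, c m * c m' * ((S m ∩ S m').card.choose ij.1 : ℝ) := by
    simp only [Finset.mul_sum]
    rw [Finset.sum_comm (s := Finset.HasAntidiagonal.antidiagonal s)]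
    refine Finset.sum_congr rfl fun m hm => ?_
    rw [Finset.sum_comm (s := Finset.HasAntidiagonal.antidiagonal s)]
    refine Finset.sum_congr rfl fun m' hm' => ?_
    rw [hcount m hm m' hm', Nat.cast_sum, Finset.mul_sum]
    refine Finset.sum_congr rfl fun ij _ => ?_
    push_cast
    ring
  -- For `i = e` the kernel is the identity matrix, because distinct `e`-sets meet in fewer than `e`
  -- elements.
  have hdiag : ∑ m ∈ M, ∑ m' ∈ M, c m * c m' * ((S m ∩ S m').card.choose e : ℝ) =
      ∑ m ∈ M, c m ^ 2 := by
    refine Finset.sum_congr rfl fun m hm => ?_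
    rw [Finset.sum_eq_single m]
    · rw [Finset.inter_self, hcard m hm, Nat.choose_self]
      push_cast
      ring
    · intro m' hm' hne
      have h1 : (S m ∩ S m').card < e := by
        by_contra hlt
        push Not at hlt
        have h2 : S m ∩ S m' = S m :=
          Finset.eq_of_subset_of_card_le Finset.inter_subset_left (by rw [hcard m hm]; exact hlt)
        have h3 : S m ∩ S m' = S m' :=
          Finset.eq_of_subset_of_card_le Finset.inter_subset_right (by rw [hcard m' hm']; exact hlt)
        exact hne (hinj m hm m' hm' (h2.symm.trans h3)).symm
      rw [Nat.choose_eq_zero_of_lt h1]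
      simp
    · intro h
      exact absurd hm h
  rw [hexpand, ← hdiag]
  have hmem : (e, s - e) ∈ Finset.HasAntidiagonal.antidiagonal s := by
    rw [Finset.HasAntidiagonal.mem_antidiagonal]
    omega
  -- All other Vandermonde terms are nonnegative and are discarded; the term `i = e` has weight
  -- `C(N, s - e)`.
  exact Finset.single_le_sum (f := fun ij : ℕ × ℕ => (N.choose ij.2 : ℝ) *
    ∑ m ∈ M, ∑ m' ∈ M, c m * c m' * ((S m ∩ S m').card.choose ij.1 : ℝ))
    (fun ij _ => mul_nonneg (Nat.cast_nonneg _) (sum_choose_card_inter_nonneg M S c ij.1)) hmem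

/-- The right side is a block-diagonal form, equal to the sum over all fibres of the squared fibre
sums. One block is kept. -/
theorem sq_sum_fiber_le {κ τ : Type*} [Fintype τ] [DecidableEq τ] (M : Finset κ) (R : κ → τ)
    (y : κ → ℝ) (t : τ) :
    (∑ m ∈ M with R m = t, y m) ^ 2 ≤ ∑ m ∈ M, ∑ m' ∈ M, if R m = R m' then y m * y m' else 0 := by
  have h : ∑ m ∈ M, ∑ m' ∈ M, (if R m = R m' then y m * y m' else 0) =
      ∑ t, (∑ m ∈ M with R m = t, y m) ^ 2 := by
    have hsq : ∀ t, (∑ m ∈ M with R m = t, y m) ^ 2 = ∑ m ∈ M, ∑ m' ∈ M,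
        if R m = t then (if R m' = t then y m * y m' else 0) else 0 := by
      intro t
      rw [pow_two, Finset.sum_filter, Finset.sum_mul_sum]
      refine Finset.sum_congr rfl fun m _ => Finset.sum_congr rfl fun m' _ => ?_
      split_ifs <;> simp
    simp only [hsq]
    rw [Finset.sum_comm (s := Finset.univ)]
    refine Finset.sum_congr rfl fun m _ => ?_
    rw [Finset.sum_comm (s := Finset.univ)]
    refine Finset.sum_congr rfl fun m' _ => ?_
    rw [Finset.sum_ite_eq Finset.univ (R m), if_pos (Finset.mem_univ _)]
    simp only [eq_comm]
  rw [h]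
  exact Finset.single_le_sum (f := fun t => (∑ m ∈ M with R m = t, y m) ^ 2)
    (fun _ _ => sq_nonneg _) (Finset.mem_univ t)

end Counting

/-! ### Moment functionals supported on random subsets. -/

section Functionals

variable {n : ℕ}

/-- The linear functional with prescribed values on the monomials. -/
noncomputable def functionalOfMoments (w : (Fin n →₀ ℕ) → ℝ) : MvPolynomial (Fin n) ℝ →ₗ[ℝ] ℝ :=
  (basisMonomials (Fin n) ℝ).constr ℝ w

theorem functionalOfMoments_monomial (w : (Fin n →₀ ℕ) → ℝ) (m : Fin n →₀ ℕ) (c : ℝ) :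
    functionalOfMoments w (monomial m c) = c * w m := by
  have h : monomial m c = c • basisMonomials (Fin n) ℝ m := by
    rw [coe_basisMonomials, smul_monomial, smul_eq_mul, mul_one]
  rw [h, map_smul, functionalOfMoments, Module.Basis.constr_basis, smul_eq_mul]

theorem functionalOfMoments_sq (w : (Fin n →₀ ℕ) → ℝ) (p : MvPolynomial (Fin n) ℝ) :
    functionalOfMoments w (p ^ 2) =
      ∑ m ∈ p.support, ∑ m' ∈ p.support, coeff m p * coeff m' p * w (m + m') := by
  conv_lhs => rw [p.as_sum, pow_two, Finset.sum_mul_sum, map_sum]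
  refine Finset.sum_congr rfl fun m _ => ?_
  rw [map_sum]
  exact Finset.sum_congr rfl fun m' _ => by rw [monomial_mul, functionalOfMoments_monomial]

theorem map_mul_eq_zero_of_monomial {L : MvPolynomial (Fin n) ℝ →ₗ[ℝ] ℝ}
    {h : MvPolynomial (Fin n) ℝ} (H : ∀ m, L (monomial m 1 * h) = 0) (q : MvPolynomial (Fin n) ℝ) :
    L (q * h) = 0 := by
  rw [q.as_sum, Finset.sum_mul, map_sum]
  refine Finset.sum_eq_zero fun m _ => ?_
  have h1 : monomial m (coeff m q) = coeff m q • monomial m (1 : ℝ) := by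
    rw [smul_monomial, smul_eq_mul, mul_one]
  rw [h1, smul_mul_assoc, map_smul, H, smul_zero]

theorem map_eq_zero_of_mem_truncIdeal {ι : Type} [Fintype ι] {g : ι → MvPolynomial (Fin n) ℝ}
    {L : MvPolynomial (Fin n) ℝ →ₗ[ℝ] ℝ} (H : ∀ j q, L (q * g j) = 0) {e : ℕ}
    {h : MvPolynomial (Fin n) ℝ} (hh : h ∈ truncIdeal g e) : L h = 0 := by
  obtain ⟨q, -, rfl⟩ := hh
  rw [map_sum]
  exact Finset.sum_eq_zero fun j _ => H j (q j)

/-- The moments of a random vector whose support is uniform in `𝒵` and whose nonzero entries are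
independent uniform `a`-th roots of unity. -/
noncomputable def supportMoment (a : ℕ) (𝒵 : Finset (Finset (Fin n))) (m : Fin n →₀ ℕ) : ℝ :=
  open scoped Classical in
  if ∀ i, a ∣ m i then ((𝒵.filter (m.support ⊆ ·)).card : ℝ) / 𝒵.card else 0

/-- The linear functional with moments `supportMoment a 𝒵`. -/
noncomputable def supportMean (a : ℕ) (𝒵 : Finset (Finset (Fin n))) :
    MvPolynomial (Fin n) ℝ →ₗ[ℝ] ℝ :=
  functionalOfMoments (supportMoment a 𝒵)

variable {a : ℕ} {𝒵 : Finset (Finset (Fin n))}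

theorem supportMoment_of_dvd {m : Fin n →₀ ℕ} (h : ∀ i, a ∣ m i) :
    supportMoment a 𝒵 m = ((𝒵.filter (m.support ⊆ ·)).card : ℝ) / 𝒵.card := by
  rw [supportMoment, if_pos h]

theorem supportMean_monomial (m : Fin n →₀ ℕ) (c : ℝ) :
    supportMean a 𝒵 (monomial m c) = c * supportMoment a 𝒵 m :=
  functionalOfMoments_monomial _ m c

theorem supportMean_one (h : 𝒵.Nonempty) : supportMean a 𝒵 1 = 1 := by
  have h0 : ((𝒵.card : ℕ) : ℝ) ≠ 0 := Nat.cast_ne_zero.2 h.card_ne_zero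
  have h1 : (1 : MvPolynomial (Fin n) ℝ) = monomial 0 1 := rfl
  rw [h1, supportMean_monomial, supportMoment_of_dvd (by simp)]
  simp [h0]

theorem abs_supportMean_monomial_le (m : Fin n →₀ ℕ) : |supportMean a 𝒵 (monomial m 1)| ≤ 1 := by
  rw [supportMean_monomial, one_mul, supportMoment]
  split_ifs
  · rw [abs_of_nonneg (by positivity)]
    exact div_le_one_of_le₀ (by exact_mod_cast Finset.card_filter_le _ _) (by positivity)
  · simp

/-- Adding `a` to a nonzero exponent changes neither the support nor divisibility by `a`, and the
moment depends on nothing else. -/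
theorem supportMoment_add_single_eq {m : Fin n →₀ ℕ} {i : Fin n} (hi : m i ≠ 0) :
    supportMoment a 𝒵 (m + Finsupp.single i a) = supportMoment a 𝒵 m := by
  have h1 : (m + Finsupp.single i a).support = m.support := by
    ext l
    by_cases hl : l = i
    · subst hl
      simp [hi]
    · simp [Ne.symm hl]
  have h2 : (∀ l, a ∣ (m + Finsupp.single i a) l) ↔ ∀ l, a ∣ m l := by
    refine forall_congr' fun l => ?_
    by_cases hl : l = i
    · subst hl
      simp
    · simp [Ne.symm hl]
  simp only [supportMoment, h1, h2]

theorem supportMean_mul_X_pow_sub (i : Fin n) (q : MvPolynomial (Fin n) ℝ) :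
    supportMean a 𝒵 (q * (X i ^ (a + 1) - X i)) = 0 := by
  refine map_mul_eq_zero_of_monomial (fun m => ?_) q
  have h1 : monomial m (1 : ℝ) * X i = monomial (m + Finsupp.single i 1) 1 := by
    rw [← pow_one (X i), monomial_mul_X_pow]
  rw [mul_sub, monomial_mul_X_pow, h1, map_sub, supportMean_monomial, supportMean_monomial,
    add_comm a 1, Finsupp.single_add, ← add_assoc, supportMoment_add_single_eq (by simp),
    sub_self]

/-- Double counting of pairs `(z, i)` with `i ∈ z` and the support of the monomial inside `z`: every
such `z` contributes exactly `k` indices. -/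
theorem supportMean_mul_sum_sub (ha : 1 ≤ a) {k : ℕ} (hk : ∀ z ∈ 𝒵, z.card = k)
    (q : MvPolynomial (Fin n) ℝ) : supportMean a 𝒵 (q * ((∑ i, X i ^ a) - C (k : ℝ))) = 0 := by
  refine map_mul_eq_zero_of_monomial (fun m => ?_) q
  rw [mul_sub, Finset.mul_sum, mul_comm _ (C (k : ℝ)), C_mul_monomial, map_sub, map_sum]
  simp only [monomial_mul_X_pow, supportMean_monomial, one_mul, mul_one]
  have h2 : ∀ i : Fin n, (∀ l : Fin n, a ∣ (m + Finsupp.single i a) l) ↔ ∀ l, a ∣ m l := by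
    refine fun i => forall_congr' fun l => ?_
    by_cases hl : l = i
    · subst hl
      simp
    · simp [Ne.symm hl]
  have h1 : ∀ i : Fin n, (m + Finsupp.single i a).support = insert i m.support := by
    intro i
    ext l
    by_cases hl : l = i
    · subst hl
      simp
      omega
    · simp [hl]
  simp only [supportMoment, h1, h2]
  split_ifs
  · rw [← Finset.sum_div, ← mul_div_assoc, ← sub_div]
    have h3 : ∑ i, ((𝒵.filter (insert i m.support ⊆ ·)).card : ℝ) =
        k * ((𝒵.filter (m.support ⊆ ·)).card : ℝ) := by
      have h4 : ∑ i, (𝒵.filter (insert i m.support ⊆ ·)).card =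
          k * (𝒵.filter (m.support ⊆ ·)).card := by
        simp only [Finset.card_filter]
        rw [Finset.sum_comm, Finset.mul_sum]
        refine Finset.sum_congr rfl fun z hz => ?_
        simp only [Finset.insert_subset_iff]
        by_cases hm : m.support ⊆ z
        · simp [hm, hk z hz]
        · simp [hm]
      exact_mod_cast h4
    rw [h3, sub_self, zero_div]
  · simp

/-- The coordinates at which the exponent is not a multiple of `a`. -/
def residue (a : ℕ) (m : Fin n →₀ ℕ) : Finset (Fin n) := Finset.univ.filter fun i => ¬ a ∣ m i

/-- This is where `a ≤ 2` matters: then the class of an exponent modulo `a` is determined by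
divisibility, and a sum is divisible exactly when both classes agree. Consequently monomials with
different residue sets are orthogonal under `supportMean`. -/
theorem dvd_add_iff_residue_eq (ha : a = 1 ∨ a = 2) (m m' : Fin n →₀ ℕ) :
    (∀ i, a ∣ (m + m') i) ↔ residue a m = residue a m' := by
  simp only [residue, Finset.ext_iff, Finset.mem_filter, Finset.mem_univ, true_and, not_iff_not]
  refine forall_congr' fun i => ?_
  rcases ha with rfl | rfl
  · simp
  · rw [Finsupp.add_apply]
    omega

/-- The second moment splits into orthogonal blocks indexed by residue sets, and each block is an
average of squares over the random support. Only the block of `T` is kept. -/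
theorem sum_sq_le_supportMean_sq (ha : a = 1 ∨ a = 2) (h𝒵 : 𝒵.Nonempty)
    (p : MvPolynomial (Fin n) ℝ) (T : Finset (Fin n)) :
    ∑ z ∈ 𝒵, (∑ m ∈ p.support with residue a m = T, if m.support ⊆ z then coeff m p else 0) ^ 2 ≤
      𝒵.card * supportMean a 𝒵 (p ^ 2) := by
  have h0 : ((𝒵.card : ℕ) : ℝ) ≠ 0 := Nat.cast_ne_zero.2 h𝒵.card_ne_zero
  refine (Finset.sum_le_sum fun z _ => sq_sum_fiber_le p.support (residue a)
    (fun m => if m.support ⊆ z then coeff m p else 0) T).trans (le_of_eq ?_)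
  rw [supportMean, functionalOfMoments_sq, Finset.mul_sum, Finset.sum_comm]
  refine Finset.sum_congr rfl fun m _ => ?_
  rw [Finset.mul_sum, Finset.sum_comm]
  refine Finset.sum_congr rfl fun m' _ => ?_
  rw [supportMoment]
  simp only [dvd_add_iff_residue_eq ha]
  by_cases hR : residue a m = residue a m'
  · simp only [hR, if_true]
    have hsupp : (m + m').support = m.support ∪ m'.support := by
      ext l
      simp only [Finsupp.mem_support_iff, Finsupp.add_apply, Finset.mem_union]
      omega
    rw [hsupp, Finset.card_filter, Nat.cast_sum]
    have : (𝒵.card : ℝ) * (coeff m p * coeff m' p *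
        ((∑ z ∈ 𝒵, ((if m.support ∪ m'.support ⊆ z then 1 else 0 : ℕ) : ℝ)) / 𝒵.card)) =
        ∑ z ∈ 𝒵, coeff m p * coeff m' p *
          ((if m.support ∪ m'.support ⊆ z then 1 else 0 : ℕ) : ℝ) := by
      rw [← Finset.mul_sum]
      field_simp
    rw [this]
    refine Finset.sum_congr rfl fun z _ => ?_
    by_cases h1 : m.support ⊆ z <;> by_cases h2 : m'.support ⊆ z <;>
      simp [Finset.union_subset_iff, h1, h2]
  · simp [hR]

/-- The coordinates at which the exponent is `a`. -/
def fullExponents (a : ℕ) (m : Fin n →₀ ℕ) : Finset (Fin n) := Finset.univ.filter fun i => m i = a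

theorem support_eq_residue_union (ha : a = 1 ∨ a = 2) {m : Fin n →₀ ℕ} (hm : ∀ i, m i ≤ a) :
    m.support = residue a m ∪ fullExponents a m := by
  ext i
  have := hm i
  simp only [Finsupp.mem_support_iff, residue, fullExponents, Finset.mem_union, Finset.mem_filter,
    Finset.mem_univ, true_and]
  rcases ha with rfl | rfl
  · simp
    omega
  · omega

theorem disjoint_residue_fullExponents (m : Fin n →₀ ℕ) :
    Disjoint (residue a m) (fullExponents a m) := by
  rw [Finset.disjoint_left]
  intro i h1 h2
  simp only [residue, fullExponents, Finset.mem_filter, Finset.mem_univ, true_and] at h1 h2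
  exact h1 (h2 ▸ dvd_rfl)

theorem degree_eq_card_residue_add (ha : a = 1 ∨ a = 2) {m : Fin n →₀ ℕ} (hm : ∀ i, m i ≤ a) :
    m.degree = (residue a m).card + a * (fullExponents a m).card := by
  rw [Finsupp.degree_eq_sum, residue, fullExponents, Finset.card_filter, Finset.card_filter,
    Finset.mul_sum, ← Finset.sum_add_distrib]
  refine Finset.sum_congr rfl fun i _ => ?_
  have := hm i
  rcases ha with rfl | rfl
  · have h : m i = 0 ∨ m i = 1 := by omega
    rcases h with h | h <;> simp [h]
  · have h : m i = 0 ∨ m i = 1 ∨ m i = 2 := by omega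
    rcases h with h | h | h <;> simp [h]

theorem eq_of_residue_eq (ha : a = 1 ∨ a = 2) {m m' : Fin n →₀ ℕ} (hm : ∀ i, m i ≤ a)
    (hm' : ∀ i, m' i ≤ a) (h1 : residue a m = residue a m')
    (h2 : fullExponents a m = fullExponents a m') : m = m' := by
  ext i
  have e1 := Finset.ext_iff.1 h1 i
  have e2 := Finset.ext_iff.1 h2 i
  have := hm i
  have := hm' i
  simp only [residue, fullExponents, Finset.mem_filter, Finset.mem_univ, true_and] at e1 e2
  rcases ha with rfl | rfl <;> omega

/-- On the slice, top-degree normal forms have coefficients controlled by the second moment. -/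
theorem sq_coeff_le_supportMean_sq (ha : a = 1 ∨ a = 2) {k s e : ℕ} (hks : k + s = n)
    (hek : e ≤ k) (hes : e / a ≤ s) {p : MvPolynomial (Fin n) ℝ}
    (hp : p ∈ restrictSupport ℝ {m : Fin n →₀ ℕ | (∀ i, m i ≤ a) ∧ m.degree ≤ e ∧ e < m.degree + a})
    (m : Fin n →₀ ℕ) :
    coeff m p ^ 2 ≤ (n : ℝ) ^ (2 * e) *
      supportMean a (Finset.powersetCard k (Finset.univ : Finset (Fin n))) (p ^ 2) := by
  have ha0 : 0 < a := by omega
  have hcard : (Finset.powersetCard k (Finset.univ : Finset (Fin n))).card = n.choose s := by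
    rw [Finset.card_powersetCard, Finset.card_univ, Fintype.card_fin]
    exact Nat.choose_symm_of_eq_add hks.symm
  have hne : (Finset.powersetCard k (Finset.univ : Finset (Fin n))).Nonempty := by
    rw [← Finset.card_pos, hcard]
    exact Nat.choose_pos (by omega)
  have hmean : ∀ T, 0 ≤ (n.choose s : ℝ) *
      supportMean a (Finset.powersetCard k (Finset.univ : Finset (Fin n))) (p ^ 2) := fun T => by
    rw [← hcard]
    exact (Finset.sum_nonneg fun _ _ => sq_nonneg _).trans (sum_sq_le_supportMean_sq ha hne p T)
  have hchoose : (0 : ℝ) < n.choose s := by exact_mod_cast Nat.choose_pos (by omega)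
  have hmean0 := nonneg_of_mul_nonneg_right (hmean ∅) hchoose
  by_cases hm : m ∈ p.support
  swap
  · rw [notMem_support_iff.1 hm]
    simpa using mul_nonneg (by positivity) hmean0
  set T := residue a m with hT
  set e' := (fullExponents a m).card with he'
  set M := p.support.filter fun m' => residue a m' = T with hM
  have hmM : m ∈ M := Finset.mem_filter.2 ⟨hm, rfl⟩
  have hprop : ∀ m' ∈ M, (∀ i, m' i ≤ a) ∧ m'.degree ≤ e ∧ e < m'.degree + a := fun m' hm' =>
    hp (Finset.mem_filter.1 hm').1
  have hres : ∀ m' ∈ M, residue a m' = T := fun m' hm' => (Finset.mem_filter.1 hm').2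
  obtain ⟨hma, hmd, hmd'⟩ := hprop m hmM
  have hdm := degree_eq_card_residue_add ha hma
  rw [← hT, ← he'] at hdm
  have hle : e' ≤ a * e' := Nat.le_mul_of_pos_left _ ha0
  -- In a block the residue set is fixed, and the degree lies in a window of length `a`, so the
  -- number of full exponents is constant. The supports outside `T` are thus sets of one common
  -- size, as the inclusion-matrix bound requires.
  have hcardM : ∀ m' ∈ M, (fullExponents a m').card = e' := by
    intro m' hm'
    obtain ⟨h1, h2, h3⟩ := hprop m' hm'
    have h4 := degree_eq_card_residue_add ha h1
    rw [hres m' hm'] at h4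
    rcases ha with rfl | rfl <;> omega
  have hes' : e' ≤ s := by
    refine le_trans ?_ hes
    rw [Nat.le_div_iff_mul_le ha0, mul_comm]
    omega
  have hek' : T.card + e' ≤ k := by omega
  have hquad := choose_mul_sum_sq_le M T (fullExponents a) (fun m => coeff m p) (k := k) (s := s)
    (e := e') (by rw [hks, Fintype.card_fin])
    (fun m' hm' => hres m' hm' ▸ disjoint_residue_fullExponents m') hcardM
    (fun m₁ h₁ m₂ h₂ h => eq_of_residue_eq ha (hprop m₁ h₁).1 (hprop m₂ h₂).1
      ((hres m₁ h₁).trans (hres m₂ h₂).symm) h) hes' hek'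
  have hsum := sum_sq_le_supportMean_sq ha hne p T
  have hsame : ∀ z : Finset (Fin n),
      (∑ m ∈ M, if T ∪ fullExponents a m ⊆ z then coeff m p else 0) =
      ∑ m ∈ p.support with residue a m = T, if m.support ⊆ z then coeff m p else 0 := by
    intro z
    refine Finset.sum_congr rfl fun m' hm' => ?_
    rw [support_eq_residue_union ha (hprop m' hm').1, hres m' hm']
  simp only [hsame] at hquad
  have h1 := hquad.trans hsum
  rw [hcard, Fintype.card_fin] at h1
  have h2 : coeff m p ^ 2 ≤ ∑ m ∈ M, coeff m p ^ 2 :=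
    Finset.single_le_sum (f := fun m => coeff m p ^ 2) (fun _ _ => sq_nonneg _) hmM
  -- It remains to compare the number of `k`-sets with the smallest eigenvalue bound. The exponent
  -- `2e' + |T|` is at most `2e` because `|T| + a e'` is the degree of `m`.
  have h3 := choose_le_pow_mul_choose (n := n) (s := s) (a := e') (b := T.card + e') hes' (by omega)
  have h3' : (n.choose s : ℝ) ≤ (n : ℝ) ^ (e' + (T.card + e')) *
      ((n - e' - (T.card + e')).choose (s - e') : ℝ) := by exact_mod_cast h3
  set Cn := ((n - e' - (T.card + e')).choose (s - e') : ℝ) with hCn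
  set Lp := supportMean a (Finset.powersetCard k (Finset.univ : Finset (Fin n))) (p ^ 2)
  have hC0 : 0 < Cn := by
    rw [hCn]
    exact_mod_cast Nat.choose_pos (by omega)
  have hnpow : (n : ℝ) ^ (e' + (T.card + e')) ≤ (n : ℝ) ^ (2 * e) := by
    rcases Nat.eq_zero_or_pos n with h0 | h0
    · have h5 : e' + (T.card + e') = 0 := by omega
      have h6 : e = 0 := by omega
      rw [h5, h6]
    · exact pow_le_pow_right₀ (by exact_mod_cast h0) (by omega)
  have h4 : Cn * coeff m p ^ 2 ≤ Cn * ((n : ℝ) ^ (2 * e) * Lp) := by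
    calc Cn * coeff m p ^ 2 ≤ Cn * ∑ m ∈ M, coeff m p ^ 2 := by gcongr
      _ ≤ n.choose s * Lp := h1
      _ ≤ ((n : ℝ) ^ (e' + (T.card + e')) * Cn) * Lp := by gcongr
      _ ≤ ((n : ℝ) ^ (2 * e) * Cn) * Lp := by gcongr
      _ = _ := by ring
  exact le_of_mul_le_mul_left h4 hC0

end Functionals

end SoSBound

/-! ### Slices in the range `2d ≤ k`. -/

namespace SoSBound

variable {n : ℕ}

/-- The system consists of `X i ^ (a + 1) = X i` and `∑ i, X i ^ a = k`. -/
structure IsSliceSystem {ι : Type} (a k : ℕ) (g : ι → MvPolynomial (Fin n) ℝ) : Prop where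
  pow : ∀ i, ∃ j, g j = X i ^ (a + 1) - X i
  sum : ∃ j, g j = (∑ i, X i ^ a) - C (k : ℝ)
  eq_or : ∀ j, (∃ i, g j = X i ^ (a + 1) - X i) ∨ g j = (∑ i, X i ^ a) - C (k : ℝ)

theorem totalDegree_sum_X_pow_sub_le (a : ℕ) (c : ℝ) :
    ((∑ i, X i ^ a) - C c : MvPolynomial (Fin n) ℝ).totalDegree ≤ a := by
  refine totalDegree_sub_le (totalDegree_sum_le fun i _ => ?_) (by simp)
  exact (totalDegree_pow _ _).trans (by simp)

theorem card_support_le_degree (m : Fin n →₀ ℕ) : m.support.card ≤ m.degree := by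
  rw [Finsupp.degree_apply, Finset.card_eq_sum_ones]
  exact Finset.sum_le_sum fun i hi => Nat.one_le_iff_ne_zero.2 (Finsupp.mem_support_iff.1 hi)

/-- The exponent vectors that survive reduction and raising in degree `e`. -/
def topMonomials (n a e : ℕ) : Set (Fin n →₀ ℕ) :=
  {m | (∀ i, m i ≤ a) ∧ m.degree ≤ e ∧ e < m.degree + a}

section Slice

variable {ι : Type} [Fintype ι] {g : ι → MvPolynomial (Fin n) ℝ} {a k : ℕ}

/-- Multiply the sum equation by `x^m`. For `i` in the support, `x^m xᵢ^a` reduces to `x^m`, leaving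
`(k - |supp m|) x^m = ∑_{i ∉ supp m} x^m xᵢ^a`. The division is legitimate because `|supp m| < e ≤
k`, and the inverse is then at most `1`. -/
theorem IsSliceSystem.idealBound_raise (hg : IsSliceSystem a k g) {e : ℕ} (hek : e ≤ k)
    (ha : 1 ≤ a) {m : Fin n →₀ ℕ} (hm : m.degree + a ≤ e) :
    IdealBound g e (monomial m 1 - ((k : ℝ) - m.support.card)⁻¹ •
      ∑ i ∈ m.supportᶜ, monomial (m + Finsupp.single i a) 1) (n + 1) := by
  have hcard : m.support.card + 1 ≤ k := by
    have := card_support_le_degree m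
    omega
  have hpos : (1 : ℝ) ≤ (k : ℝ) - m.support.card := by
    have : ((m.support.card + 1 : ℕ) : ℝ) ≤ k := by exact_mod_cast hcard
    push_cast at this
    linarith
  obtain ⟨j, hj⟩ := hg.sum
  have h1 : IdealBound g e (monomial m 1 * g j) 1 := by
    refine IdealBound.mul_generator j ?_ fun m' => by simpa using abs_coeff_monomial_le m' m 1
    rw [hj]
    exact (totalDegree_mul_le (totalDegree_monomial_le_degree m 1)
      (totalDegree_sum_X_pow_sub_le a k)).trans hm
  have h2 : IdealBound g e (∑ i ∈ m.support,
      (monomial (m + Finsupp.single i a) 1 - monomial m 1)) (∑ i ∈ m.support, 1) :=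
    IdealBound.sum _ fun i hi =>
      IdealBound.lower_exponent hg.pow (Finsupp.mem_support_iff.1 hi) hm
  have h3 := (h2.add (h1.smul (-1))).smul ((k : ℝ) - m.support.card)⁻¹
  convert h3.mono le_rfl ?_ using 1
  · have hne : ((k : ℝ) - m.support.card) ≠ 0 := by linarith
    have e1 : monomial m (1 : ℝ) = ((k : ℝ) - m.support.card)⁻¹ •
        (((k : ℝ) - m.support.card) • monomial m (1 : ℝ)) := by
      rw [smul_smul, inv_mul_cancel₀ hne, one_smul]
    conv_lhs => rw [e1]
    rw [← smul_sub]
    congr 1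
    rw [hj, mul_sub, Finset.mul_sum, mul_comm _ (C (k : ℝ)), Finset.sum_sub_distrib,
      Finset.sum_const, ← Finset.sum_add_sum_compl m.support
        (fun i => monomial m (1 : ℝ) * X i ^ a)]
    simp only [monomial_mul_X_pow]
    rw [← smul_eq_C_mul, ← Nat.cast_smul_eq_nsmul ℝ]
    module
  · have hn : (m.support.card : ℝ) ≤ n := by
      have := m.support.card_le_univ
      rw [Fintype.card_fin] at this
      exact_mod_cast this
    rw [abs_of_nonneg (inv_nonneg.2 (by linarith)), Finset.sum_const, nsmul_eq_mul, mul_one,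
      abs_neg, abs_one, one_mul]
    have hle1 : ((k : ℝ) - m.support.card)⁻¹ ≤ 1 := inv_le_one_of_one_le₀ hpos
    calc ((k : ℝ) - m.support.card)⁻¹ * (m.support.card + 1) ≤ 1 * (n + 1) := by gcongr
      _ = n + 1 := one_mul _

theorem IsSliceSystem.exists_normalForm (hg : IsSliceSystem a k g) {e : ℕ} (hek : e ≤ k)
    (ha : 1 ≤ a) {m : Fin n →₀ ℕ} (hm : m.degree ≤ e) :
    ∃ ν ∈ restrictSupport ℝ (topMonomials n a e),
      IdealBound g e (monomial m 1 - ν) (e + ((n : ℝ) + 1) ^ (2 * e)) := by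
  obtain ⟨m', h1, -, h3, h4⟩ := exists_reduced_monomial ha hg.pow m hm
  have hn : (1 : ℝ) ≤ (n : ℝ) + 1 := by linarith [n.cast_nonneg (α := ℝ)]
  obtain ⟨ν, hν, hνb⟩ := exists_raised (g := g) ha (fun m => ∀ i, m i ≤ a) (e := e)
    (fun m hma hme => by
      refine ⟨m.supportᶜ, ((k : ℝ) - m.support.card)⁻¹, ?_, ?_, hg.idealBound_raise hek ha hme⟩
      · have hcard : m.support.card + 1 ≤ k := by
          have := card_support_le_degree m
          omega
        have : ((m.support.card + 1 : ℕ) : ℝ) ≤ k := by exact_mod_cast hcard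
        push_cast at this
        rw [abs_of_nonneg (inv_nonneg.2 (by linarith))]
        exact inv_le_one_of_one_le₀ (by linarith)
      · intro i hi l
        rw [Finset.mem_compl, Finsupp.notMem_support_iff] at hi
        by_cases hl : l = i
        · subst hl
          simp [hi]
        · simpa [Finsupp.add_apply, Finsupp.single_apply, Ne.symm hl] using hma l)
    m' h1 (h3.trans hm)
  refine ⟨ν, hν, ?_⟩
  have h5 := h4.add hνb
  rw [sub_add_sub_cancel] at h5
  refine h5.mono le_rfl (add_le_add (by exact_mod_cast hm) (pow_le_pow_right₀ hn ?_))
  omega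

/-- Extended linearly from monomials. The degree of `p'` stays bounded because elements of the
truncated ideal have bounded degree themselves. -/
theorem exists_sub_mem_truncIdeal {N : Submodule ℝ (MvPolynomial (Fin n) ℝ)} {e : ℕ}
    (h : ∀ m : Fin n →₀ ℕ, m.degree ≤ e → ∃ ν ∈ N, monomial m 1 - ν ∈ truncIdeal g e)
    {p : MvPolynomial (Fin n) ℝ} (hp : p.totalDegree ≤ e) :
    ∃ p' ∈ N, p'.totalDegree ≤ e ∧ p - p' ∈ truncIdeal g e := by
  choose! ν hν hνm using h
  have hmem : p - ∑ m ∈ monomialsUpTo n e, coeff m p • ν m ∈ truncIdeal g e := by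
    have h0 : p - ∑ m ∈ monomialsUpTo n e, coeff m p • ν m =
        ∑ m ∈ monomialsUpTo n e, (monomial m (coeff m p) - coeff m p • ν m) := by
      rw [Finset.sum_sub_distrib, sum_monomial_coeff hp]
    rw [h0]
    refine Submodule.sum_mem _ fun m hm => ?_
    have h1 : monomial m (coeff m p) = coeff m p • monomial m (1 : ℝ) := by
      rw [smul_monomial, smul_eq_mul, mul_one]
    rw [h1, ← smul_sub]
    exact Submodule.smul_mem _ _ (hνm m (mem_monomialsUpTo_iff_degree.1 hm))
  refine ⟨_, N.sum_mem fun m hm => N.smul_mem (coeff m p)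
    (hν m (mem_monomialsUpTo_iff_degree.1 hm)), ?_, hmem⟩
  have := totalDegree_sub_le hp (totalDegree_le_of_mem_truncIdeal hmem)
  rwa [sub_sub_cancel] at this

/-- Factor as `(p - p') (p + p')`: the degrees add up to exactly `2d`. -/
theorem sq_sub_sq_mem_truncIdeal {d : ℕ} {p p' : MvPolynomial (Fin n) ℝ}
    (hp : p.totalDegree ≤ d) (hp' : p'.totalDegree ≤ d) (h : p - p' ∈ truncIdeal g d) :
    p ^ 2 - p' ^ 2 ∈ truncIdeal g (2 * d) := by
  have := mul_mem_truncIdeal h (totalDegree_add_le hp hp')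
  rw [two_mul]
  convert this using 1
  ring

omit [Fintype ι] in
theorem IsSliceSystem.supportMean_mul_eq_zero (hg : IsSliceSystem a k g) (ha : 1 ≤ a) (j : ι)
    (q : MvPolynomial (Fin n) ℝ) :
    supportMean a (Finset.powersetCard k (Finset.univ : Finset (Fin n))) (q * g j) = 0 := by
  rcases hg.eq_or j with ⟨i, hi⟩ | hj
  · rw [hi]
    exact supportMean_mul_X_pow_sub i q
  · rw [hj]
    exact supportMean_mul_sum_sub ha (fun z hz => (Finset.mem_powersetCard.1 hz).2) q

/-- For `a = 2` this is the sum equation itself; for `a = 1` the equations `xᵢ² = xᵢ` are added. It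
yields the bound on each variable needed for boundedness of the relaxation. -/
theorem IsSliceSystem.sum_sq_sub_mem (hg : IsSliceSystem a k g) (ha : a = 1 ∨ a = 2) :
    (∑ i, X i ^ 2) - C (k : ℝ) ∈ truncIdeal g 2 := by
  obtain ⟨j, hj⟩ := hg.sum
  have h1 : (∑ i, X i ^ a) - C (k : ℝ) ∈ truncIdeal g 2 := by
    rw [← hj, ← one_mul (g j)]
    refine (IdealBound.mul_generator (g := g) (B := 1) j ?_ fun m => ?_).mem
    · rw [one_mul, hj]
      exact (totalDegree_sum_X_pow_sub_le a k).trans (by omega)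
    · simpa using abs_coeff_monomial_le m 0 1
  rcases ha with rfl | rfl
  · have h2 : ∑ i, (X i ^ 2 - X i : MvPolynomial (Fin n) ℝ) ∈ truncIdeal g 2 := by
      refine Submodule.sum_mem _ fun i _ => ?_
      have := (IdealBound.lower_exponent (g := g) (e := 2) (a := 1) hg.pow
        (m := Finsupp.single i 1) (i := i) (by simp) (by simp)).mem
      rw [← monomial_mul_X_pow, ← X_pow_eq_monomial_single] at this
      convert this using 1
      ring
    convert add_mem h1 h2 using 1
    rw [Finset.sum_sub_distrib]
    simp only [pow_one]
    ring
  · exact h1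

theorem isSoSMod_of_le {W : Submodule ℝ (MvPolynomial (Fin n) ℝ)} {d : ℕ} {c c' : ℝ}
    {h : MvPolynomial (Fin n) ℝ} (H : IsSoSMod W d (C c - h)) (hc : c ≤ c') :
    IsSoSMod W d (C c' - h) := by
  convert H.add (isSoSMod_C (sub_nonneg.2 hc)) using 1
  rw [C_sub]
  ring

theorem isSoSMod_natPow_sub_monomial {W : Submodule ℝ (MvPolynomial (Fin n) ℝ)} {d r : ℕ}
    (hW : truncIdeal g (2 * d) ≤ W) (hn : 1 ≤ n) (hr : 1 ≤ r)
    (h : ∀ i, IsSoSMod (truncIdeal g 2) 1 (C (n : ℝ) - X i ^ 2)) {α : Fin n →₀ ℕ}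
    (hα : α.degree ≤ d) : IsSoSMod W d (C ((n : ℝ) ^ (r * d)) - monomial (α + α) 1) := by
  refine isSoSMod_of_le (isSoSMod_pow_sub_monomial hW n.cast_nonneg h α.degree α rfl hα)
    (pow_le_pow_right₀ (by exact_mod_cast hn) ?_)
  nlinarith

/-- The reduction of an exponent modulo `x ^ (a + 1) = x`. -/
def reduceExponent (a j : ℕ) : ℕ := if j = 0 then 0 else (j - 1) % a + 1

theorem reduceExponent_of_le {a j : ℕ} (h : j ≤ a) : reduceExponent a j = j := by
  unfold reduceExponent
  split_ifs with h0
  · exact h0.symm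
  · rw [Nat.mod_eq_of_lt (by omega)]
    omega

theorem reduceExponent_add {a j : ℕ} (h : j ≠ 0) : reduceExponent a (j + a) = reduceExponent a j := by
  unfold reduceExponent
  rw [if_neg h, if_neg (by omega)]
  have : j + a - 1 = j - 1 + a := by omega
  rw [this, Nat.add_mod_right]

theorem reduceExponent_le {a : ℕ} (ha : 1 ≤ a) (j : ℕ) : reduceExponent a j ≤ a := by
  unfold reduceExponent
  split_ifs
  · omega
  · have := Nat.mod_lt (j - 1) ha
    omega

theorem reduceExponent_le_self (a j : ℕ) : reduceExponent a j ≤ j := by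
  unfold reduceExponent
  split_ifs
  · omega
  · have := Nat.mod_le (j - 1) a
    omega

theorem reduceExponent_zero (a : ℕ) : reduceExponent a 0 = 0 := if_pos rfl

/-- Reduction of all exponents of a monomial. -/
noncomputable def reduceMonomial (a : ℕ) (m : Fin n →₀ ℕ) : Fin n →₀ ℕ :=
  m.mapRange (reduceExponent a) (reduceExponent_zero a)

theorem reduceMonomial_of_le {m : Fin n →₀ ℕ} (h : ∀ i, m i ≤ a) : reduceMonomial a m = m := by
  ext i
  exact reduceExponent_of_le (h i)

theorem reduceMonomial_le {m : Fin n →₀ ℕ} (ha : 1 ≤ a) (i : Fin n) : reduceMonomial a m i ≤ a :=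
  reduceExponent_le ha (m i)

theorem degree_reduceMonomial_le (m : Fin n →₀ ℕ) : (reduceMonomial a m).degree ≤ m.degree := by
  rw [Finsupp.degree_eq_sum, Finsupp.degree_eq_sum]
  exact Finset.sum_le_sum fun i _ => reduceExponent_le_self a (m i)

theorem reduceMonomial_add_single {m : Fin n →₀ ℕ} {i : Fin n} (hi : m i ≠ 0) :
    reduceMonomial a (m + Finsupp.single i a) = reduceMonomial a m := by
  ext l
  by_cases hl : l = i
  · subst hl
    simp only [reduceMonomial, Finsupp.mapRange_apply, Finsupp.add_apply, Finsupp.single_eq_same]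
    exact reduceExponent_add hi
  · simp [reduceMonomial, Ne.symm hl]

theorem reduceMonomial_reduceMonomial_add (ha : 1 ≤ a) (m : Fin n →₀ ℕ) (i : Fin n) :
    reduceMonomial a (reduceMonomial a m + Finsupp.single i a) =
      reduceMonomial a (m + Finsupp.single i a) := by
  ext l
  by_cases hl : l = i
  · subst hl
    simp only [reduceMonomial, Finsupp.mapRange_apply, Finsupp.add_apply, Finsupp.single_eq_same]
    by_cases h0 : m l = 0
    · rw [h0, reduceExponent_zero]
    · rw [reduceExponent_add h0, reduceExponent_add, reduceExponent_of_le (reduceExponent_le ha _)]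
      rw [reduceExponent, if_neg h0]
      omega
  · simp only [reduceMonomial, Finsupp.mapRange_apply, Finsupp.add_apply, Finsupp.single_apply,
      Ne.symm hl, if_false, add_zero]
    exact reduceExponent_of_le (reduceExponent_le ha _)

/-- Reduction of all exponents, as a linear map. -/
noncomputable def reducePolynomial (n a : ℕ) : MvPolynomial (Fin n) ℝ →ₗ[ℝ] MvPolynomial (Fin n) ℝ :=
  (basisMonomials (Fin n) ℝ).constr ℝ fun m => monomial (reduceMonomial a m) 1

theorem reducePolynomial_monomial (m : Fin n →₀ ℕ) (c : ℝ) :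
    reducePolynomial n a (monomial m c) = monomial (reduceMonomial a m) c := by
  have h : monomial m c = c • basisMonomials (Fin n) ℝ m := by
    rw [coe_basisMonomials, smul_monomial, smul_eq_mul, mul_one]
  rw [h, map_smul, reducePolynomial, Module.Basis.constr_basis, smul_monomial, smul_eq_mul, mul_one]

theorem reducePolynomial_eq_sum (p : MvPolynomial (Fin n) ℝ) :
    reducePolynomial n a p = ∑ m ∈ p.support, monomial (reduceMonomial a m) (coeff m p) := by
  conv_lhs => rw [p.as_sum, map_sum]
  exact Finset.sum_congr rfl fun m _ => reducePolynomial_monomial m _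

theorem reducePolynomial_of_le {p : MvPolynomial (Fin n) ℝ} (h : ∀ m ∈ p.support, ∀ i, m i ≤ a) :
    reducePolynomial n a p = p := by
  rw [reducePolynomial_eq_sum]
  conv_rhs => rw [p.as_sum]
  exact Finset.sum_congr rfl fun m hm => by rw [reduceMonomial_of_le (h m hm)]

theorem exists_reduceMonomial_eq {p : MvPolynomial (Fin n) ℝ} {m : Fin n →₀ ℕ}
    (hm : m ∈ (reducePolynomial n a p).support) : ∃ m' ∈ p.support, reduceMonomial a m' = m := by
  by_contra hcon
  push Not at hcon
  refine mem_support_iff.1 hm ?_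
  rw [reducePolynomial_eq_sum, coeff_sum]
  refine Finset.sum_eq_zero fun m' hm' => ?_
  rw [coeff_monomial, if_neg (hcon m' hm')]

theorem reducePolynomial_mul_X_pow_sub (i : Fin n) (q : MvPolynomial (Fin n) ℝ) :
    reducePolynomial n a (q * (X i ^ (a + 1) - X i)) = 0 := by
  rw [q.as_sum, Finset.sum_mul, map_sum]
  refine Finset.sum_eq_zero fun m _ => ?_
  have h1 : monomial m (coeff m q) * X i = monomial (m + Finsupp.single i 1) (coeff m q) := by
    rw [← pow_one (X i), monomial_mul_X_pow]
  rw [mul_sub, monomial_mul_X_pow, h1, map_sub, reducePolynomial_monomial,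
    reducePolynomial_monomial, add_comm a 1, Finsupp.single_add, ← add_assoc,
    reduceMonomial_add_single (by simp), sub_self]

theorem reducePolynomial_mul_sum_sub (k : ℕ) (q : MvPolynomial (Fin n) ℝ) :
    reducePolynomial n a (q * ((∑ i, X i ^ a) - C (k : ℝ))) =
      ∑ m ∈ q.support, (∑ i, monomial (reduceMonomial a (m + Finsupp.single i a)) (coeff m q) -
        monomial (reduceMonomial a m) (k * coeff m q)) := by
  conv_lhs => rw [q.as_sum, Finset.sum_mul, map_sum]
  refine Finset.sum_congr rfl fun m _ => ?_
  rw [mul_sub, Finset.mul_sum, mul_comm _ (C (k : ℝ)), C_mul_monomial, map_sub, map_sum]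
  simp only [monomial_mul_X_pow, reducePolynomial_monomial]

/-- Reducing exponents early does not affect the final reduction, so a multiplier of the sum
equation may be assumed reduced. -/
theorem reducePolynomial_reducePolynomial_mul (ha : 1 ≤ a) (k : ℕ) (q : MvPolynomial (Fin n) ℝ) :
    reducePolynomial n a (reducePolynomial n a q * ((∑ i, X i ^ a) - C (k : ℝ))) =
      reducePolynomial n a (q * ((∑ i, X i ^ a) - C (k : ℝ))) := by
  rw [reducePolynomial_eq_sum q, Finset.sum_mul, map_sum]
  conv_rhs => rw [q.as_sum, Finset.sum_mul, map_sum]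
  refine Finset.sum_congr rfl fun m _ => ?_
  rw [mul_sub, mul_sub, Finset.mul_sum, Finset.mul_sum, mul_comm _ (C (k : ℝ)),
    mul_comm _ (C (k : ℝ)), C_mul_monomial, C_mul_monomial, map_sub, map_sub, map_sum, map_sum]
  simp only [monomial_mul_X_pow, reducePolynomial_monomial, reduceMonomial_reduceMonomial_add ha]
  rw [reduceMonomial_of_le fun i => reduceMonomial_le ha i]

theorem le_totalDegree_sum_X_pow_sub (hn : 1 ≤ n) (ha : 1 ≤ a) (c : ℝ) :
    a ≤ ((∑ i, X i ^ a) - C c : MvPolynomial (Fin n) ℝ).totalDegree := by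
  have i₀ : Fin n := ⟨0, hn⟩
  have hcoeff : coeff (Finsupp.single i₀ a) ((∑ i, X i ^ a) - C c : MvPolynomial (Fin n) ℝ) = 1 := by
    rw [coeff_sub, coeff_sum, Finset.sum_eq_single i₀]
    · rw [X_pow_eq_monomial, coeff_monomial, if_pos rfl, coeff_C, if_neg, sub_zero]
      intro h
      have := DFunLike.congr_fun h i₀
      simp at this
      omega
    · intro i _ hi
      rw [X_pow_eq_monomial, coeff_monomial, if_neg]
      intro h
      have := DFunLike.congr_fun h i₀
      simp [hi] at this
      omega
    · intro h
      exact absurd (Finset.mem_univ _) h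
  have := totalDegree_le_iff_degree.1 (le_refl
    ((∑ i, X i ^ a) - C c : MvPolynomial (Fin n) ℝ).totalDegree) (Finsupp.single i₀ a)
    (by rw [hcoeff]; exact one_ne_zero)
  rwa [Finsupp.degree_single] at this

/-- Normal forms are independent modulo the truncated ideal when `e ≤ k`. -/
theorem IsSliceSystem.eq_zero_of_mem_truncIdeal (hg : IsSliceSystem a k g) (hn : 1 ≤ n)
    (ha : 1 ≤ a) {e : ℕ} (hek : e ≤ k) {ν : MvPolynomial (Fin n) ℝ}
    (hν : ν ∈ restrictSupport ℝ (topMonomials n a e)) (hmem : ν ∈ truncIdeal g e) : ν = 0 := by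
  classical
  set G : MvPolynomial (Fin n) ℝ := (∑ i, X i ^ a) - C (k : ℝ) with hG
  obtain ⟨q, hq, hνq⟩ := hmem
  set Q := ∑ j with g j = G, q j with hQ
  have hQdeg : (Q * G).totalDegree ≤ e := by
    rw [hQ, Finset.sum_mul]
    refine totalDegree_sum_le fun j hj => ?_
    rw [← (Finset.mem_filter.1 hj).2]
    exact hq j
  -- Reduction fixes `ν` and annihilates all multiples of `xᵢ^(a+1) - xᵢ`, so only the multiplier of
  -- the sum equation survives.
  have hνQ : ν = reducePolynomial n a (Q * G) := by
    rw [← reducePolynomial_of_le (a := a) (p := ν) fun m hm => (hν hm).1, hνq, map_sum, hQ,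
      Finset.sum_mul, map_sum, Finset.sum_filter]
    refine Finset.sum_congr rfl fun j _ => ?_
    split_ifs with hj
    · rw [hj]
    · rcases hg.eq_or j with ⟨i, hi⟩ | hj'
      · rw [hi]
        exact reducePolynomial_mul_X_pow_sub i _
      · exact absurd hj' hj
  rw [← reducePolynomial_reducePolynomial_mul ha] at hνQ
  set b := reducePolynomial n a Q with hb
  have hb0 : b = 0 := by
    by_contra hb0
    -- A monomial `m` of least degree in the reduced multiplier cannot be hit from another monomial:
    -- raising increases the degree, and lowering returns to the starting monomial. Its coefficient
    -- in `ν` is therefore `|supp m| - k` times its coefficient in `b`. But the degree of `m` is too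
    -- low for it to occur in `ν`, while `|supp m| < k`.
    obtain ⟨m, hm, hmin⟩ := Finset.exists_min_image b.support Finsupp.degree
      (support_nonempty.2 hb0)
    have hba : ∀ m' ∈ b.support, ∀ i, m' i ≤ a := by
      intro m' hm' i
      obtain ⟨m'', -, rfl⟩ := exists_reduceMonomial_eq hm'
      exact reduceMonomial_le ha i
    have hQ0 : Q ≠ 0 := by
      intro h
      rw [h, map_zero] at hb
      exact hb0 hb
    have hGdeg := le_totalDegree_sum_X_pow_sub hn ha (k : ℝ)
    rw [← hG] at hGdeg
    have hG0 : G ≠ 0 := by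
      intro h
      rw [h, totalDegree_zero] at hGdeg
      omega
    rw [totalDegree_mul_of_isDomain hQ0 hG0] at hQdeg
    have hmdeg : m.degree + a ≤ e := by
      obtain ⟨m', hm', rfl⟩ := exists_reduceMonomial_eq hm
      have h1 := totalDegree_le_iff_degree.1 (le_refl Q.totalDegree) m' (mem_support_iff.1 hm')
      have h2 := degree_reduceMonomial_le (a := a) m'
      omega
    have hcoeff : coeff m ν = ((m.support.card : ℝ) - k) * coeff m b := by
      rw [hνQ, reducePolynomial_mul_sum_sub, coeff_sum, Finset.sum_eq_single m]
      · rw [coeff_sub, coeff_sum, reduceMonomial_of_le (hba m hm), coeff_monomial, if_pos rfl]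
        have h1 : ∀ i, coeff m (monomial (reduceMonomial a (m + Finsupp.single i a)) (coeff m b)) =
            if i ∈ m.support then coeff m b else 0 := by
          intro i
          rw [coeff_monomial]
          by_cases hi : i ∈ m.support
          · rw [if_pos hi, reduceMonomial_add_single (Finsupp.mem_support_iff.1 hi),
              reduceMonomial_of_le (hba m hm), if_pos rfl]
          · rw [if_neg hi, if_neg]
            intro h
            have := DFunLike.congr_fun h i
            rw [Finsupp.notMem_support_iff] at hi
            simp [reduceMonomial, hi, reduceExponent_of_le] at this
            omega
        simp only [h1]
        rw [Finset.sum_ite_mem, Finset.univ_inter, Finset.sum_const, nsmul_eq_mul]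
        ring
      · intro m' hm' hne
        rw [coeff_sub, coeff_sum, reduceMonomial_of_le (hba m' hm'), coeff_monomial, if_neg hne,
          sub_zero]
        refine Finset.sum_eq_zero fun i _ => ?_
        rw [coeff_monomial, if_neg]
        intro h
        by_cases hi : m' i = 0
        · rw [reduceMonomial_of_le] at h
          · have h1 := congrArg Finsupp.degree h
            rw [map_add, Finsupp.degree_single] at h1
            have := hmin m' hm'
            omega
          · intro l
            by_cases hl : l = i
            · subst hl
              simp [hi]
            · simpa [Finsupp.single_apply, Ne.symm hl] using hba m' hm' l
        · rw [reduceMonomial_add_single hi, reduceMonomial_of_le (hba m' hm')] at h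
          exact hne h
      · intro h
        exact absurd hm h
    have hνm : coeff m ν = 0 := by
      by_contra h
      have := (hν (mem_support_iff.2 h)).2.2
      omega
    rw [hνm] at hcoeff
    have hcard := card_support_le_degree m
    have hlt : (m.support.card : ℝ) < k := by
      have : m.support.card < k := by omega
      exact_mod_cast this
    rcases mul_eq_zero.1 hcoeff.symm with h | h
    · linarith
    · exact mem_support_iff.1 hm h
  rw [hνQ, hb0, zero_mul, map_zero]

/-- Source of the constant `10` in `HasNormalForms`: both summands are at most `n ^ (8 d)` and the
factor `2` is at most `n ^ (2 d)`. -/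
theorem two_mul_add_pow_le (hn : 2 ≤ n) {d e : ℕ} (hd : 1 ≤ d) (he : e ≤ 2 * d) :
    (e : ℝ) + ((n : ℝ) + 1) ^ (2 * e) ≤ (n : ℝ) ^ (10 * d) := by
  have hn2 : (2 : ℝ) ≤ n := by exact_mod_cast hn
  have h1 : (n : ℝ) + 1 ≤ (n : ℝ) ^ 2 := by nlinarith
  have h2 : ((n : ℝ) + 1) ^ (2 * e) ≤ (n : ℝ) ^ (8 * d) := by
    calc ((n : ℝ) + 1) ^ (2 * e) ≤ ((n : ℝ) ^ 2) ^ (2 * e) := by gcongr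
      _ = (n : ℝ) ^ (4 * e) := by rw [← pow_mul]; congr 1; ring
      _ ≤ (n : ℝ) ^ (8 * d) := pow_le_pow_right₀ (by linarith) (by omega)
  have h3 : (e : ℝ) ≤ (n : ℝ) ^ (8 * d) := by
    have h4 : e ≤ 2 ^ e := e.lt_two_pow_self.le
    calc (e : ℝ) ≤ 2 ^ e := by exact_mod_cast h4
      _ ≤ (n : ℝ) ^ e := by gcongr
      _ ≤ (n : ℝ) ^ (8 * d) := pow_le_pow_right₀ (by linarith) (by omega)
  have h5 : (2 : ℝ) ≤ (n : ℝ) ^ (2 * d) := by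
    calc (2 : ℝ) ≤ n := hn2
      _ = (n : ℝ) ^ 1 := (pow_one _).symm
      _ ≤ (n : ℝ) ^ (2 * d) := pow_le_pow_right₀ (by linarith) (by omega)
  calc (e : ℝ) + ((n : ℝ) + 1) ^ (2 * e) ≤ 2 * (n : ℝ) ^ (8 * d) := by linarith
    _ ≤ (n : ℝ) ^ (2 * d) * (n : ℝ) ^ (8 * d) := by gcongr
    _ = (n : ℝ) ^ (10 * d) := by rw [← pow_add]; congr 1; ring

theorem one_le_natCast_pow (hn : 1 ≤ n) (j : ℕ) : (1 : ℝ) ≤ (n : ℝ) ^ j :=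
  one_le_pow₀ (by exact_mod_cast hn)

theorem powersetCard_univ_nonempty {k s : ℕ} (hks : k + s = n) :
    (Finset.powersetCard k (Finset.univ : Finset (Fin n))).Nonempty := by
  rw [← Finset.card_pos, Finset.card_powersetCard, Finset.card_univ, Fintype.card_fin]
  exact Nat.choose_pos (by omega)

theorem IsSliceSystem.isSoSMod_X_sq (hg : IsSliceSystem a k g) (ha : a = 1 ∨ a = 2) (hk : k ≤ n)
    (i : Fin n) : IsSoSMod (truncIdeal g 2) 1 (C (n : ℝ) - X i ^ 2) :=
  isSoSMod_const_sub_of_sum_sq (by exact_mod_cast hk) (hg.sum_sq_sub_mem ha) i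

theorem IsSliceSystem.exists_sq_sub_sq_mem (hg : IsSliceSystem a k g) (hn : 2 ≤ n)
    (ha : a = 1 ∨ a = 2) {s d : ℕ} (hks : k + s = n) (hdk : d ≤ k) (hds : d / a ≤ s)
    {p : MvPolynomial (Fin n) ℝ} (hp : p.totalDegree ≤ d) :
    ∃ p' : MvPolynomial (Fin n) ℝ, p'.totalDegree ≤ d ∧ p ^ 2 - p' ^ 2 ∈ truncIdeal g (2 * d) ∧
      ∀ m, coeff m p' ^ 2 ≤ (n : ℝ) ^ (10 * d) *
        supportMean a (Finset.powersetCard k (Finset.univ : Finset (Fin n))) (p' ^ 2) := by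
  have ha1 : 1 ≤ a := by omega
  obtain ⟨p', hp'N, hp'd, hp'm⟩ := exists_sub_mem_truncIdeal (g := g) (e := d) (fun m hm => by
    obtain ⟨ν, h1, h2⟩ := hg.exists_normalForm hdk ha1 hm
    exact ⟨ν, h1, h2.mem⟩) hp
  refine ⟨p', hp'd, sq_sub_sq_mem_truncIdeal hp hp'd hp'm, fun m => ?_⟩
  have h1 := sq_coeff_le_supportMean_sq ha hks hdk hds hp'N
  have h0 := nonneg_of_mul_nonneg_right ((sq_nonneg _).trans (h1 0))
    (pow_pos (by exact_mod_cast (by omega)) _)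
  exact (h1 m).trans (mul_le_mul_of_nonneg_right
    (pow_le_pow_right₀ (by exact_mod_cast (by omega)) (by omega)) h0)

/-- Normal forms are used in two degrees. Those of degree `2d` rewrite the defect and need `2d ≤ k`
for existence and independence. Those of degree `d` replace the squared polynomials, and their
coefficient bound needs `d / a ≤ n - k`. -/
theorem IsSliceSystem.hasNormalForms (hg : IsSliceSystem a k g) (hn : 2 ≤ n) (ha : a = 1 ∨ a = 2)
    {s d : ℕ} (hd : 1 ≤ d) (hks : k + s = n) (hdk : 2 * d ≤ k) (hds : d / a ≤ s) :
    HasNormalForms g d 10 (truncIdeal g (2 * d)) (restrictSupport ℝ (topMonomials n a (2 * d)))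
      (supportMean a (Finset.powersetCard k Finset.univ)) where
  le_W := le_rfl
  L_one := supportMean_one (powersetCard_univ_nonempty hks)
  L_mem h hh _ := map_eq_zero_of_mem_truncIdeal (hg.supportMean_mul_eq_zero (by omega)) hh
  L_bound m _ := (abs_supportMean_monomial_le m).trans (one_le_natCast_pow (by omega) _)
  red p hp := hg.exists_sq_sub_sq_mem hn ha hks (by omega) hds hp
  nf m hm := by
    obtain ⟨ν, h1, h2⟩ := hg.exists_normalForm hdk (by omega) hm
    exact ⟨ν, h1, h2.mem, (h2.mono le_rfl (two_mul_add_pow_le hn hd le_rfl)).twoSidedBound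
      (by positivity)⟩
  indep ν hν hmem := hg.eq_zero_of_mem_truncIdeal (by omega) (by omega) hdk hν hmem
  bd α hα := isSoSMod_natPow_sub_monomial le_rfl (by omega) (by norm_num)
    (hg.isSoSMod_X_sq ha (by omega)) hα

end Slice

end SoSBound

/-! ### Boolean slices on which high-degree squarefree monomials vanish. -/

namespace SoSBound

variable {n : ℕ}

/-- The indicator vector of a set. -/
def point (z : Finset (Fin n)) : Fin n → ℝ := fun i => if i ∈ z then 1 else 0

theorem eval_point_monomial (z : Finset (Fin n)) (m : Fin n →₀ ℕ) (c : ℝ) :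
    eval (point z) (monomial m c) = if m.support ⊆ z then c else 0 := by
  rw [eval_monomial, Finsupp.prod]
  split_ifs with h
  · rw [Finset.prod_eq_one, mul_one]
    intro i hi
    rw [point, if_pos (h hi), one_pow]
  · rw [Finset.not_subset] at h
    obtain ⟨i, hi, hiz⟩ := h
    rw [Finset.prod_eq_zero hi, mul_zero]
    rw [point, if_neg hiz, zero_pow (Finsupp.mem_support_iff.1 hi)]

theorem eval_point_eq_sum (z : Finset (Fin n)) (p : MvPolynomial (Fin n) ℝ) :
    eval (point z) p = ∑ m ∈ p.support, if m.support ⊆ z then coeff m p else 0 := by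
  conv_lhs => rw [p.as_sum, map_sum]
  exact Finset.sum_congr rfl fun m _ => eval_point_monomial z m _

/-- For `a = 1` the functional is a genuine average over points, so it kills every polynomial
vanishing on them. This permits `W` to be a full vanishing space. -/
theorem supportMean_one_eq (𝒵 : Finset (Finset (Fin n))) (p : MvPolynomial (Fin n) ℝ) :
    supportMean 1 𝒵 p = (∑ z ∈ 𝒵, eval (point z) p) / 𝒵.card := by
  simp only [eval_point_eq_sum]
  conv_lhs => rw [p.as_sum, map_sum]
  rw [Finset.sum_comm, Finset.sum_div]
  refine Finset.sum_congr rfl fun m _ => ?_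
  rw [supportMean_monomial, supportMoment_of_dvd fun i => one_dvd _, ← Finset.sum_filter,
    Finset.sum_const, nsmul_eq_mul]
  ring

theorem sq_eval_le_supportMean_sq {𝒵 : Finset (Finset (Fin n))} {z : Finset (Fin n)} (hz : z ∈ 𝒵)
    (p : MvPolynomial (Fin n) ℝ) : eval (point z) p ^ 2 ≤ 𝒵.card * supportMean 1 𝒵 (p ^ 2) := by
  have h0 : ((𝒵.card : ℕ) : ℝ) ≠ 0 := Nat.cast_ne_zero.2 (Finset.card_ne_zero_of_mem hz)
  rw [supportMean_one_eq, mul_div_cancel₀ _ h0]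
  simp only [map_pow]
  exact Finset.single_le_sum (f := fun z => eval (point z) p ^ 2) (fun _ _ => sq_nonneg _) hz

/-- The exponent vector of the squarefree monomial with support `U`. -/
noncomputable def sqfree (U : Finset (Fin n)) : Fin n →₀ ℕ :=
  Finsupp.equivFunOnFinite.symm fun i => if i ∈ U then 1 else 0

theorem sqfree_apply (U : Finset (Fin n)) (i : Fin n) : sqfree U i = if i ∈ U then 1 else 0 := rfl

theorem sqfree_le_one (U : Finset (Fin n)) (i : Fin n) : sqfree U i ≤ 1 := by
  rw [sqfree_apply]
  split_ifs <;> omega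

theorem support_sqfree (U : Finset (Fin n)) : (sqfree U).support = U := by
  ext i
  simp [sqfree_apply]

theorem degree_sqfree (U : Finset (Fin n)) : (sqfree U).degree = U.card := by
  rw [Finsupp.degree_eq_sum]
  simp [sqfree_apply]

theorem eq_sqfree_support {m : Fin n →₀ ℕ} (hm : ∀ i, m i ≤ 1) : m = sqfree m.support := by
  ext i
  have := hm i
  rw [sqfree_apply]
  simp only [Finsupp.mem_support_iff]
  split_ifs <;> omega

theorem eq_of_support_eq {m m' : Fin n →₀ ℕ} (hm : ∀ i, m i ≤ 1) (hm' : ∀ i, m' i ≤ 1)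
    (h : m.support = m'.support) : m = m' := by
  rw [eq_sqfree_support hm, eq_sqfree_support hm', h]

theorem sqfree_add_single {U : Finset (Fin n)} {i : Fin n} (hi : i ∉ U) :
    sqfree U + Finsupp.single i 1 = sqfree (insert i U) := by
  ext l
  by_cases hl : l = i
  · subst hl
    simp [sqfree_apply, hi]
  · simp [sqfree_apply, hl]

/-- Reindexing of incidences: `(U, i)` with `i ∉ U` corresponds to `(U ∪ {i}, i)`. -/
theorem sum_powersetCard_compl {M : Type*} [AddCommMonoid M] (k : ℕ)
    (F : Finset (Fin n) → Fin n → M) :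
    ∑ U ∈ Finset.powersetCard k (Finset.univ : Finset (Fin n)), ∑ i ∈ Uᶜ, F U i =
      ∑ V ∈ Finset.powersetCard (k + 1) (Finset.univ : Finset (Fin n)),
        ∑ i ∈ V, F (V.erase i) i := by
  rw [Finset.sum_sigma', Finset.sum_sigma']
  refine Finset.sum_bij' (fun x _ => ⟨insert x.2 x.1, x.2⟩) (fun x _ => ⟨x.1.erase x.2, x.2⟩)
    ?_ ?_ ?_ ?_ ?_
  · rintro ⟨U, i⟩ h
    simp only [Finset.mem_sigma, Finset.mem_powersetCard, Finset.subset_univ, true_and,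
      Finset.mem_compl] at h ⊢
    exact ⟨by rw [Finset.card_insert_of_notMem h.2, h.1], Finset.mem_insert_self _ _⟩
  · rintro ⟨V, i⟩ h
    simp only [Finset.mem_sigma, Finset.mem_powersetCard, Finset.subset_univ, true_and,
      Finset.mem_compl] at h ⊢
    exact ⟨by rw [Finset.card_erase_of_mem h.2, h.1, Nat.add_sub_cancel], Finset.notMem_erase _ _⟩
  · rintro ⟨U, i⟩ h
    simp only [Finset.mem_sigma, Finset.mem_compl] at h
    simp [Finset.erase_insert h.2]
  · rintro ⟨V, i⟩ h
    simp only [Finset.mem_sigma] at h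
    simp [Finset.insert_erase h.2]
  · rintro ⟨U, i⟩ h
    simp only [Finset.mem_sigma, Finset.mem_compl] at h
    simp [Finset.erase_insert h.2]

section Slice

variable {ι : Type} [Fintype ι] {g : ι → MvPolynomial (Fin n) ℝ} {k : ℕ}

theorem IdealBound.monomial_mul {e : ℕ} {h : MvPolynomial (Fin n) ℝ} {B : ℝ}
    (H : IdealBound g e h B) (m : Fin n →₀ ℕ) :
    IdealBound g (m.degree + e) (monomial m 1 * h) B := by
  obtain ⟨q, h1, h2, rfl⟩ := H
  refine ⟨fun j => monomial m 1 * q j, fun j => ?_, fun j m' => ?_, ?_⟩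
  · rw [mul_assoc]
    exact totalDegree_mul_le (totalDegree_monomial_le_degree m 1) (h1 j)
  · rw [coeff_monomial_mul']
    split_ifs
    · rw [one_mul]
      exact h2 j _
    · rw [abs_zero]
      exact (abs_nonneg _).trans (h2 j 0)
  · rw [Finset.mul_sum]
    exact Finset.sum_congr rfl fun j _ => by rw [mul_assoc]

/-- Combinations of the products of the squarefree monomials of degree `k` with `∑ X i - k`. -/
theorem IsSliceSystem.idealBound_combination (hg : IsSliceSystem 1 k g)
    {ε : Finset (Fin n) → ℝ} (hε : ∀ U, |ε U| ≤ 1) :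
    IdealBound g (k + 1) (∑ V ∈ Finset.powersetCard (k + 1) (Finset.univ : Finset (Fin n)),
      (∑ i ∈ V, ε (V.erase i)) • monomial (sqfree V) 1) (((n : ℝ) + 1) ^ (k + 1)) := by
  -- For `|U| = k` the terms `i ∈ U` of `x^U ∑ xᵢ` reduce to `k x^U` and cancel the constant
  -- exactly, leaving only squarefree monomials of degree `k + 1`.
  have hterm : ∀ U ∈ Finset.powersetCard k (Finset.univ : Finset (Fin n)),
      IdealBound g (k + 1) (ε U • ∑ i ∈ Uᶜ, monomial (sqfree (insert i U)) 1) (n + 1) := by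
    intro U hU
    have hUk : U.card = k := (Finset.mem_powersetCard.1 hU).2
    obtain ⟨j, hj⟩ := hg.sum
    have h1 : IdealBound g (k + 1) (monomial (sqfree U) 1 * g j) 1 := by
      refine IdealBound.mul_generator j ?_ fun m' => by simpa using abs_coeff_monomial_le m' _ 1
      rw [hj]
      exact totalDegree_mul_le ((totalDegree_monomial_le_degree _ 1).trans
        (degree_sqfree U ▸ hUk.le)) (totalDegree_sum_X_pow_sub_le 1 k)
    have h2 : IdealBound g (k + 1) (∑ i ∈ U,
        (monomial (sqfree U + Finsupp.single i 1) 1 - monomial (sqfree U) 1)) (∑ i ∈ U, 1) :=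
      IdealBound.sum _ fun i hi => IdealBound.lower_exponent hg.pow (by simp [sqfree_apply, hi])
        (by rw [degree_sqfree, hUk])
    have h3 := (h1.add (h2.smul (-1))).smul (ε U)
    convert h3.mono le_rfl ?_ using 1
    · congr 1
      rw [hj, mul_sub, Finset.mul_sum, mul_comm _ (C (k : ℝ)), Finset.sum_sub_distrib,
        Finset.sum_const, ← Finset.sum_add_sum_compl U
          (fun i => monomial (sqfree U) (1 : ℝ) * X i ^ 1)]
      simp only [monomial_mul_X_pow]
      rw [← smul_eq_C_mul, ← Nat.cast_smul_eq_nsmul ℝ, hUk]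
      have h4 : ∑ i ∈ Uᶜ, monomial (sqfree U + Finsupp.single i 1) (1 : ℝ) =
          ∑ i ∈ Uᶜ, monomial (sqfree (insert i U)) 1 :=
        Finset.sum_congr rfl fun i hi => by rw [sqfree_add_single (Finset.mem_compl.1 hi)]
      rw [h4]
      module
    · have hn : (U.card : ℝ) ≤ n := by
        have := U.card_le_univ
        rw [Fintype.card_fin] at this
        exact_mod_cast this
      rw [Finset.sum_const, nsmul_eq_mul, mul_one, abs_neg, abs_one, one_mul]
      calc |ε U| * (1 + U.card) ≤ 1 * (1 + n) := by
            gcongr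
            exact hε U
        _ = n + 1 := by ring
  have hsum := IdealBound.sum _ hterm
  have hexp : ∑ U ∈ Finset.powersetCard k (Finset.univ : Finset (Fin n)),
      ε U • ∑ i ∈ Uᶜ, monomial (sqfree (insert i U)) (1 : ℝ) =
      ∑ V ∈ Finset.powersetCard (k + 1) (Finset.univ : Finset (Fin n)),
        (∑ i ∈ V, ε (V.erase i)) • monomial (sqfree V) 1 := by
    simp only [Finset.smul_sum]
    rw [sum_powersetCard_compl k (fun U i => ε U • monomial (sqfree (insert i U)) (1 : ℝ))]
    refine Finset.sum_congr rfl fun V _ => ?_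
    rw [Finset.sum_smul]
    exact Finset.sum_congr rfl fun i hi => by rw [Finset.insert_erase hi]
  rw [hexp] at hsum
  refine hsum.mono le_rfl ?_
  rw [Finset.sum_const, nsmul_eq_mul, Finset.card_powersetCard, Finset.card_univ, Fintype.card_fin,
    pow_succ]
  have h1 : (n.choose k : ℝ) ≤ ((n : ℝ) + 1) ^ k := by
    calc (n.choose k : ℝ) ≤ (n : ℝ) ^ k := by exact_mod_cast Nat.choose_le_pow n k
      _ ≤ ((n : ℝ) + 1) ^ k := by gcongr; linarith
  gcongr

theorem IsSliceSystem.idealBound_sub (hg : IsSliceSystem 1 k g) {m m' : Fin n →₀ ℕ}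
    (hm' : ∀ i, m' i ≤ 1) (h : m.support = m'.support) {e : ℕ} (he : m.degree ≤ e) :
    IdealBound g e (monomial m 1 - monomial m' 1) e := by
  obtain ⟨m'', h1, h2, -, h4⟩ := exists_reduced_monomial le_rfl hg.pow m he
  rw [eq_of_support_eq h1 hm' (h2.trans h)] at h4
  exact h4.mono le_rfl (by exact_mod_cast he)

/-- The weights `ε_b = (-1)^(k-b) / ((k+1) C(k, b))` solve the recursion `b ε_{b-1} + (k + 1 - b)
ε_b = 0`, which says that a `(k+1)`-set meeting `S` in `b` points receives coefficient zero. -/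
theorem coeff_alternating {k b : ℕ} (hb1 : 1 ≤ b) (hbk : b ≤ k) :
    (b : ℝ) * ((-1) ^ (k - (b - 1)) / ((k + 1) * (k.choose (b - 1)))) +
      ((k : ℝ) + 1 - b) * ((-1) ^ (k - b) / ((k + 1) * (k.choose b))) = 0 := by
  obtain ⟨b, rfl⟩ : ∃ b', b = b' + 1 := ⟨b - 1, by omega⟩
  rw [Nat.add_sub_cancel]
  have h1 : k - b = k - (b + 1) + 1 := by omega
  have h2 := Nat.choose_succ_right_eq k b
  have h3 : ((k.choose (b + 1) : ℕ) : ℝ) * (b + 1) = k.choose b * (k - b) := by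
    have : ((k - b : ℕ) : ℝ) = k - b := by
      rw [Nat.cast_sub (by omega)]
    rw [← this]
    exact_mod_cast h2
  have h4 : (0 : ℝ) < k.choose b := by exact_mod_cast Nat.choose_pos (by omega)
  have h5 : (0 : ℝ) < k.choose (b + 1) := by exact_mod_cast Nat.choose_pos hbk
  have h6 : (0 : ℝ) < (k : ℝ) + 1 := by positivity
  rw [h1, pow_succ]
  push_cast
  field_simp
  linear_combination (-(-1 : ℝ) ^ (k - (b + 1))) * h3

theorem mul_two_add_one_le_three_pow (j : ℕ) : j * 2 + 1 ≤ 3 ^ j := by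
  induction j with
  | zero => simp
  | succ j ih =>
    rw [pow_succ]
    omega

/-- On the middle slice, the squarefree monomials of degree `k + 1` lie in the ideal. -/
theorem IsSliceSystem.idealBound_middle (hg : IsSliceSystem 1 k g) (hk : n = 2 * k)
    {S : Finset (Fin n)} (hS : S.card = k + 1) :
    IdealBound g (k + 1) (monomial (sqfree S) 1) (((n : ℝ) + 1) ^ (k + 1)) := by
  -- The weight of `U` depends only on `|U ∩ S|`. It is normalized so that `S` itself receives
  -- coefficient `(k + 1) ε_k = 1`.
  let ε : Finset (Fin n) → ℝ := fun U =>
    (-1) ^ (k - (U ∩ S).card) / ((k + 1) * k.choose (U ∩ S).card)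
  have hε : ∀ U, |ε U| ≤ 1 := by
    intro U
    simp only [ε]
    rw [abs_div, abs_pow, abs_neg, abs_one, one_pow, abs_of_nonneg (by positivity)]
    rcases Nat.eq_zero_or_pos (k.choose (U ∩ S).card) with h | h
    · simp [h]
    · refine div_le_one_of_le₀ ?_ (by positivity)
      have h' : (1 : ℝ) ≤ k.choose (U ∩ S).card := by exact_mod_cast h
      have h'' : (1 : ℝ) ≤ (k : ℝ) + 1 := by linarith [k.cast_nonneg (α := ℝ)]
      nlinarith
  have hcomb := hg.idealBound_combination hε
  convert hcomb using 1
  have hmemS : S ∈ Finset.powersetCard (k + 1) (Finset.univ : Finset (Fin n)) :=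
    Finset.mem_powersetCard.2 ⟨Finset.subset_univ _, hS⟩
  have hval : ∀ V ∈ Finset.powersetCard (k + 1) (Finset.univ : Finset (Fin n)),
      ∑ i ∈ V, ε (V.erase i) = (V ∩ S).card *
        ((-1) ^ (k - ((V ∩ S).card - 1)) / ((k + 1) * (k.choose ((V ∩ S).card - 1)))) +
        ((k : ℝ) + 1 - (V ∩ S).card) *
          ((-1) ^ (k - (V ∩ S).card) / ((k + 1) * (k.choose (V ∩ S).card))) := by
    intro V hV
    have hVk : V.card = k + 1 := (Finset.mem_powersetCard.1 hV).2
    rw [← Finset.sum_inter_add_sum_sdiff V S]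
    have e1 : ∀ i ∈ V ∩ S, ε (V.erase i) =
        (-1) ^ (k - ((V ∩ S).card - 1)) / ((k + 1) * (k.choose ((V ∩ S).card - 1))) := by
      intro i hi
      simp only [ε]
      rw [Finset.erase_inter, Finset.card_erase_of_mem hi]
    have e2 : ∀ i ∈ V \ S, ε (V.erase i) =
        (-1) ^ (k - (V ∩ S).card) / ((k + 1) * (k.choose (V ∩ S).card)) := by
      intro i hi
      simp only [ε]
      have : i ∉ V ∩ S := fun h => (Finset.mem_sdiff.1 hi).2 (Finset.mem_inter.1 h).2
      rw [Finset.erase_inter, Finset.erase_eq_of_notMem this]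
    rw [Finset.sum_congr rfl e1, Finset.sum_congr rfl e2, Finset.sum_const, Finset.sum_const,
      nsmul_eq_mul, nsmul_eq_mul]
    congr 2
    have := Finset.card_inter_add_card_sdiff V S
    rw [hVk] at this
    have : (((V ∩ S).card + (V \ S).card : ℕ) : ℝ) = (k + 1 : ℕ) := by exact_mod_cast this
    push_cast at this
    linarith
  rw [Finset.sum_eq_single S]
  · rw [hval S hmemS, Finset.inter_self, hS, Nat.add_sub_cancel]
    have : ((k : ℝ) + 1) ≠ 0 := by positivity
    simp [this]
  · intro V hV hne
    have hVk : V.card = k + 1 := (Finset.mem_powersetCard.1 hV).2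
    have h1 : (V ∩ S).card ≤ k := by
      by_contra hlt
      push Not at hlt
      have e1 : V ∩ S = V := Finset.eq_of_subset_of_card_le Finset.inter_subset_left (by omega)
      have e2 : V ∩ S = S := Finset.eq_of_subset_of_card_le Finset.inter_subset_right (by omega)
      exact hne (e1.symm.trans e2)
    -- Two `(k+1)`-sets among `2k` points intersect. This is where `n = 2k` enters; the recursion
    -- says nothing about `b = 0`.
    have h2 : 1 ≤ (V ∩ S).card := by
      have e1 := Finset.card_union_add_card_inter V S
      have e2 := (V ∪ S).card_le_univ
      rw [Fintype.card_fin] at e2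
      omega
    rw [hval V hV, coeff_alternating h2 h1, zero_smul]
  · intro h
    exact absurd hmemS h

/-- Such a monomial is a multiple of a squarefree one of degree exactly `k + 1`, which already lies
in the ideal. -/
theorem IsSliceSystem.twoSidedBound_middle (hg : IsSliceSystem 1 k g) (hk : n = 2 * k) {d : ℕ}
    {m : Fin n →₀ ℕ} (hm : ∀ i, m i ≤ 1) (hkm : k < m.degree) (hmd : m.degree ≤ 2 * d) :
    TwoSidedBound g d (monomial m 1) (((n : ℝ) + 1) ^ (4 * d)) := by
  obtain ⟨m₁, hle, hm₁⟩ := Finsupp.exists_le_degree_eq m (k + 1) hkm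
  obtain ⟨m₂, rfl⟩ := exists_add_of_le hle
  have h1 : ∀ i, m₁ i ≤ 1 := fun i => le_trans (by simp) (hm i)
  have hcard : m₁.support.card = k + 1 := by
    rw [← degree_sqfree, ← eq_sqfree_support h1, hm₁]
  have h2 := (hg.idealBound_middle hk hcard).monomial_mul m₂
  rw [← eq_sqfree_support h1, monomial_mul, one_mul, add_comm m₂ m₁] at h2
  rw [map_add] at hmd
  refine (h2.mono (e' := 2 * d) (by omega) (pow_le_pow_right₀ ?_ ?_)).twoSidedBound (by positivity)
  · linarith [n.cast_nonneg (α := ℝ)]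
  · omega

/-- The elementary symmetric polynomial of degree `k + 1` lies in the ideal, so `-x^V` is congruent
to the sum of the other `x^U`, each congruent to its own square. The condition `k < d` keeps these
squares within degree `2d`. -/
theorem IsSliceSystem.certBound_neg_sq (hg : IsSliceSystem 1 k g) (hn : 2 ≤ n) {d : ℕ}
    (hkd : k < d) {V : Finset (Fin n)} (hV : V.card = k + 1) :
    CertBound g d (-monomial (sqfree V) 1 ^ 2) ((((n : ℝ) + 1) ^ d) ^ 3) := by
  have hn2 : (2 : ℝ) ≤ n := by exact_mod_cast hn
  have hY : ((k + 1 : ℕ) : ℝ) * 2 + 1 ≤ ((n : ℝ) + 1) ^ d := by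
    have h1 := mul_two_add_one_le_three_pow (k + 1)
    calc ((k + 1 : ℕ) : ℝ) * 2 + 1 ≤ 3 ^ (k + 1) := by exact_mod_cast h1
      _ ≤ ((n : ℝ) + 1) ^ (k + 1) := by gcongr; linarith
      _ ≤ ((n : ℝ) + 1) ^ d := pow_le_pow_right₀ (by linarith) hkd
  have hpow : ((n : ℝ) + 1) ^ (k + 1) ≤ ((n : ℝ) + 1) ^ d := pow_le_pow_right₀ (by linarith) hkd
  have hmemV : V ∈ Finset.powersetCard (k + 1) (Finset.univ : Finset (Fin n)) :=
    Finset.mem_powersetCard.2 ⟨Finset.subset_univ _, hV⟩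
  -- the elementary symmetric polynomial of degree `k + 1`
  have he := hg.idealBound_combination (ε := fun _ => ((k : ℝ) + 1)⁻¹) fun _ => by
    rw [abs_of_nonneg (by positivity)]
    exact inv_le_one_of_one_le₀ (by linarith [k.cast_nonneg (α := ℝ)])
  have he' : ∑ V ∈ Finset.powersetCard (k + 1) (Finset.univ : Finset (Fin n)),
      (∑ _i ∈ V, ((k : ℝ) + 1)⁻¹) • monomial (sqfree V) (1 : ℝ) =
      ∑ V ∈ Finset.powersetCard (k + 1) (Finset.univ : Finset (Fin n)),
        monomial (sqfree V) (1 : ℝ) := by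
    refine Finset.sum_congr rfl fun V hV => ?_
    rw [Finset.sum_const, nsmul_eq_mul, (Finset.mem_powersetCard.1 hV).2]
    have : ((k : ℝ) + 1) ≠ 0 := by positivity
    push_cast
    rw [mul_inv_cancel₀ this, one_smul]
  rw [he'] at he
  have he2 := ((he.smul (-1)).mono (e' := 2 * d) (by omega) le_rfl).certBound (by positivity)
  have hsub : ∀ U ∈ Finset.powersetCard (k + 1) (Finset.univ : Finset (Fin n)),
      IdealBound g (2 * d) (monomial (sqfree U) 1 ^ 2 - monomial (sqfree U) 1)
        ((k + 1 : ℕ) * 2) := by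
    intro U hU
    rw [pow_two, monomial_mul, one_mul]
    have := hg.idealBound_sub (m := sqfree U + sqfree U) (m' := sqfree U) (sqfree_le_one U)
      (by ext i; simp) (e := (k + 1) * 2)
      (by rw [map_add, degree_sqfree, (Finset.mem_powersetCard.1 hU).2]; omega)
    have := this.mono (e' := 2 * d) (by omega) le_rfl
    push_cast at this ⊢
    exact this
  have hother : CertBound g d
      (∑ U ∈ (Finset.powersetCard (k + 1) (Finset.univ : Finset (Fin n))).erase V,
        monomial (sqfree U) 1)
      (∑ U ∈ (Finset.powersetCard (k + 1) (Finset.univ : Finset (Fin n))).erase V,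
        (((k + 1 : ℕ) : ℝ) * 2 + 1)) := by
    refine CertBound.sum _ fun U hU => ?_
    have hU' := Finset.mem_of_mem_erase hU
    have h1 := ((hsub U hU').twoSidedBound (by positivity)).2
    have h2 : CertBound g d ((monomial (sqfree U) (1 : ℝ)) ^ 2) (1 ^ 2) := by
      refine CertBound.sq ((totalDegree_monomial_le_degree _ _).trans ?_) fun m => by
        simpa using abs_coeff_monomial_le m (sqfree U) 1
      rw [degree_sqfree, (Finset.mem_powersetCard.1 hU').2]
      omega
    convert h1.add h2 using 1
    · ring
    · norm_num
  have h3 := ((hsub V hmemV).twoSidedBound (by positivity)).2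
  convert ((he2.add hother).add h3).mono ?_ using 1
  · rw [← Finset.add_sum_erase _ _ hmemV]
    module
  · rw [Finset.sum_const, nsmul_eq_mul, abs_neg, abs_one, one_mul]
    have hcard : (((Finset.powersetCard (k + 1) (Finset.univ : Finset (Fin n))).erase V).card : ℝ) ≤
        ((n : ℝ) + 1) ^ d := by
      refine le_trans ?_ hpow
      calc (((Finset.powersetCard (k + 1) (Finset.univ : Finset (Fin n))).erase V).card : ℝ)
          ≤ (Finset.powersetCard (k + 1) (Finset.univ : Finset (Fin n))).card := by
            exact_mod_cast Finset.card_erase_le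
        _ ≤ (n : ℝ) ^ (k + 1) := by
            rw [Finset.card_powersetCard, Finset.card_univ, Fintype.card_fin]
            exact_mod_cast Nat.choose_le_pow n (k + 1)
        _ ≤ ((n : ℝ) + 1) ^ (k + 1) := by gcongr; linarith
    have hY3 : (3 : ℝ) ≤ ((n : ℝ) + 1) ^ d := by
      refine le_trans ?_ hY
      push_cast
      linarith [k.cast_nonneg (α := ℝ)]
    have hD0 : (0 : ℝ) ≤ ((k + 1 : ℕ) : ℝ) * 2 := by positivity
    generalize ((n : ℝ) + 1) ^ d = Y at *
    generalize ((n : ℝ) + 1) ^ (k + 1) = Z at *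
    generalize (((k + 1 : ℕ) : ℝ)) * 2 = D at *
    generalize (((Finset.powersetCard (k + 1) (Finset.univ : Finset (Fin n))).erase V).card : ℝ) = c at *
    have hY0 : 0 ≤ Y := by linarith
    have h5 : c * (D + 1) ≤ Y * Y := mul_le_mul hcard hY (by linarith) hY0
    nlinarith [mul_nonneg hY0 hY0]

/-- For a divisor `m₁` of `m` of degree `k + 1`, `-m² = (m₁ - m)² - m₁² + 2 (m₁ m - m) - 2 (m² -
m)`, where the last two terms lie in the ideal because the factors have equal supports after
reduction. -/
theorem IsSliceSystem.certBound_neg_sq_of_degree (hg : IsSliceSystem 1 k g) (hn : 2 ≤ n) {d : ℕ}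
    {m : Fin n →₀ ℕ} (hm : ∀ i, m i ≤ 1) (hkm : k < m.degree) (hmd : m.degree ≤ d) :
    CertBound g d (-monomial m 1 ^ 2) (4 + 8 * d + (((n : ℝ) + 1) ^ d) ^ 3) := by
  obtain ⟨m₁, hle, hm₁⟩ := Finsupp.exists_le_degree_eq m (k + 1) hkm
  have h1 : ∀ i, m₁ i ≤ 1 := fun i => (hle i).trans (hm i)
  have hcard : m₁.support.card = k + 1 := by
    rw [← degree_sqfree, ← eq_sqfree_support h1, hm₁]
  have h2 := hg.certBound_neg_sq hn (d := d) (by omega) hcard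
  rw [← eq_sqfree_support h1] at h2
  have hsupp : m₁.support ⊆ m.support := Finsupp.support_mono hle
  have h3 : CertBound g d ((monomial m₁ (1 : ℝ) - monomial m 1) ^ 2) (2 ^ 2) := by
    refine CertBound.sq (totalDegree_sub_le ((totalDegree_monomial_le_degree _ _).trans (by omega))
      ((totalDegree_monomial_le_degree _ _).trans hmd)) fun m' => ?_
    rw [coeff_sub]
    have e1 := abs_coeff_monomial_le m' m₁ 1
    have e2 := abs_coeff_monomial_le m' m 1
    rw [abs_one] at e1 e2
    linarith [abs_sub (coeff m' (monomial m₁ (1 : ℝ))) (coeff m' (monomial m 1))]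
  have h4 := (hg.idealBound_sub (m := m₁ + m) (m' := m) hm (by
    ext i
    have := @hsupp i
    simp only [Finsupp.mem_support_iff, Finsupp.add_apply] at this ⊢
    omega) (e := 2 * d) (by rw [map_add]; omega)).smul 2
  have h5 := (hg.idealBound_sub (m := m + m) (m' := m) hm (by ext i; simp) (e := 2 * d)
    (by rw [map_add]; omega)).smul (-2)
  convert ((h3.add ((h4.add h5).certBound (by positivity))).add h2).mono ?_ using 1
  · rw [pow_two (monomial m (1 : ℝ)), monomial_mul, pow_two (monomial m₁ (1 : ℝ)), monomial_mul]
    have : (monomial m₁ (1 : ℝ) - monomial m 1) ^ 2 =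
        monomial (m₁ + m₁) 1 - (2 : ℝ) • monomial (m₁ + m) 1 + monomial (m + m) 1 := by
      have e1 : (monomial m₁ (1 : ℝ) - monomial m 1) ^ 2 = monomial m₁ (1 : ℝ) * monomial m₁ 1 -
          (2 : ℝ) • (monomial m₁ (1 : ℝ) * monomial m 1) + monomial m 1 * monomial m 1 := by
        rw [smul_eq_C_mul, map_ofNat]
        ring
      rw [e1, monomial_mul, monomial_mul, monomial_mul, mul_one]
    rw [this, mul_one]
    module
  · norm_num
    linarith

/-- Write `m` modulo the ideal as a product `αβ` of two squarefree monomials whose degrees lie above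
`k` and do not exceed `d`. Then `c αβ = ½ ((α + cβ)² - α² - β²)`, and both negative squares are
certified. Overlapping factors are harmless since `xᵢ² = xᵢ`. -/
theorem IsSliceSystem.certBound_monomial (hg : IsSliceSystem 1 k g) (hn : 2 ≤ n) {d : ℕ}
    (hkd : k < d) {m : Fin n →₀ ℕ} (hm : ∀ i, m i ≤ 1) (hkm : k < m.degree)
    (hmd : m.degree ≤ 2 * d) {c : ℝ} (hc : c ^ 2 = 1) :
    CertBound g d (c • monomial m 1) (((n : ℝ) + 1) ^ (4 * d)) := by
  obtain ⟨α, hα, hαd⟩ := Finsupp.exists_le_degree_eq m (min d m.degree) (min_le_right _ _)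
  obtain ⟨δ, rfl⟩ := exists_add_of_le hα
  rw [map_add] at hkm hmd hαd
  -- The second factor `δ` may be too short, so it borrows variables of `α` to reach degree `k + 1`.
  -- The truncated subtraction makes `γ` zero when `δ` is already long enough.
  obtain ⟨γ, hγ, hγd⟩ := Finsupp.exists_le_degree_eq α (k + 1 - δ.degree) (by omega)
  have hα1 : ∀ i, α i ≤ 1 := fun i => (hα i).trans (hm i)
  have hβ1 : ∀ i, (δ + γ) i ≤ 1 := fun i => by
    have e1 := hm i
    have e2 := hγ i
    simp only [Finsupp.add_apply] at e1 ⊢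
    omega
  have hβd : (δ + γ).degree ≤ d := by
    rw [map_add]
    omega
  have hβk : k < (δ + γ).degree := by
    rw [map_add]
    omega
  have hc1 : |c| = 1 := by
    rw [← sq_eq_sq₀ (abs_nonneg c) zero_le_one, sq_abs, hc, one_pow]
  have h1 := (hg.certBound_neg_sq_of_degree hn (d := d) hα1 (by omega : k < α.degree) (by omega)).smul
    (show (0 : ℝ) ≤ 1 / 2 by norm_num)
  have h2 := (hg.certBound_neg_sq_of_degree hn hβ1 hβk hβd).smul
    (show (0 : ℝ) ≤ 1 / 2 by norm_num)
  have h3 : CertBound g d ((monomial α (1 : ℝ) + monomial (δ + γ) c) ^ 2) (2 ^ 2) := by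
    refine CertBound.sq (totalDegree_add_le ((totalDegree_monomial_le_degree _ _).trans (by omega))
      ((totalDegree_monomial_le_degree _ _).trans hβd)) fun m' => ?_
    rw [coeff_add]
    have e1 := abs_coeff_monomial_le m' α 1
    have e2 := abs_coeff_monomial_le m' (δ + γ) c
    rw [abs_one] at e1
    rw [hc1] at e2
    linarith [abs_add_le (coeff m' (monomial α (1 : ℝ))) (coeff m' (monomial (δ + γ) c))]
  have h4 := (hg.idealBound_sub (m := α + (δ + γ)) (m' := α + δ) hm (by
    ext i
    have := hγ i
    simp only [Finsupp.mem_support_iff, Finsupp.add_apply]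
    omega) (e := 2 * d) (by rw [map_add]; omega)).smul (-c)
  convert ((((h3.smul (show (0 : ℝ) ≤ 1 / 2 by norm_num)).add h1).add h2).add
    (h4.certBound (by positivity))).mono ?_ using 1
  · have e1 : (monomial α (1 : ℝ) + monomial (δ + γ) c) ^ 2 =
        monomial (α + α) 1 + (2 * c) • monomial (α + (δ + γ)) 1 +
          monomial (δ + γ + (δ + γ)) 1 := by
      have e2 : (monomial α (1 : ℝ) + monomial (δ + γ) c) ^ 2 = monomial α (1 : ℝ) * monomial α 1 +
          (2 : ℝ) • (monomial α (1 : ℝ) * monomial (δ + γ) c) +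
            monomial (δ + γ) c * monomial (δ + γ) c := by
        rw [smul_eq_C_mul, map_ofNat]
        ring
      rw [e2, monomial_mul, monomial_mul, monomial_mul, mul_one, one_mul, ← pow_two, hc,
        mul_smul, smul_monomial c, smul_eq_mul, mul_one]
    rw [e1, pow_two (monomial α (1 : ℝ)), monomial_mul, pow_two (monomial (δ + γ) (1 : ℝ)),
      monomial_mul, mul_one]
    module
  · rw [abs_neg, hc1]
    have hn2 : (2 : ℝ) ≤ n := by exact_mod_cast hn
    have hY : (d : ℝ) * 2 + 1 ≤ ((n : ℝ) + 1) ^ d := by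
      have h1 := mul_two_add_one_le_three_pow d
      calc (d : ℝ) * 2 + 1 ≤ 3 ^ d := by exact_mod_cast h1
        _ ≤ ((n : ℝ) + 1) ^ d := by gcongr; linarith
    have hd1 : (1 : ℝ) ≤ d := by exact_mod_cast (by omega : 1 ≤ d)
    have h44 : ((n : ℝ) + 1) ^ (4 * d) = (((n : ℝ) + 1) ^ d) ^ 4 := by
      rw [← pow_mul]
      congr 1
      ring
    rw [h44]
    push_cast
    generalize ((n : ℝ) + 1) ^ d = Y at *
    have hY3 : 3 ≤ Y := by linarith
    have hY2 : 9 ≤ Y ^ 2 := by nlinarith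
    have hY33 : 9 * Y ≤ Y ^ 3 := by nlinarith
    have hY43 : 3 * Y ^ 3 ≤ Y ^ 4 := by
      have : 0 ≤ Y ^ 3 := by positivity
      nlinarith
    linarith

theorem IsSliceSystem.twoSidedBound_small (hg : IsSliceSystem 1 k g) (hn : 2 ≤ n) {d : ℕ}
    (hkd : k < d) {m : Fin n →₀ ℕ} (hm : ∀ i, m i ≤ 1) (hkm : k < m.degree)
    (hmd : m.degree ≤ 2 * d) : TwoSidedBound g d (monomial m 1) (((n : ℝ) + 1) ^ (4 * d)) := by
  refine ⟨?_, ?_⟩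
  · simpa using hg.certBound_monomial hn hkd hm hkm hmd (c := 1) (by norm_num)
  · simpa using hg.certBound_monomial hn hkd hm hkm hmd (c := -1) (by norm_num)

/-- The polynomials vanishing at the indicator vectors of the `k`-sets. -/
noncomputable def sliceVanishing (n k : ℕ) : Submodule ℝ (MvPolynomial (Fin n) ℝ) where
  carrier := {h | ∀ z : Finset (Fin n), z.card = k → eval (point z) h = 0}
  zero_mem' := fun z _ => by simp
  add_mem' := fun ha hb z hz => by rw [map_add, ha z hz, hb z hz, add_zero]
  smul_mem' := fun c h hh z hz => by rw [smul_eval, hh z hz, mul_zero]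

theorem IsSliceSystem.truncIdeal_le (hg : IsSliceSystem 1 k g) (e : ℕ) :
    truncIdeal g e ≤ sliceVanishing n k := by
  rintro _ ⟨q, -, rfl⟩
  intro z hz
  rw [map_sum]
  refine Finset.sum_eq_zero fun j _ => ?_
  rw [map_mul]
  rcases hg.eq_or j with ⟨i, hi⟩ | hj
  · rw [hi]
    simp only [map_sub, map_pow, eval_X, point]
    split_ifs <;> simp
  · rw [hj]
    simp [point, hz]

/-- All supports involved have exactly `k` elements, so at the indicator of one of them no other
monomial survives. Coefficients are point values, which settles independence at once and bounds
coefficients when `k ≤ d`. -/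
theorem eval_point_support_of_mem {ν : MvPolynomial (Fin n) ℝ} {k : ℕ}
    (hν : ν ∈ restrictSupport ℝ (topMonomials n 1 k)) {m : Fin n →₀ ℕ}
    (hm : m ∈ topMonomials n 1 k) : eval (point m.support) ν = coeff m ν := by
  have hdeg : ∀ m' ∈ topMonomials n 1 k, m'.support.card = k := by
    rintro m' ⟨h1, h2, h3⟩
    rw [← degree_sqfree, ← eq_sqfree_support h1]
    omega
  rw [eval_point_eq_sum]
  have hterm : ∀ m' ∈ ν.support, (if m'.support ⊆ m.support then coeff m' ν else 0) =
      if m' = m then coeff m' ν else 0 := by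
    intro m' hm'
    refine if_congr ⟨fun h => ?_, fun h => h ▸ Finset.Subset.refl _⟩ rfl rfl
    refine eq_of_support_eq (hν hm').1 hm.1 (Finset.eq_of_subset_of_card_le h ?_)
    rw [hdeg m' (hν hm'), hdeg m hm]
  rw [Finset.sum_congr rfl hterm, Finset.sum_ite_eq']
  split_ifs with h
  · rfl
  · exact (notMem_support_iff.1 h).symm

theorem card_support_of_mem_topMonomials {m : Fin n →₀ ℕ} (hm : m ∈ topMonomials n 1 k) :
    m.support.card = k := by
  obtain ⟨h1, h2, h3⟩ := hm
  rw [← degree_sqfree, ← eq_sqfree_support h1]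
  omega

theorem eq_zero_of_mem_sliceVanishing {ν : MvPolynomial (Fin n) ℝ} {k : ℕ}
    (hν : ν ∈ restrictSupport ℝ (topMonomials n 1 k)) (h : ν ∈ sliceVanishing n k) : ν = 0 := by
  ext m
  rw [coeff_zero]
  by_contra hm
  have hmem := hν (mem_support_iff.2 hm)
  rw [← eval_point_support_of_mem hν hmem] at hm
  exact hm (h _ (card_support_of_mem_topMonomials hmem))

/-- Slices with `k ≤ 2 d` for which the squarefree monomials of degree above `k` are null. -/
theorem IsSliceSystem.hasNormalForms_of_null (hg : IsSliceSystem 1 k g) (hn : 2 ≤ n) {s d : ℕ}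
    (hd : 1 ≤ d) (hks : k + s = n) (hkd : k ≤ 2 * d) (hred : k ≤ d ∨ d ≤ s)
    (null : ∀ m : Fin n →₀ ℕ, (∀ i, m i ≤ 1) → k < m.degree → m.degree ≤ 2 * d →
      TwoSidedBound g d (monomial m 1) (((n : ℝ) + 1) ^ (4 * d))) :
    HasNormalForms g d 10 (sliceVanishing n k) (restrictSupport ℝ (topMonomials n 1 k))
      (supportMean 1 (Finset.powersetCard k Finset.univ)) := by
  have hW := hg.truncIdeal_le (2 * d)
  have hn1 : (1 : ℝ) ≤ n := by exact_mod_cast (by omega : 1 ≤ n)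
  have hnf : ∀ m : Fin n →₀ ℕ, m.degree ≤ 2 * d →
      ∃ ν ∈ restrictSupport ℝ (topMonomials n 1 k), monomial m 1 - ν ∈ sliceVanishing n k ∧
        TwoSidedBound g d (monomial m 1 - ν) ((n : ℝ) ^ (10 * d)) := by
    intro m hm
    have hB := two_mul_add_pow_le hn hd (le_refl (2 * d))
    have h4d : 2 * (2 * d) = 4 * d := by ring
    rw [h4d] at hB
    obtain ⟨m', h1, -, h3, h4⟩ := exists_reduced_monomial le_rfl hg.pow m hm
    have h4' := (h4.mono (B' := ((2 * d : ℕ) : ℝ)) le_rfl (by exact_mod_cast hm))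
    have h5 := h4'.twoSidedBound (by positivity)
    -- Up to degree `k` monomials are raised to degree exactly `k`, not `2d`. Above degree `k` they
    -- vanish on the slice, have normal form `0`, and are certified by `null`.
    rcases le_or_gt m'.degree k with hle | hlt
    · obtain ⟨ν, hν, hνb⟩ := exists_raised (g := g) (a := 1) le_rfl (fun m => ∀ i, m i ≤ 1) (e := k)
        (fun m hma hme => by
          refine ⟨m.supportᶜ, ((k : ℝ) - m.support.card)⁻¹, ?_, ?_,
            hg.idealBound_raise le_rfl le_rfl hme⟩
          · have hcard : m.support.card + 1 ≤ k := by
              have := card_support_le_degree m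
              omega
            have : ((m.support.card + 1 : ℕ) : ℝ) ≤ k := by exact_mod_cast hcard
            push_cast at this
            rw [abs_of_nonneg (inv_nonneg.2 (by linarith))]
            exact inv_le_one_of_one_le₀ (by linarith)
          · intro i hi l
            rw [Finset.mem_compl, Finsupp.notMem_support_iff] at hi
            by_cases hl : l = i
            · subst hl
              simp [hi]
            · simpa [Finsupp.add_apply, Finsupp.single_apply, Ne.symm hl] using hma l) m' h1 hle
      have h6 := (hνb.mono (e' := 2 * d) (B' := ((n : ℝ) + 1) ^ (4 * d)) hkd
        (pow_le_pow_right₀ (by linarith) (by omega))).twoSidedBound (by positivity)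
      refine ⟨ν, hν, ?_, ?_⟩
      · have := add_mem (hW h4.mem) (hg.truncIdeal_le k hνb.mem)
        rwa [sub_add_sub_cancel] at this
      · have := h5.add h6
        rw [sub_add_sub_cancel] at this
        exact this.mono hB
    · refine ⟨0, Submodule.zero_mem _, ?_, ?_⟩
      · rw [sub_zero]
        have h7 : monomial m' (1 : ℝ) ∈ sliceVanishing n k := by
          intro z hz
          rw [eval_point_monomial, if_neg]
          intro hsub
          have h8 := Finset.card_le_card hsub
          rw [← degree_sqfree, ← eq_sqfree_support h1] at h8
          omega
        have := add_mem (hW h4.mem) h7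
        rwa [sub_add_cancel] at this
      · rw [sub_zero]
        have := h5.add (null m' h1 hlt (h3.trans hm))
        rw [sub_add_cancel] at this
        exact this.mono hB
  refine ⟨hW, supportMean_one (powersetCard_univ_nonempty hks), ?_,
    fun m _ => (abs_supportMean_monomial_le m).trans (one_le_natCast_pow (by omega) _), ?_, hnf,
    fun ν hν hmem => eq_zero_of_mem_sliceVanishing hν hmem, fun α hα =>
      isSoSMod_natPow_sub_monomial hW (by omega) (by norm_num)
        (hg.isSoSMod_X_sq (Or.inl rfl) (by omega)) hα⟩
  · intro h hh _
    rw [supportMean_one_eq, Finset.sum_eq_zero, zero_div]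
    exact fun z hz => hh z (Finset.mem_powersetCard.1 hz).2
  · intro p hp
    -- If `k ≤ d`, the degree-`k` normal forms themselves fit the degree bound and their
    -- coefficients are point values. Otherwise `d < k`, the hypothesis `hred` gives `d ≤ s`, and
    -- the inclusion-matrix bound applies.
    rcases le_or_gt k d with hkd' | hdk
    · choose! ν hν hνW hνB using hnf
      set p' := ∑ m ∈ monomialsUpTo n d, coeff m p • ν m with hp'
      have hmd : ∀ m ∈ monomialsUpTo n d, m.degree ≤ 2 * d := fun m hm => by
        have := mem_monomialsUpTo_iff_degree.1 hm
        omega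
      have hp'N : p' ∈ restrictSupport ℝ (topMonomials n 1 k) :=
        Submodule.sum_mem _ fun m hm => Submodule.smul_mem _ _ (hν m (hmd m hm))
      have hsub : p - p' ∈ sliceVanishing n k := by
        have h0 : p - p' = ∑ m ∈ monomialsUpTo n d, coeff m p • (monomial m 1 - ν m) := by
          simp only [smul_sub, Finset.sum_sub_distrib, smul_monomial, smul_eq_mul, mul_one]
          rw [sum_monomial_coeff hp]
        rw [h0]
        exact Submodule.sum_mem _ fun m hm => Submodule.smul_mem _ _ (hνW m (hmd m hm))
      refine ⟨p', ?_, ?_, ?_⟩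
      · rw [totalDegree_le_iff_degree]
        intro m hm
        exact (hp'N (mem_support_iff.2 hm)).2.1.trans hkd'
      · intro z hz
        have := hsub z hz
        rw [map_sub, sub_eq_zero] at this
        simp [this]
      · have hL0 : 0 ≤ supportMean 1 (Finset.powersetCard k (Finset.univ : Finset (Fin n)))
            (p' ^ 2) := by
          rw [supportMean_one_eq]
          refine div_nonneg (Finset.sum_nonneg fun z _ => ?_) (Nat.cast_nonneg _)
          rw [map_pow]
          positivity
        intro m
        by_cases hm : coeff m p' = 0
        · rw [hm]
          simpa using mul_nonneg (pow_nonneg (by linarith) (10 * d)) hL0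
        · have hmem := hp'N (mem_support_iff.2 hm)
          rw [← eval_point_support_of_mem hp'N hmem]
          refine (sq_eval_le_supportMean_sq (Finset.mem_powersetCard.2
            ⟨Finset.subset_univ _, card_support_of_mem_topMonomials hmem⟩) p').trans ?_
          refine mul_le_mul_of_nonneg_right ?_ hL0
          rw [Finset.card_powersetCard, Finset.card_univ, Fintype.card_fin]
          calc (n.choose k : ℝ) ≤ (n : ℝ) ^ k := by exact_mod_cast Nat.choose_le_pow n k
            _ ≤ (n : ℝ) ^ (10 * d) := pow_le_pow_right₀ hn1 (by omega)
    · obtain ⟨p', h1, h2, h3⟩ := hg.exists_sq_sub_sq_mem hn (Or.inl rfl) hks hdk.le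
        (d := d) (by rw [Nat.div_one]; omega) hp
      exact ⟨p', h1, hW h2, h3⟩

end Slice

end SoSBound

/-! ### Flag complexes: the Boolean cube and cliques. -/

namespace SoSBound

variable {n : ℕ}

/-- Quantitative Möbius inversion: differencing in one element at a time removes it from the set and
doubles the bound. -/
theorem abs_le_of_abs_sum_powerset_le {α : Type*} [DecidableEq α] (U : Finset α) :
    ∀ {M : ℝ} {c : Finset α → ℝ}, (∀ z ⊆ U, |∑ V ∈ z.powerset, c V| ≤ M) →
      |c U| ≤ 2 ^ U.card * M := by
  induction U using Finset.induction_on with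
  | empty =>
    intro M c h
    simpa using h ∅ (Finset.Subset.refl _)
  | insert a U ha ih =>
    intro M c h
    have h1 := ih (M := 2 * M) (c := fun V => c (insert a V)) fun z hz => by
      have haz : a ∉ z := fun h => ha (hz h)
      have e1 := h (insert a z) (Finset.insert_subset_insert a hz)
      have e2 := h z (hz.trans (Finset.subset_insert a U))
      rw [Finset.sum_powerset_insert haz] at e1
      rw [abs_le] at e1 e2 ⊢
      constructor <;> linarith
    rw [Finset.card_insert_of_notMem ha, pow_succ, mul_assoc]
    exact h1

theorem eval_point_eq_sum_powerset {p : MvPolynomial (Fin n) ℝ}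
    (hp : ∀ m ∈ p.support, ∀ i, m i ≤ 1) (z : Finset (Fin n)) :
    eval (point z) p = ∑ V ∈ z.powerset, coeff (sqfree V) p := by
  classical
  have h1 : ∀ V, coeff (sqfree V) p = ∑ m ∈ p.support, if m.support = V then coeff m p else 0 := by
    intro V
    have : ∀ m ∈ p.support, (if m.support = V then coeff m p else 0) =
        if m = sqfree V then coeff m p else 0 := by
      intro m hm
      refine if_congr ⟨fun h => h ▸ eq_sqfree_support (hp m hm), fun h => ?_⟩ rfl rfl
      rw [h, support_sqfree]
    rw [Finset.sum_congr rfl this, Finset.sum_ite_eq']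
    split_ifs with h
    · rfl
    · exact notMem_support_iff.1 h
  rw [eval_point_eq_sum, Finset.sum_congr rfl fun V _ => h1 V, Finset.sum_comm]
  refine Finset.sum_congr rfl fun m _ => ?_
  rw [Finset.sum_ite_eq]
  simp only [Finset.mem_powerset]

/-- The polynomials vanishing at the indicator vectors of the members of `𝒞`. -/
noncomputable def pointVanishing (𝒞 : Set (Finset (Fin n))) :
    Submodule ℝ (MvPolynomial (Fin n) ℝ) where
  carrier := {h | ∀ z ∈ 𝒞, eval (point z) h = 0}
  zero_mem' := fun z _ => by simp
  add_mem' := fun ha hb z hz => by rw [map_add, ha z hz, hb z hz, add_zero]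
  smul_mem' := fun c h hh z hz => by rw [smul_eval, hh z hz, mul_zero]

/-- Equations for the indicator vectors of the faces of a flag simplicial complex. -/
structure IsFlagSystem {ι : Type} (𝒞 : Set (Finset (Fin n)))
    (g : ι → MvPolynomial (Fin n) ℝ) : Prop where
  empty : ∅ ∈ 𝒞
  lower : ∀ U V, U ⊆ V → V ∈ 𝒞 → U ∈ 𝒞
  pow : ∀ i, ∃ j, g j = X i ^ (1 + 1) - X i
  mul : ∀ V ∉ 𝒞, ∃ i ∈ V, ∃ l ∈ V, i ≠ l ∧ ∃ j, g j = X i * X l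
  vanish : ∀ z ∈ 𝒞, ∀ j, eval (point z) (g j) = 0

/-- The squarefree monomials of degree at most `e` supported on the members of `𝒞`. -/
def faceMonomials (𝒞 : Set (Finset (Fin n))) (e : ℕ) : Set (Fin n →₀ ℕ) :=
  {m | (∀ i, m i ≤ 1) ∧ m.support ∈ 𝒞 ∧ m.degree ≤ e}

section Flag

variable {ι : Type} [Fintype ι] {g : ι → MvPolynomial (Fin n) ℝ} {𝒞 : Set (Finset (Fin n))}

theorem IsFlagSystem.truncIdeal_le (hg : IsFlagSystem 𝒞 g) (e : ℕ) :
    truncIdeal g e ≤ pointVanishing 𝒞 := by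
  rintro _ ⟨q, -, rfl⟩
  intro z hz
  rw [map_sum]
  refine Finset.sum_eq_zero fun j _ => ?_
  rw [map_mul, hg.vanish z hz, mul_zero]

/-- After reduction the monomial is squarefree. If its support is not a face it contains a missing
edge, so it is a monomial multiple of a generator and rewrites to `0`. -/
theorem IsFlagSystem.exists_normalForm (hg : IsFlagSystem 𝒞 g) {e : ℕ} (m : Fin n →₀ ℕ)
    (hm : m.degree ≤ e) : ∃ ν ∈ restrictSupport ℝ (faceMonomials 𝒞 e),
      IdealBound g e (monomial m 1 - ν) (e + 1) := by
  obtain ⟨m', h1, -, h3, h4⟩ := exists_reduced_monomial le_rfl hg.pow m hm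
  have hme : (m.degree : ℝ) ≤ e := by exact_mod_cast hm
  by_cases hm' : m'.support ∈ 𝒞
  · refine ⟨monomial m' 1, ?_, h4.mono le_rfl (by linarith)⟩
    intro m'' hm''
    have := support_monomial_subset hm''
    rw [Finset.mem_singleton] at this
    rw [this]
    exact ⟨h1, hm', h3.trans hm⟩
  · refine ⟨0, Submodule.zero_mem _, ?_⟩
    obtain ⟨i, hi, l, hl, hil, j, hj⟩ := hg.mul _ hm'
    have hle : Finsupp.single i 1 + Finsupp.single l 1 ≤ m' := by
      intro t
      rw [Finsupp.mem_support_iff] at hi hl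
      by_cases hti : t = i
      · subst hti
        simp [Ne.symm hil]
        omega
      · by_cases htl : t = l
        · subst htl
          simp [hil]
          omega
        · simp [Ne.symm hti, Ne.symm htl]
    obtain ⟨δ, hδ⟩ := exists_add_of_le hle
    have h5 : monomial m' (1 : ℝ) = monomial δ 1 * g j := by
      rw [hj, X, X, monomial_mul, monomial_mul, mul_one, mul_one, hδ, add_comm]
    have h6 : IdealBound g e (monomial m' 1) 1 := by
      rw [h5]
      refine IdealBound.mul_generator j ?_ fun m => by simpa using abs_coeff_monomial_le m δ 1
      rw [← h5]
      exact (totalDegree_monomial_le_degree _ _).trans (h3.trans hm)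
    have := h4.add h6
    rw [sub_add_cancel] at this
    rw [sub_zero]
    exact this.mono le_rfl (by linarith)

-- All subsets of a face are faces, so Möbius inversion with bound `0` recovers vanishing
-- coefficients from vanishing values.
omit [Fintype ι] in
theorem IsFlagSystem.eq_zero_of_mem (hg : IsFlagSystem 𝒞 g) {e : ℕ}
    {ν : MvPolynomial (Fin n) ℝ} (hν : ν ∈ restrictSupport ℝ (faceMonomials 𝒞 e))
    (h : ν ∈ pointVanishing 𝒞) : ν = 0 := by
  ext m
  rw [coeff_zero]
  by_contra hm
  have hmem := hν (mem_support_iff.2 hm)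
  have h1 := abs_le_of_abs_sum_powerset_le (M := 0) (c := fun V => coeff (sqfree V) ν) m.support
    fun z hz => by
      rw [← eval_point_eq_sum_powerset (p := ν) fun m' hm' => (hν hm').1,
        h z (hg.lower _ _ hz hmem.2.1), abs_zero]
  rw [mul_zero, ← eq_sqfree_support hmem.1] at h1
  exact hm (abs_nonpos_iff.1 h1)

open scoped Classical in
/-- The members of `𝒞` with at most `e` elements. -/
noncomputable def smallFaces (𝒞 : Set (Finset (Fin n))) (e : ℕ) : Finset (Finset (Fin n)) :=
  Finset.univ.filter fun z => z ∈ 𝒞 ∧ z.card ≤ e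

theorem mem_smallFaces {e : ℕ} {z : Finset (Fin n)} :
    z ∈ smallFaces 𝒞 e ↔ z ∈ 𝒞 ∧ z.card ≤ e := by
  simp [smallFaces]

theorem card_smallFaces_le (hn : 2 ≤ n) (e : ℕ) : ((smallFaces 𝒞 e).card : ℝ) ≤ (n : ℝ) ^ (2 * e) := by
  refine le_trans (Nat.cast_le.2 ?_) (card_monomialsUpTo_le hn e)
  refine Finset.card_le_card_of_injOn sqfree (fun z hz => ?_) fun z _ z' _ h => ?_
  · rw [Finset.mem_coe, mem_monomialsUpTo_iff_degree, degree_sqfree]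
    exact (mem_smallFaces.1 hz).2
  · rw [← support_sqfree z, h, support_sqfree]

-- Every small face carries weight at least `n ^ (-2d)`, so point values are controlled by the
-- second moment. Möbius inversion over the subsets of the support, all of them faces of size at
-- most `d`, passes to coefficients at a squared cost of `4 ^ d ≤ n ^ (2d)`.
omit [Fintype ι] in
theorem IsFlagSystem.sq_coeff_le (hg : IsFlagSystem 𝒞 g) (hn : 2 ≤ n) {d : ℕ}
    {p : MvPolynomial (Fin n) ℝ} (hp : p ∈ restrictSupport ℝ (faceMonomials 𝒞 d))
    (m : Fin n →₀ ℕ) :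
    coeff m p ^ 2 ≤ (n : ℝ) ^ (10 * d) * supportMean 1 (smallFaces 𝒞 d) (p ^ 2) := by
  have hn2 : (2 : ℝ) ≤ n := by exact_mod_cast hn
  have hn1 : (1 : ℝ) ≤ n := by linarith
  have hpt : ∀ z ∈ smallFaces 𝒞 d, eval (point z) p ^ 2 ≤
      (smallFaces 𝒞 d).card * supportMean 1 (smallFaces 𝒞 d) (p ^ 2) :=
    fun z hz => sq_eval_le_supportMean_sq hz p
  have h0 := hpt ∅ (mem_smallFaces.2 ⟨hg.empty, by simp⟩)
  have hcard : ((smallFaces 𝒞 d).card : ℝ) ≤ (n : ℝ) ^ (2 * d) := card_smallFaces_le hn d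
  have hpos : 0 < ((smallFaces 𝒞 d).card : ℝ) := by
    exact_mod_cast Finset.card_pos.2 ⟨∅, mem_smallFaces.2 ⟨hg.empty, by simp⟩⟩
  have hL0 := nonneg_of_mul_nonneg_right ((sq_nonneg _).trans h0) hpos
  set L := supportMean 1 (smallFaces 𝒞 d) (p ^ 2) with hL
  by_cases hm : coeff m p = 0
  · rw [hm]
    simpa using mul_nonneg (pow_nonneg (by linarith) (10 * d)) hL0
  · have hmem := hp (mem_support_iff.2 hm)
    have h1 := abs_le_of_abs_sum_powerset_le (M := Real.sqrt ((smallFaces 𝒞 d).card * L))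
      (c := fun V => coeff (sqfree V) p) m.support fun z hz => by
        rw [← eval_point_eq_sum_powerset (p := p) fun m' hm' => (hp hm').1]
        refine Real.abs_le_sqrt (hpt z (mem_smallFaces.2 ⟨hg.lower _ _ hz hmem.2.1, ?_⟩))
        refine (Finset.card_le_card hz).trans ?_
        rw [← degree_sqfree, ← eq_sqfree_support hmem.1]
        exact hmem.2.2
    rw [← degree_sqfree, ← eq_sqfree_support hmem.1] at h1
    have h2 := pow_le_pow_left₀ (abs_nonneg _) h1 2
    rw [sq_abs, mul_pow, Real.sq_sqrt (by positivity)] at h2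
    have h3 : ((2 : ℝ) ^ m.degree) ^ 2 ≤ (n : ℝ) ^ (2 * d) := by
      rw [← pow_mul]
      calc (2 : ℝ) ^ (m.degree * 2) ≤ (n : ℝ) ^ (m.degree * 2) := by gcongr
        _ ≤ (n : ℝ) ^ (2 * d) := pow_le_pow_right₀ hn1 (by have := hmem.2.2; omega)
    calc coeff m p ^ 2 ≤ (n : ℝ) ^ (2 * d) * ((n : ℝ) ^ (2 * d) * L) := by
          refine h2.trans ?_
          gcongr
      _ = (n : ℝ) ^ (4 * d) * L := by rw [← mul_assoc, ← pow_add]; congr 2; ring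
      _ ≤ (n : ℝ) ^ (10 * d) * L :=
          mul_le_mul_of_nonneg_right (pow_le_pow_right₀ hn1 (by omega)) hL0

/-- Averaging over faces of size at most `d` suffices, since only polynomials of degree at most `d`
are squared. There are few enough of them that no point has too small a weight, and `L` still kills
everything vanishing on all faces. -/
theorem IsFlagSystem.hasNormalForms (hg : IsFlagSystem 𝒞 g) (hn : 2 ≤ n) {d : ℕ} (hd : 1 ≤ d) :
    HasNormalForms g d 10 (pointVanishing 𝒞) (restrictSupport ℝ (faceMonomials 𝒞 (2 * d)))
      (supportMean 1 (smallFaces 𝒞 d)) where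
  le_W := hg.truncIdeal_le _
  L_one := supportMean_one ⟨∅, mem_smallFaces.2 ⟨hg.empty, by simp⟩⟩
  L_mem h hh _ := by
    rw [supportMean_one_eq, Finset.sum_eq_zero, zero_div]
    exact fun z hz => hh z (mem_smallFaces.1 hz).1
  L_bound m _ := (abs_supportMean_monomial_le m).trans (one_le_natCast_pow (by omega) _)
  red p hp := by
    obtain ⟨p', hp'N, hp'd, hp'm⟩ := exists_sub_mem_truncIdeal (g := g) (e := d) (fun m hm => by
      obtain ⟨ν, h1, h2⟩ := hg.exists_normalForm m hm
      exact ⟨ν, h1, h2.mem⟩) hp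
    exact ⟨p', hp'd, hg.truncIdeal_le _ (sq_sub_sq_mem_truncIdeal hp hp'd hp'm),
      hg.sq_coeff_le hn hp'N⟩
  nf m hm := by
    obtain ⟨ν, h1, h2⟩ := hg.exists_normalForm m hm
    refine ⟨ν, h1, hg.truncIdeal_le _ h2.mem, (h2.mono le_rfl ?_).twoSidedBound (by positivity)⟩
    refine le_trans ?_ (two_mul_add_pow_le hn hd (le_refl (2 * d)))
    gcongr
    exact one_le_pow₀ (by linarith [n.cast_nonneg (α := ℝ)])
  indep ν hν hmem := hg.eq_zero_of_mem hν hmem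
  bd α hα := by
    refine isSoSMod_natPow_sub_monomial (hg.truncIdeal_le _) (by omega) (by norm_num)
      (fun i => one_sub_X_sq_isSoSMod (by exact_mod_cast (by omega : 1 ≤ n)) i ?_) hα
    obtain ⟨j, hj⟩ := hg.pow i
    have := (IdealBound.mul_generator (g := g) (e := 2) (q := C 1) (B := 1) j ?_ ?_).mem
    · rwa [hj, C_1, one_mul] at this
    · rw [hj, C_1, one_mul]
      exact totalDegree_sub_le (by simp) (by simp)
    · intro m
      simpa using abs_coeff_monomial_le m 0 1

end Flag

theorem boolCube_isFlagSystem : IsFlagSystem Set.univ (boolCube n) where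
  empty := Set.mem_univ _
  lower _ _ _ _ := Set.mem_univ _
  pow i := ⟨i, rfl⟩
  mul V hV := absurd (Set.mem_univ V) hV
  vanish z _ i := by
    simp only [boolCube, map_sub, map_pow, eval_X, point]
    split_ifs <;> simp

theorem cliqueSystem_isFlagSystem (G : SimpleGraph (Fin n)) :
    IsFlagSystem {z : Finset (Fin n) | G.IsClique z} (cliqueSystem G) where
  empty := by simp
  lower U V hUV hV := SimpleGraph.IsClique.subset (Finset.coe_subset.2 hUV) hV
  pow i := ⟨Sum.inl i, rfl⟩
  mul V hV := by
    simp only [Set.mem_ofPred_eq, SimpleGraph.isClique_iff, Set.Pairwise, not_forall] at hV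
    obtain ⟨i, hi, l, hl, hil, hadj⟩ := hV
    rcases lt_or_gt_of_ne hil with h | h
    · exact ⟨i, hi, l, hl, hil, Sum.inr ⟨(i, l), h, hadj⟩, rfl⟩
    · exact ⟨l, hl, i, hi, hil.symm, Sum.inr ⟨(l, i), h, fun h' => hadj h'.symm⟩, rfl⟩
  vanish z hz j := by
    rcases j with i | ⟨⟨i, l⟩, h, hadj⟩
    · exact boolCube_isFlagSystem.vanish z (Set.mem_univ _) i
    · simp only [cliqueSystem, Sum.elim_inr, map_mul, eval_X, point]
      by_cases hi : i ∈ z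
      · have hl : l ∉ z := fun hl => hadj (hz hi hl h.ne)
        simp [hl]
      · simp [hi]

end SoSBound

/-! ### The unit sphere, via Gaussian moments and Hermite polynomials. -/

namespace SoSBound

section Hermite

open scoped Nat

/-- The moments of the standard Gaussian distribution. -/
noncomputable def gaussianMoment : ℕ → ℝ
  | 0 => 1
  | 1 => 0
  | j + 2 => (j + 1) * gaussianMoment j

theorem gaussianMoment_nonneg (j : ℕ) : 0 ≤ gaussianMoment j := by
  induction j using Nat.twoStepInduction with
  | zero => simp [gaussianMoment]
  | one => simp [gaussianMoment]
  | more j ih _ =>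
    rw [gaussianMoment]
    positivity

theorem gaussianMoment_of_odd {j : ℕ} (hj : Odd j) : gaussianMoment j = 0 := by
  obtain ⟨t, rfl⟩ := hj
  induction t with
  | zero => simp [gaussianMoment]
  | succ t ih =>
    rw [show 2 * (t + 1) + 1 = 2 * t + 1 + 2 by ring, gaussianMoment, ih, mul_zero]

/-- The coefficients of `x ^ a` in the basis of the probabilists' Hermite polynomials. -/
noncomputable def hermiteCoeff : ℕ → ℕ → ℝ
  | 0, c => if c = 0 then 1 else 0
  | a + 1, 0 => hermiteCoeff a 1
  | a + 1, c + 1 => hermiteCoeff a c + (c + 2) * hermiteCoeff a (c + 2)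

theorem hermiteCoeff_of_lt {a : ℕ} : ∀ {c : ℕ}, a < c → hermiteCoeff a c = 0 := by
  induction a with
  | zero =>
    intro c hc
    rw [hermiteCoeff, if_neg (by omega)]
  | succ a ih =>
    intro c hc
    obtain ⟨c, rfl⟩ : ∃ c', c = c' + 1 := ⟨c - 1, by omega⟩
    rw [hermiteCoeff, ih (by omega), ih (by omega), mul_zero, add_zero]

theorem hermiteCoeff_self (a : ℕ) : hermiteCoeff a a = 1 := by
  induction a with
  | zero => simp [hermiteCoeff]
  | succ a ih => rw [hermiteCoeff, ih, hermiteCoeff_of_lt (by omega), mul_zero, add_zero]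

theorem hermiteCoeff_of_odd {a : ℕ} : ∀ {c : ℕ}, Odd (a + c) → hermiteCoeff a c = 0 := by
  induction a with
  | zero =>
    intro c hc
    rw [hermiteCoeff, if_neg]
    rintro rfl
    simp at hc
  | succ a ih =>
    intro c hc
    rcases c with _ | c
    · rw [hermiteCoeff, ih (by simpa using hc)]
    · rw [hermiteCoeff, ih (by grind), ih (by grind), mul_zero, add_zero]

/-- Comparison of coefficients after differentiating the expansion of `x^(a+1)`, using that the
derivative of the Hermite polynomial of degree `c + 1` is `c + 1` times the one of degree `c`. -/
theorem succ_mul_hermiteCoeff (a : ℕ) :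
    ∀ c : ℕ, ((c : ℝ) + 1) * hermiteCoeff (a + 1) (c + 1) = (a + 1) * hermiteCoeff a c := by
  induction a with
  | zero =>
    intro c
    rcases c with _ | c
    · simp [hermiteCoeff]
    · simp [hermiteCoeff]
  | succ a ih =>
    intro c
    have h1 := ih (c + 1)
    rw [hermiteCoeff]
    push_cast at h1 ⊢
    rcases c with _ | c
    · have h2 : hermiteCoeff (a + 1) 0 = hermiteCoeff a 1 := by rw [hermiteCoeff]
      push_cast at h1 ⊢
      rw [h2]
      norm_num at h1 ⊢
      linear_combination h1
    · have h2 := ih c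
      have h3 : hermiteCoeff (a + 1) (c + 1) =
          hermiteCoeff a c + (c + 2) * hermiteCoeff a (c + 2) := by rw [hermiteCoeff]
      push_cast at h1 ⊢
      linear_combination ((c : ℝ) + 2) * h1 + h2 - (a + 1) * h3

theorem hermiteCoeff_zero_eq (j : ℕ) : hermiteCoeff j 0 = gaussianMoment j := by
  induction j using Nat.twoStepInduction with
  | zero => simp [hermiteCoeff, gaussianMoment]
  | one => simp [hermiteCoeff, gaussianMoment]
  | more j ih _ =>
    have h := succ_mul_hermiteCoeff j 0
    rw [gaussianMoment, ← ih, hermiteCoeff]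
    simpa using h

/-- The right side is symmetric in `a` and `b`: multiplication by `x` is self-adjoint for the
Hermite inner product. -/
theorem sum_hermiteCoeff_succ {a b N : ℕ} (ha : a ≤ N) :
    ∑ c ∈ Finset.range (N + 1), (c ! : ℝ) * hermiteCoeff (a + 1) c * hermiteCoeff b c =
      ∑ c ∈ Finset.range N, ((c + 1)! : ℝ) *
        (hermiteCoeff a c * hermiteCoeff b (c + 1) + hermiteCoeff a (c + 1) * hermiteCoeff b c) := by
  have h1 : ∑ c ∈ Finset.range (N + 1), ((c + 1)! : ℝ) * (hermiteCoeff a (c + 1) * hermiteCoeff b c) =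
      ∑ c ∈ Finset.range N, ((c + 1)! : ℝ) * (hermiteCoeff a (c + 1) * hermiteCoeff b c) := by
    rw [Finset.sum_range_succ, hermiteCoeff_of_lt (by omega : a < N + 1), zero_mul, mul_zero,
      add_zero]
  simp only [mul_add, Finset.sum_add_distrib]
  rw [← h1, Finset.sum_range_succ', Finset.sum_range_succ' (fun c => ((c + 1)! : ℝ) * _),
    ← add_assoc, ← Finset.sum_add_distrib]
  congr 1
  · refine Finset.sum_congr rfl fun c _ => ?_
    rw [hermiteCoeff, Nat.factorial_succ (c + 1)]
    push_cast
    ring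
  · rw [hermiteCoeff]
    simp

/-- Parseval's identity for the Gaussian measure, where the squared norm of the Hermite polynomial
of degree `c` is `c!`. Self-adjointness moves one factor `x` at a time from the first power to the
second, until the constant coefficient remains. -/
theorem sum_hermiteCoeff_mul (a : ℕ) : ∀ {b N : ℕ}, a + b ≤ N →
    ∑ c ∈ Finset.range (N + 1), (c ! : ℝ) * hermiteCoeff a c * hermiteCoeff b c =
      gaussianMoment (a + b) := by
  induction a with
  | zero =>
    intro b N _
    rw [Finset.sum_eq_single 0]
    · simp [hermiteCoeff, hermiteCoeff_zero_eq]
    · intro c _ hc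
      simp [hermiteCoeff, hc]
    · simp
  | succ a ih =>
    intro b N hN
    have h := ih (b := b + 1) (N := N) (by omega)
    rw [show a + 1 + b = a + (b + 1) by ring, ← h, sum_hermiteCoeff_succ (by omega)]
    have h2 : ∑ c ∈ Finset.range (N + 1), (c ! : ℝ) * hermiteCoeff a c * hermiteCoeff (b + 1) c =
        ∑ c ∈ Finset.range (N + 1), (c ! : ℝ) * hermiteCoeff (b + 1) c * hermiteCoeff a c :=
      Finset.sum_congr rfl fun c _ => by ring
    rw [h2, sum_hermiteCoeff_succ (by omega)]
    exact Finset.sum_congr rfl fun c _ => by ring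

end Hermite

variable {n : ℕ}

/-- The normalization `n (n + 2) ⋯ (n + 2 t - 2)` of the moments of the unit sphere. -/
def sphereNorm (n t : ℕ) : ℝ := ∏ j ∈ Finset.range t, ((n : ℝ) + 2 * j)

theorem sphereNorm_pos (hn : 1 ≤ n) (t : ℕ) : 0 < sphereNorm n t := by
  have : (0 : ℝ) < n := by exact_mod_cast hn
  exact Finset.prod_pos fun j _ => by positivity

/-- The moments of the uniform distribution on the unit sphere. -/
noncomputable def sphereMoment (m : Fin n →₀ ℕ) : ℝ :=
  (∏ i, gaussianMoment (m i)) / sphereNorm n (m.degree / 2)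

/-- The expectation with respect to the uniform distribution on the unit sphere. -/
noncomputable def sphereMean (n : ℕ) : MvPolynomial (Fin n) ℝ →ₗ[ℝ] ℝ :=
  functionalOfMoments sphereMoment

theorem sphereMean_monomial (m : Fin n →₀ ℕ) (c : ℝ) :
    sphereMean n (monomial m c) = c * sphereMoment m :=
  functionalOfMoments_monomial _ m c

theorem prod_gaussianMoment_of_odd {m : Fin n →₀ ℕ} (hm : Odd m.degree) :
    ∏ i, gaussianMoment (m i) = 0 := by
  by_contra h
  rw [Finset.prod_eq_zero_iff] at h
  push Not at h
  rw [Finsupp.degree_eq_sum] at hm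
  refine Nat.not_odd_iff_even.2 (Finset.even_sum _ fun i hi => ?_) hm
  by_contra hi'
  exact h i hi (gaussianMoment_of_odd (Nat.not_even_iff_odd.1 hi'))

theorem prod_gaussianMoment_add_single (m : Fin n →₀ ℕ) (i : Fin n) :
    ∏ l, gaussianMoment ((m + Finsupp.single i 2 : Fin n →₀ ℕ) l) =
      (m i + 1) * ∏ l, gaussianMoment (m l) := by
  rw [← Finset.mul_prod_erase _ _ (Finset.mem_univ i), ← Finset.mul_prod_erase _
    (fun l => gaussianMoment (m l)) (Finset.mem_univ i), ← mul_assoc]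
  congr 1
  · simp [gaussianMoment]
  · refine Finset.prod_congr rfl fun l hl => ?_
    simp [Finset.ne_of_mem_erase hl]

/-- Raising exponent `i` by `2` multiplies the Gaussian moment by `mᵢ + 1`. These factors add up to
`n + deg m`, which in even degree is the next factor of the normalization; in odd degree both sides
vanish. -/
theorem sum_sphereMoment_add_single (hn : 1 ≤ n) (m : Fin n →₀ ℕ) :
    ∑ i, sphereMoment (m + Finsupp.single i 2) = sphereMoment m := by
  simp only [sphereMoment, prod_gaussianMoment_add_single, map_add, Finsupp.degree_single]
  rw [← Finset.sum_div, ← Finset.sum_mul]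
  by_cases hm : Odd m.degree
  · rw [prod_gaussianMoment_of_odd hm, mul_zero, zero_div, zero_div]
  · obtain ⟨t, ht⟩ := Nat.not_odd_iff_even.1 hm
    have h1 : (∑ i, ((m i : ℝ) + 1)) = n + 2 * t := by
      rw [Finset.sum_add_distrib, ← Nat.cast_sum, ← Finsupp.degree_eq_sum, ht]
      simp
      ring
    have h2 : (m.degree + 2) / 2 = t + 1 := by omega
    have h3 : m.degree / 2 = t := by omega
    have h4 := (sphereNorm_pos hn t).ne'
    have h5 : (n : ℝ) + 2 * t ≠ 0 := by
      have : (0 : ℝ) < n := by exact_mod_cast hn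
      positivity
    rw [h1, h2, h3, sphereNorm, Finset.prod_range_succ, ← sphereNorm]
    field_simp

theorem sphereMoment_nonneg (hn : 1 ≤ n) (m : Fin n →₀ ℕ) : 0 ≤ sphereMoment m :=
  div_nonneg (Finset.prod_nonneg fun _ _ => gaussianMoment_nonneg _) (sphereNorm_pos hn _).le

theorem sphereMoment_zero : sphereMoment (0 : Fin n →₀ ℕ) = 1 := by
  simp [sphereMoment, gaussianMoment, sphereNorm]

/-- A moment with some exponent at least `2` is one of several nonnegative terms adding up to a
moment of lower degree. The descent ends at the moment `1` or at an exponent `1`, where the moment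
is zero. -/
theorem sphereMoment_le_one (hn : 1 ≤ n) (m : Fin n →₀ ℕ) : sphereMoment m ≤ 1 := by
  induction hj : m.degree using Nat.strong_induction_on generalizing m with
  | _ j ih =>
    by_cases h : ∃ i, 2 ≤ m i
    · obtain ⟨i, hi⟩ := h
      obtain ⟨m', rfl⟩ := exists_eq_add_single hi
      rw [map_add, Finsupp.degree_single] at hj
      refine le_trans ?_ (ih m'.degree (by omega) m' rfl)
      rw [← sum_sphereMoment_add_single hn m']
      exact Finset.single_le_sum (f := fun i => sphereMoment (m' + Finsupp.single i 2))
        (fun i _ => sphereMoment_nonneg hn _) (Finset.mem_univ i)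
    · push Not at h
      by_cases h0 : m = 0
      · rw [h0, sphereMoment_zero]
      · obtain ⟨i, hi⟩ := Finsupp.ne_iff.1 h0
        have h1 : m i = 1 := by
          have := h i
          simp at hi
          omega
        rw [sphereMoment, Finset.prod_eq_zero (Finset.mem_univ i), zero_div]
        · exact zero_le_one
        · rw [h1, gaussianMoment]

theorem sphereMean_mul_unitSphere (hn : 1 ≤ n) (j : Unit) (q : MvPolynomial (Fin n) ℝ) :
    sphereMean n (q * unitSphere n j) = 0 := by
  refine map_mul_eq_zero_of_monomial (fun m => ?_) q
  rw [unitSphere, mul_sub, mul_one, Finset.mul_sum, map_sub, map_sum]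
  simp only [monomial_mul_X_pow, sphereMean_monomial, one_mul]
  rw [sum_sphereMoment_add_single hn, sub_self]

/-- A nonzero product forces `γ ≤ m` with all differences even. A degree window of length `2` has no
room for such a difference, so the Hermite expansion is diagonal on top-degree normal forms. -/
theorem prod_hermiteCoeff {e : ℕ} {m γ : Fin n →₀ ℕ} (hm : m.degree ≤ e)
    (hγ : e < γ.degree + 2) : ∏ i, hermiteCoeff (m i) (γ i) = if m = γ then 1 else 0 := by
  split_ifs with h
  · rw [h, Finset.prod_eq_one fun i _ => hermiteCoeff_self _]
  · by_contra h0
    rw [Finset.prod_eq_zero_iff] at h0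
    push Not at h0
    have hle : ∀ i, γ i ≤ m i := fun i => by
      by_contra hlt
      exact h0 i (Finset.mem_univ i) (hermiteCoeff_of_lt (not_le.1 hlt))
    have hpar : ∀ i, Even (m i + γ i) := fun i => by
      by_contra hodd
      exact h0 i (Finset.mem_univ i) (hermiteCoeff_of_odd (Nat.not_even_iff_odd.1 hodd))
    obtain ⟨δ, rfl⟩ := exists_add_of_le (show γ ≤ m from hle)
    rw [map_add] at hm
    have hδ : δ ≠ 0 := fun h' => h (by rw [h', add_zero])
    obtain ⟨i, hi⟩ := Finsupp.ne_iff.1 hδ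
    have h1 := hpar i
    rw [Finsupp.add_apply] at h1
    have h2 : 2 ≤ δ i := by
      simp only [Finsupp.coe_zero, Pi.zero_apply] at hi
      grind
    have h3 := Finsupp.le_degree i δ
    omega

-- The two degrees in the window have opposite parity, so they are orthogonal. Scaling each by `ρ`,
-- the inverse square root of its normalization, turns spherical into Gaussian second moments. In
-- the Hermite expansion the square belonging to `γ` contains only the coefficient of `γ`, and the
-- others are dropped.
open scoped Nat in
theorem sq_coeff_mul_le_sphereMean_sq (hn : 1 ≤ n) {e : ℕ} {p : MvPolynomial (Fin n) ℝ}
    (hp : p ∈ restrictSupport ℝ {m : Fin n →₀ ℕ | m.degree ≤ e ∧ e < m.degree + 2})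
    {γ : Fin n →₀ ℕ} (hγ : γ ∈ p.support) :
    coeff γ p ^ 2 * (∏ i, ((γ i)! : ℝ)) ≤ sphereNorm n γ.degree * sphereMean n (p ^ 2) := by
  have hpos := sphereNorm_pos hn
  have hmem : ∀ m ∈ p.support, m.degree ≤ e ∧ e < m.degree + 2 := fun m hm => hp hm
  set ρ : (Fin n →₀ ℕ) → ℝ := fun m => (Real.sqrt (sphereNorm n m.degree))⁻¹ with hρ
  have hρ2 : ∀ m, ρ m * ρ m = (sphereNorm n m.degree)⁻¹ := fun m => by
    rw [hρ, ← mul_inv, Real.mul_self_sqrt (hpos _).le]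
  have hmoment : ∀ m ∈ p.support, ∀ m' ∈ p.support,
      sphereMoment (m + m') = ρ m * ρ m' * ∏ i, gaussianMoment (m i + m' i) := by
    intro m hm m' hm'
    have h1 := hmem m hm
    have h2 := hmem m' hm'
    by_cases h : m.degree = m'.degree
    · have h3 : ρ m' = ρ m := by simp only [hρ, h]
      rw [h3, hρ2, sphereMoment, map_add, ← h, ← two_mul, Nat.mul_div_cancel_left _ two_pos,
        div_eq_inv_mul]
      simp
    · have hodd : Odd (m + m').degree := by
        rw [map_add]
        grind
      have h3 := prod_gaussianMoment_of_odd hodd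
      rw [sphereMoment, h3, zero_div]
      simp only [Finsupp.add_apply] at h3
      rw [h3, mul_zero]
  have hprod : ∀ m ∈ p.support, ∀ m' ∈ p.support, ∏ i, gaussianMoment (m i + m' i) =
      ∑ c ∈ Fintype.piFinset fun _ : Fin n => Finset.range (2 * e + 1),
        (∏ i, ((c i)! : ℝ)) * (∏ i, hermiteCoeff (m i) (c i)) * ∏ i, hermiteCoeff (m' i) (c i) := by
    intro m hm m' hm'
    have h1 : ∀ i, gaussianMoment (m i + m' i) = ∑ c ∈ Finset.range (2 * e + 1),
        (c ! : ℝ) * hermiteCoeff (m i) c * hermiteCoeff (m' i) c := fun i => by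
      rw [sum_hermiteCoeff_mul]
      have e1 := (Finsupp.le_degree i m).trans (hmem m hm).1
      have e2 := (Finsupp.le_degree i m').trans (hmem m' hm').1
      omega
    rw [Finset.prod_congr rfl fun i _ => h1 i, Finset.prod_univ_sum]
    exact Finset.sum_congr rfl fun c _ => by
      rw [Finset.prod_mul_distrib, Finset.prod_mul_distrib]
  have hL : sphereMean n (p ^ 2) = ∑ c ∈ Fintype.piFinset fun _ : Fin n => Finset.range (2 * e + 1),
      (∏ i, ((c i)! : ℝ)) *
        (∑ m ∈ p.support, coeff m p * ρ m * ∏ i, hermiteCoeff (m i) (c i)) ^ 2 := by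
    rw [sphereMean, functionalOfMoments_sq]
    have h1 : ∀ m ∈ p.support, ∀ m' ∈ p.support, coeff m p * coeff m' p * sphereMoment (m + m') =
        ∑ c ∈ Fintype.piFinset fun _ : Fin n => Finset.range (2 * e + 1),
          (∏ i, ((c i)! : ℝ)) * ((coeff m p * ρ m * ∏ i, hermiteCoeff (m i) (c i)) *
            (coeff m' p * ρ m' * ∏ i, hermiteCoeff (m' i) (c i))) := by
      intro m hm m' hm'
      rw [hmoment m hm m' hm', hprod m hm m' hm', Finset.mul_sum, Finset.mul_sum]
      exact Finset.sum_congr rfl fun c _ => by ring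
    rw [Finset.sum_congr rfl fun m hm => Finset.sum_congr rfl fun m' hm' => h1 m hm m' hm',
      Finset.sum_congr rfl fun m _ => Finset.sum_comm, Finset.sum_comm]
    refine Finset.sum_congr rfl fun c _ => ?_
    rw [pow_two, Finset.sum_mul_sum, Finset.mul_sum]
    exact Finset.sum_congr rfl fun m _ => by rw [Finset.mul_sum]
  have hle : (∏ i, ((γ i)! : ℝ)) *
      (∑ m ∈ p.support, coeff m p * ρ m * ∏ i, hermiteCoeff (m i) (γ i)) ^ 2 ≤
        sphereMean n (p ^ 2) := by
    rw [hL]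
    refine Finset.single_le_sum (f := fun c : Fin n → ℕ => (∏ i, ((c i)! : ℝ)) *
        (∑ m ∈ p.support, coeff m p * ρ m * ∏ i, hermiteCoeff (m i) (c i)) ^ 2)
      (fun c _ => by positivity) (Fintype.mem_piFinset.2 fun i => Finset.mem_range.2 ?_)
    have := (Finsupp.le_degree i γ).trans (hmem γ hγ).1
    omega
  have hsum : ∑ m ∈ p.support, coeff m p * ρ m * ∏ i, hermiteCoeff (m i) (γ i) =
      coeff γ p * ρ γ := by
    rw [Finset.sum_eq_single γ]
    · rw [prod_hermiteCoeff (hmem γ hγ).1 (hmem γ hγ).2, if_pos rfl, mul_one]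
    · intro m hm hne
      rw [prod_hermiteCoeff (hmem m hm).1 (hmem γ hγ).2, if_neg hne, mul_zero]
    · exact fun h => absurd hγ h
  rw [hsum, mul_pow, pow_two (ρ γ), hρ2] at hle
  have h := mul_le_mul_of_nonneg_left hle (hpos γ.degree).le
  refine le_trans (le_of_eq ?_) h
  have := (hpos γ.degree).ne'
  field_simp

-- The multinomial coefficient is one term in the expansion of `(1 + ⋯ + 1) ^ deg`, hence at most `n
-- ^ deg`.
open scoped Nat in
theorem factorial_degree_le (γ : Fin n →₀ ℕ) : γ.degree ! ≤ n ^ γ.degree * ∏ i, (γ i)! := by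
  have h1 := Nat.multinomial_spec (Finset.univ : Finset (Fin n)) γ
  rw [← Finsupp.degree_eq_sum] at h1
  have h2 := Finset.sum_pow_eq_sum_piAntidiag (Finset.univ : Finset (Fin n))
    (fun _ => (1 : ℕ)) γ.degree
  simp only [Finset.sum_const, Finset.card_univ, Fintype.card_fin, smul_eq_mul, mul_one, one_pow,
    Finset.prod_const_one] at h2
  rw [← h1, h2, mul_comm]
  refine Nat.mul_le_mul_right _ ?_
  exact Finset.single_le_sum (f := fun c : Fin n → ℕ => Nat.multinomial Finset.univ c)
    (fun _ _ => Nat.zero_le _) (Finset.mem_piAntidiag.2 ⟨Finsupp.degree_eq_sum γ |>.symm, by simp⟩)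

-- Each factor satisfies `n + 2t ≤ (n + 2) (t + 1)`. Isolating the factorial matters when `d` is
-- large compared with `n`: it is cancelled by the factorials of the Hermite norms through
-- `factorial_degree_le`.
open scoped Nat in
theorem sphereNorm_le (n t : ℕ) : sphereNorm n t ≤ ((n : ℝ) + 2) ^ t * t ! := by
  induction t with
  | zero => simp [sphereNorm]
  | succ t ih =>
    rw [sphereNorm, Finset.prod_range_succ, ← sphereNorm, pow_succ, Nat.factorial_succ]
    push_cast
    calc sphereNorm n t * (n + 2 * t) ≤ ((n : ℝ) + 2) ^ t * t ! * ((n + 2) * (t + 1)) := by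
          refine mul_le_mul ih ?_ (by positivity) (by positivity)
          have : (0 : ℝ) ≤ n * t := by positivity
          linarith
      _ = _ := by ring

theorem sq_coeff_le_sphereMean_sq (hn : 2 ≤ n) {e : ℕ} {p : MvPolynomial (Fin n) ℝ}
    (hp : p ∈ restrictSupport ℝ {m : Fin n →₀ ℕ | m.degree ≤ e ∧ e < m.degree + 2})
    (m : Fin n →₀ ℕ) : coeff m p ^ 2 ≤ (n : ℝ) ^ (3 * e) * sphereMean n (p ^ 2) := by
  have hn2 : (2 : ℝ) ≤ n := by exact_mod_cast hn
  have hn1 : (1 : ℝ) ≤ n := by linarith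
  rcases p.support.eq_empty_or_nonempty with h0 | ⟨γ₀, hγ₀⟩
  · rw [support_eq_empty.1 h0]
    simp
  have hpos := sphereNorm_pos (n := n) (by omega)
  have hL0 : 0 ≤ sphereMean n (p ^ 2) := by
    refine nonneg_of_mul_nonneg_right (le_trans ?_
      (sq_coeff_mul_le_sphereMean_sq (by omega) hp hγ₀)) (hpos _)
    positivity
  by_cases hm : coeff m p = 0
  · rw [hm]
    simpa using mul_nonneg (pow_nonneg (by linarith) (3 * e)) hL0
  have hms := mem_support_iff.2 hm
  have h1 := sq_coeff_mul_le_sphereMean_sq (by omega) hp hms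
  have h2 : sphereNorm n m.degree ≤ (n : ℝ) ^ (3 * e) * ∏ i, ((m i).factorial : ℝ) := by
    have e1 : (m.degree.factorial : ℝ) ≤ (n : ℝ) ^ m.degree * ∏ i, ((m i).factorial : ℝ) := by
      exact_mod_cast factorial_degree_le m
    have e2 : (n : ℝ) + 2 ≤ (n : ℝ) ^ 2 := by nlinarith
    calc sphereNorm n m.degree ≤ ((n : ℝ) + 2) ^ m.degree * m.degree.factorial := sphereNorm_le _ _
      _ ≤ ((n : ℝ) ^ 2) ^ m.degree * ((n : ℝ) ^ m.degree * ∏ i, ((m i).factorial : ℝ)) := by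
          gcongr
      _ = (n : ℝ) ^ (3 * m.degree) * ∏ i, ((m i).factorial : ℝ) := by
          rw [← pow_mul, ← mul_assoc, ← pow_add]
          congr 2
          ring
      _ ≤ (n : ℝ) ^ (3 * e) * ∏ i, ((m i).factorial : ℝ) := by
          refine mul_le_mul_of_nonneg_right (pow_le_pow_right₀ hn1 ?_) (by positivity)
          have := (hp hms).1
          omega
  have h3 : 0 < ∏ i, ((m i).factorial : ℝ) :=
    Finset.prod_pos fun i _ => by exact_mod_cast (m i).factorial_pos
  refine le_of_mul_le_mul_right ?_ h3
  calc coeff m p ^ 2 * ∏ i, ((m i).factorial : ℝ) ≤ sphereNorm n m.degree * sphereMean n (p ^ 2) := h1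
    _ ≤ ((n : ℝ) ^ (3 * e) * ∏ i, ((m i).factorial : ℝ)) * sphereMean n (p ^ 2) := by gcongr
    _ = _ := by ring

theorem exists_sphere_normalForm {e : ℕ} (m : Fin n →₀ ℕ) (hm : m.degree ≤ e) :
    ∃ ν ∈ restrictSupport ℝ {m : Fin n →₀ ℕ | m.degree ≤ e ∧ e < m.degree + 2},
      IdealBound (unitSphere n) e (monomial m 1 - ν) (((n : ℝ) + 1) ^ (2 * e)) := by
  obtain ⟨ν, hν, hνb⟩ := exists_raised (g := unitSphere n) (a := 2) (by norm_num)
    (fun _ => True) (e := e) (fun m _ hme => by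
      -- On the sphere `x^m = ∑ᵢ x^m xᵢ²` over all indices with coefficient `1`, so no exponent
      -- reduction is needed.
      refine ⟨Finset.univ, 1, by simp, fun _ _ => trivial, ?_⟩
      have h1 : monomial m 1 - (1 : ℝ) • ∑ i, monomial (m + Finsupp.single i 2) 1 =
          (-monomial m 1) * unitSphere n () := by
        rw [unitSphere, one_smul, neg_mul, mul_sub, Finset.mul_sum, mul_one]
        simp only [monomial_mul_X_pow]
        ring
      rw [h1]
      refine IdealBound.mul_generator () ?_ fun m' => ?_
      · refine (totalDegree_mul_le (a := m.degree) (b := 2) ?_ ?_).trans hme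
        · rw [totalDegree_neg]
          exact totalDegree_monomial_le_degree _ _
        · exact totalDegree_sub_le (totalDegree_sum_le fun i _ => by simp) (by simp)
      · rw [coeff_neg, abs_neg]
        refine (abs_coeff_monomial_le _ _ _).trans ?_
        rw [abs_one]
        linarith [n.cast_nonneg (α := ℝ)]) m trivial hm
  refine ⟨ν, fun m' hm' => (hν hm').2, hνb.mono le_rfl (pow_le_pow_right₀ ?_ (by omega))⟩
  linarith [n.cast_nonneg (α := ℝ)]

theorem unitSphere_hasNormalForms (hn : 2 ≤ n) {d : ℕ} (hd : 1 ≤ d) :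
    HasNormalForms (unitSphere n) d 10 (truncIdeal (unitSphere n) (2 * d))
      (restrictSupport ℝ {m : Fin n →₀ ℕ | m.degree ≤ 2 * d ∧ 2 * d < m.degree + 2})
      (sphereMean n) where
  le_W := le_rfl
  L_one := by
    have h1 : (1 : MvPolynomial (Fin n) ℝ) = monomial 0 1 := rfl
    rw [h1, sphereMean_monomial, sphereMoment_zero, mul_one]
  L_mem h hh _ := map_eq_zero_of_mem_truncIdeal (sphereMean_mul_unitSphere (by omega)) hh
  L_bound m _ := by
    rw [sphereMean_monomial, one_mul, abs_of_nonneg (sphereMoment_nonneg (by omega) m)]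
    exact (sphereMoment_le_one (by omega) m).trans (one_le_natCast_pow (by omega) _)
  red p hp := by
    obtain ⟨p', hp'N, hp'd, hp'm⟩ := exists_sub_mem_truncIdeal (g := unitSphere n) (e := d)
      (fun m hm => by
        obtain ⟨ν, h1, h2⟩ := exists_sphere_normalForm m hm
        exact ⟨ν, h1, h2.mem⟩) hp
    refine ⟨p', hp'd, sq_sub_sq_mem_truncIdeal hp hp'd hp'm, fun m => ?_⟩
    have h1 := sq_coeff_le_sphereMean_sq hn hp'N
    have h0 := nonneg_of_mul_nonneg_right ((sq_nonneg _).trans (h1 0))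
      (pow_pos (by exact_mod_cast (by omega)) _)
    exact (h1 m).trans (mul_le_mul_of_nonneg_right
      (pow_le_pow_right₀ (by exact_mod_cast (by omega)) (by omega)) h0)
  nf m hm := by
    obtain ⟨ν, h1, h2⟩ := exists_sphere_normalForm m hm
    refine ⟨ν, h1, h2.mem, (h2.mono le_rfl ?_).twoSidedBound (by positivity)⟩
    refine le_trans ?_ (two_mul_add_pow_le hn hd (le_refl (2 * d)))
    exact le_add_of_nonneg_left (Nat.cast_nonneg _)
  indep ν hν hmem := by
    -- Independence comes from the coefficient bound itself: `L` kills every multiple of the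
    -- generator, so `L(ν²) = 0` and all coefficients of `ν` vanish.
    have h1 : sphereMean n (ν ^ 2) = 0 := by
      obtain ⟨q, -, h⟩ := hmem
      rw [pow_two]
      nth_rewrite 2 [h]
      rw [Finset.mul_sum, map_sum]
      exact Finset.sum_eq_zero fun j _ => by
        rw [← mul_assoc, sphereMean_mul_unitSphere (by omega)]
    ext m
    have h2 := sq_coeff_le_sphereMean_sq hn hν m
    rw [h1, mul_zero] at h2
    rw [coeff_zero]
    exact pow_eq_zero_iff (two_ne_zero) |>.1 (le_antisymm h2 (sq_nonneg _))
  bd α hα := by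
    refine isSoSMod_natPow_sub_monomial le_rfl (by omega) (by norm_num)
      (fun i => isSoSMod_const_sub_of_sum_sq (κ := 1) (by exact_mod_cast (by omega : 1 ≤ n)) ?_ i) hα
    have := (IdealBound.mul_generator (g := unitSphere n) (e := 2) (q := C 1) (B := 1) () ?_ ?_).mem
    · rwa [C_1, one_mul, unitSphere] at this
    · rw [C_1, one_mul]
      exact totalDegree_sub_le (totalDegree_sum_le fun i _ => by simp) (by simp)
    · intro m
      simpa using abs_coeff_monomial_le m 0 1

end SoSBound

/-! ### The individual systems and the final assembly. -/

namespace SoSBound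

variable {n : ℕ}

theorem X_pow_two_sub_X_ne_zero (i : Fin n) : (X i ^ 2 - X i : MvPolynomial (Fin n) ℝ) ≠ 0 := by
  intro h
  have := congrArg (eval fun _ => (2 : ℝ)) h
  simp at this
  norm_num at this

theorem boolCube_boundedSoS (hn : 2 ≤ n) {d : ℕ} (hd : 1 ≤ d) : BoundedSoS (boolCube n) d 52 :=
  (boolCube_isFlagSystem.hasNormalForms hn hd).boundedSoS hn hd

theorem affineSubst_half_boolCube (i : Fin n) :
    affineSubst n (1 / 2) (1 / 2) (boolCube n i) = C (1 / 4) * signCube n i := by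
  have h2 : (C (1 / 2) : MvPolynomial (Fin n) ℝ) * 2 = 1 := by
    rw [← map_ofNat (C : ℝ →+* MvPolynomial (Fin n) ℝ) 2, ← C_mul, ← C_1]
    norm_num
  have h4 : (C (1 / 4) : MvPolynomial (Fin n) ℝ) = C (1 / 2) * C (1 / 2) := by
    rw [← C_mul]
    norm_num
  rw [boolCube, signCube, map_sub, map_pow, affineSubst_X, h4]
  linear_combination ((C (1 / 2) : MvPolynomial (Fin n) ℝ) * (X i + 1)) * h2

theorem affineSubst_two_signCube (i : Fin n) :
    affineSubst n 2 (-1) (signCube n i) = C 4 * boolCube n i := by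
  rw [boolCube, signCube, map_sub, map_pow, map_one, affineSubst_X, C_neg, C_1, map_ofNat, map_ofNat]
  ring

theorem signCube_boundedSoS (hn : 2 ≤ n) {d : ℕ} (hd : 1 ≤ d) : BoundedSoS (signCube n) d 70 :=
  (boolCube_boundedSoS hn hd).of_affineSubst hn hd (a := 1 / 2) (b := 1 / 2) (a' := 2) (b' := -1)
    (by norm_num [abs_of_pos]) (by norm_num) (by norm_num) (by norm_num) (by norm_num)
    (Equiv.refl _) (u := fun _ => 1 / 4) (u' := fun _ => 4) (fun _ => by norm_num [abs_of_pos])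
    (fun _ => by norm_num) affineSubst_half_boolCube affineSubst_two_signCube
    X_pow_two_sub_X_ne_zero

theorem cliqueSystem_boundedSoS (hn : 2 ≤ n) {d : ℕ} (hd : 1 ≤ d) (G : SimpleGraph (Fin n))
    [DecidableRel G.Adj] : BoundedSoS (cliqueSystem G) d 52 :=
  ((cliqueSystem_isFlagSystem G).hasNormalForms hn hd).boundedSoS hn hd

theorem unitSphere_boundedSoS (hn : 2 ≤ n) {d : ℕ} (hd : 1 ≤ d) : BoundedSoS (unitSphere n) d 52 :=
  (unitSphere_hasNormalForms hn hd).boundedSoS hn hd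

theorem sparseTernaryCube_isSliceSystem (n k : ℕ) : IsSliceSystem 2 k (sparseTernaryCube n k) where
  pow i := ⟨Sum.inl i, rfl⟩
  sum := ⟨Sum.inr (), rfl⟩
  eq_or := by
    rintro (i | _)
    · exact Or.inl ⟨i, rfl⟩
    · exact Or.inr rfl

theorem sparseTernaryCube_boundedSoS (hn : 2 ≤ n) {d k : ℕ} (hd : 1 ≤ d) (hdk : 2 * d ≤ k)
    (hk : k + d / 2 ≤ n) : BoundedSoS (sparseTernaryCube n k) d 52 :=
  ((sparseTernaryCube_isSliceSystem n k).hasNormalForms hn (Or.inr rfl) (s := n - k) hd (by omega)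
    hdk (by omega)).boundedSoS hn hd

theorem sparseBoolCube_isSliceSystem (n k : ℕ) : IsSliceSystem 1 k (sparseBoolCube n k) where
  pow i := ⟨Sum.inl i, rfl⟩
  sum := ⟨Sum.inr (), by simp [sparseBoolCube]⟩
  eq_or := by
    rintro (i | _)
    · exact Or.inl ⟨i, rfl⟩
    · exact Or.inr (by simp [sparseBoolCube])

theorem sparseBoolCube_ne_zero (hn : 1 ≤ n) (k : ℕ) (j : Fin n ⊕ Unit) :
    sparseBoolCube n k j ≠ 0 := by
  rcases j with i | _
  · exact X_pow_two_sub_X_ne_zero i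
  · intro h
    have h1 := le_totalDegree_sum_X_pow_sub hn le_rfl (k : ℝ)
    simp only [pow_one] at h1
    rw [show (∑ i : Fin n, X i : MvPolynomial (Fin n) ℝ) - C (k : ℝ) = 0 from h,
      totalDegree_zero] at h1
    omega

theorem sparseBoolCube_boundedSoS_of_le (hn : 2 ≤ n) {d k : ℕ} (hd : 1 ≤ d) (hdk : 2 * d ≤ k)
    (hk : k + d ≤ n) : BoundedSoS (sparseBoolCube n k) d 52 :=
  ((sparseBoolCube_isSliceSystem n k).hasNormalForms hn (Or.inl rfl) (s := n - k) hd (by omega)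
    hdk (by omega)).boundedSoS hn hd

theorem sparseBoolCube_boundedSoS_of_lt (hn : 2 ≤ n) {d k : ℕ} (hd : 1 ≤ d) (hkn : k ≤ n)
    (hkd : k < d) : BoundedSoS (sparseBoolCube n k) d 52 :=
  ((sparseBoolCube_isSliceSystem n k).hasNormalForms_of_null hn (s := n - k) hd (by omega)
    (by omega) (Or.inl (by omega)) fun _ hm hkm hmd =>
      (sparseBoolCube_isSliceSystem n k).twoSidedBound_small hn hkd hm hkm hmd).boundedSoS hn hd

theorem sparseBoolCube_boundedSoS_middle (hn : 2 ≤ n) {d k : ℕ} (hd : 1 ≤ d) (hk : n = 2 * k) :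
    BoundedSoS (sparseBoolCube n k) d 52 := by
  by_cases hdk : 2 * d ≤ k
  · exact sparseBoolCube_boundedSoS_of_le hn hd hdk (by omega)
  -- Here `k < 2d` and `s = k`, so the alternative `k ≤ d ∨ d ≤ s` is automatic.
  · exact ((sparseBoolCube_isSliceSystem n k).hasNormalForms_of_null hn (s := k) hd (by omega)
      (by omega) (by omega) fun _ hm hkm hmd =>
        (sparseBoolCube_isSliceSystem n k).twoSidedBound_middle hk hm hkm hmd).boundedSoS hn hd

theorem affineSubst_neg_sparseBoolCube {k s : ℕ} (hks : k + s = n) (j : Fin n ⊕ Unit) :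
    affineSubst n (-1) 1 (sparseBoolCube n k j) =
      C (Sum.elim (fun _ => 1) (fun _ => -1) j) * sparseBoolCube n s j := by
  rcases j with i | _
  · simp only [sparseBoolCube, boolCube, Sum.elim_inl, map_sub, map_pow, affineSubst_X, C_neg, C_1]
    ring
  · have h : (C (k : ℝ) : MvPolynomial (Fin n) ℝ) + C (s : ℝ) =
        (n : MvPolynomial (Fin n) ℝ) := by
      rw [← C_add, ← Nat.cast_add, hks, map_natCast]
    simp only [sparseBoolCube, Sum.elim_inr, map_sub, map_sum, affineSubst_X, affineSubst_C, C_neg,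
      C_1, Finset.sum_add_distrib, Finset.sum_const, Finset.card_univ, Fintype.card_fin, nsmul_one,
      neg_mul, one_mul, Finset.sum_neg_distrib]
    linear_combination -h

/-- When `k + d > n` the coefficient bound on the slice is unavailable, but complementing `x ↦ 1 -
x` leads to the slice of size `n - k < d`, where the monomials above the slice size are certified to
be null. -/
theorem sparseBoolCube_boundedSoS (hn : 2 ≤ n) {d k : ℕ} (hd : 1 ≤ d) (hdk : 2 * d ≤ k)
    (hk : k ≤ n) : BoundedSoS (sparseBoolCube n k) d 70 := by
  by_cases h : k + d ≤ n
  · exact (sparseBoolCube_boundedSoS_of_le hn hd hdk h).mono (by omega) (by norm_num)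
  · have hu : ∀ j : Fin n ⊕ Unit, |(Sum.elim (fun _ => 1) (fun _ => -1) j : ℝ)| ≤ 4 := by
      rintro (i | _) <;> norm_num
    exact (sparseBoolCube_boundedSoS_of_lt hn (k := n - k) hd (by omega) (by omega)).of_affineSubst
      hn hd (a := -1) (b := 1) (a' := -1) (b' := 1) (by norm_num) (by norm_num) (by norm_num)
      (by norm_num) (by norm_num) (Equiv.refl _) hu hu
      (affineSubst_neg_sparseBoolCube (by omega)) (affineSubst_neg_sparseBoolCube (by omega))
      (sparseBoolCube_ne_zero (by omega) _)

theorem affineSubst_half_sparseBoolCube {k : ℕ} (hk : n = 2 * k) (j : Fin n ⊕ Unit) :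
    affineSubst n (1 / 2) (1 / 2) (sparseBoolCube n k j) =
      C (Sum.elim (fun _ => 1 / 4) (fun _ => 1 / 2) j) * balancedCube n j := by
  rcases j with i | _
  · exact affineSubst_half_boolCube i
  · have h : (C (k : ℝ) : MvPolynomial (Fin n) ℝ) =
        (n : MvPolynomial (Fin n) ℝ) * C (1 / 2) := by
      have hk' : (n : ℝ) = 2 * k := by exact_mod_cast hk
      rw [← map_natCast (C : ℝ →+* MvPolynomial (Fin n) ℝ) n, ← C_mul, hk']
      congr 1
      ring
    simp only [sparseBoolCube, balancedCube, Sum.elim_inr, map_sub, map_sum, affineSubst_X,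
      affineSubst_C, Finset.sum_add_distrib, Finset.sum_const, Finset.card_univ, Fintype.card_fin,
      nsmul_eq_mul, ← Finset.mul_sum]
    rw [h]
    ring

theorem affineSubst_two_balancedCube {k : ℕ} (hk : n = 2 * k) (j : Fin n ⊕ Unit) :
    affineSubst n 2 (-1) (balancedCube n j) =
      C (Sum.elim (fun _ => 4) (fun _ => 2) j) * sparseBoolCube n k j := by
  rcases j with i | _
  · exact affineSubst_two_signCube i
  · have h : (n : MvPolynomial (Fin n) ℝ) = 2 * C (k : ℝ) := by
      rw [map_natCast]
      exact_mod_cast hk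
    simp only [sparseBoolCube, balancedCube, Sum.elim_inr, map_sum, affineSubst_X, C_neg, C_1,
      Finset.sum_add_distrib, Finset.sum_const, Finset.card_univ, Fintype.card_fin,
      nsmul_eq_mul, ← Finset.mul_sum, map_ofNat, mul_neg, mul_one]
    linear_combination -h

/-- The substitution `x = (1 + y) / 2` identifies the balanced sign cube with the middle Boolean
slice. -/
theorem balancedCube_boundedSoS (hn : 2 ≤ n) {d : ℕ} (hd : 1 ≤ d) (h : Even n) :
    BoundedSoS (balancedCube n) d 70 := by
  obtain ⟨k, hk⟩ := h
  rw [← two_mul] at hk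
  refine (sparseBoolCube_boundedSoS_middle hn hd hk).of_affineSubst hn hd (a := 1 / 2) (b := 1 / 2)
    (a' := 2) (b' := -1) (by norm_num [abs_of_pos]) (by norm_num) (by norm_num) (by norm_num)
    (by norm_num) (Equiv.refl _) ?_ ?_ (affineSubst_half_sparseBoolCube hk)
    (affineSubst_two_balancedCube hk) (sparseBoolCube_ne_zero (by omega) k)
  · rintro (i | _) <;> norm_num [abs_of_pos]
  · rintro (i | _) <;> norm_num

theorem abs_coeff_sum_X_le (m : Fin n →₀ ℕ) :
    |coeff m (∑ i, X i : MvPolynomial (Fin n) ℝ)| ≤ 1 := by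
  rw [coeff_sum]
  by_cases h : ∃ i, Finsupp.single i 1 = m
  · obtain ⟨i, rfl⟩ := h
    rw [Finset.sum_eq_single i]
    · simp
    · intro l _ hl
      rw [coeff_X, if_neg]
      exact fun h => hl ((Finsupp.single_left_injective one_ne_zero) h)
    · exact fun h => absurd (Finset.mem_univ i) h
  · rw [Finset.sum_eq_zero]
    · simp
    · intro i _
      rw [coeff_X, if_neg]
      exact fun h' => h ⟨i, h'⟩

end SoSBound

theorem mainTheorem12 :
    ∀ K : ℕ, ∃ K' : ℕ, ∀ n d : ℕ, 2 ≤ n → 1 ≤ d →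
      (∀ f : MvPolynomial (Fin n) ℝ, f.totalDegree ≤ 2 * d →
        (∀ m, |MvPolynomial.coeff m f| ≤ (n : ℝ) ^ (K * d)) →
        HasBoundedSoSProof (boolCube n) f d ((n : ℝ) ^ (K' * d)) ∧
        HasBoundedSoSProof (signCube n) f d ((n : ℝ) ^ (K' * d)) ∧
        (Even n → HasBoundedSoSProof (balancedCube n) f d ((n : ℝ) ^ (K' * d))) ∧
        HasBoundedSoSProof (unitSphere n) f d ((n : ℝ) ^ (K' * d)) ∧
        (∀ k : ℕ, 2 * d ≤ k → k ≤ n →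
          HasBoundedSoSProof (sparseBoolCube n k) f d ((n : ℝ) ^ (K' * d))) ∧
        (∀ k : ℕ, 2 * d ≤ k → k + d / 2 ≤ n →
          HasBoundedSoSProof (sparseTernaryCube n k) f d ((n : ℝ) ^ (K' * d)))) ∧
      (∀ (G : SimpleGraph (Fin n)) [DecidableRel G.Adj],
        HasBoundedSoSProof (cliqueSystem G) (∑ i, MvPolynomial.X i) d ((n : ℝ) ^ (K' * d))) := by
  intro K
  -- The largest constant is `70 = 52 + 18`: the criterion with `r = 10`, followed by one affine
  -- substitution.
  refine ⟨K + 70, fun n d hn hd => ⟨fun f hf hF => ⟨?_, ?_, fun he => ?_, ?_, fun k hdk hk => ?_,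
    fun k hdk hk => ?_⟩, fun G _ => ?_⟩⟩
  · exact (SoSBound.boolCube_boundedSoS hn hd).mono (by omega) (by norm_num) K f hf hF
  · exact SoSBound.signCube_boundedSoS hn hd K f hf hF
  · exact SoSBound.balancedCube_boundedSoS hn hd he K f hf hF
  · exact (SoSBound.unitSphere_boundedSoS hn hd).mono (by omega) (by norm_num) K f hf hF
  · exact SoSBound.sparseBoolCube_boundedSoS hn hd hdk hk K f hf hF
  · exact (SoSBound.sparseTernaryCube_boundedSoS hn hd hdk hk).mono (by omega) (by norm_num) K f hf hF
  -- The clique objective has coefficients at most `1 = n ^ (0 · d)`, so it is an instance with `K =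
  -- 0`.
  · refine ((SoSBound.cliqueSystem_boundedSoS hn hd G) 0 _ ?_ fun m => ?_).mono
      (pow_le_pow_right₀ (by exact_mod_cast (by omega : 1 ≤ n))
        (Nat.mul_le_mul_right d (by omega)))
    · exact (SoSBound.totalDegree_sum_le fun i _ => (totalDegree_X i).le).trans (by omega)
    · rw [zero_mul, pow_zero]
      exact SoSBound.abs_coeff_sum_X_le m
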